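/- **Setting.** Let $B=\{B_{xt};\,x\in\mathbb R,\,t\ge0\}$ be a Brownian sheet (two-sided in $x$, i.e. a centred Gaussian field with continuous paths and $\mathbb E B_{xt}B_{ys}=\min(t,s)\,(|x|+|y|-|x-y|)/2$) on a complete probability space $(\Omega,\mathcal F,\mathbb P)$, let $x_0\in\mathbb R$, and write $\mathscr D=C_c^\infty((0,\infty))$. Put $$g(y,s;x,t)=\frac{1}{\sqrt{4\pi(t-s)}}\exp\Big\{-\frac{(x-y)^2}{4(t-s)}\Big\}\mathbf 1_{(s,\infty)}(t)$$ and, for $x\in\mathbb R$, $h\in\mathscr D$, define the stochastic integrals over $\mathbb R\times(0,\infty)$ $$U(x,h)=\iint B(dy,ds)\Big[\int_0^\infty g(y,s;x,t)h(t)\,dt\Big],\qquad \partial_1U(x,h)=\iint B(dy,ds)\Big[\int_0^\infty \partial_3g(y,s;x,t)h(t)\,dt\Big].$$ For a function $l$ on $[0,\infty)$ let $l^a$ be its antisymmetric extension to $\mathbb R$ ($l^a(0)=0$, $l^a(t)=l(t)$ and $l^a(-t)=-l(t)$ for $t>0$), and let $\langle\cdot\,;\cdot\rangle$ be the scalar product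 of $L^2([0,\infty))$. For $\alpha>3/2$ let $C_{0,\alpha}=\{h\in C([0,\infty)):h(t)(1+t)^\alpha\to0,\ t\to\infty\}$ with norm $\sup_{t\ge0}|h(t)(1+t)^\alpha|$, and let $E_1$ be the set of those $u\in(C_{0,\alpha})'$ that are given by integration against a continuous function $u$ on $[0,\infty)$ with $u(0)=0$, with the norm of $(C_{0,\alpha})'$. For $\varepsilon>0$, a smooth $\mathfrak w:\mathbb R\to\mathbb R$ with $\mathfrak w(t)\ge1+|t|^{1/2+\varepsilon}$ for all $t$ and equality outside a bounded neighbourhood of $0$, and $\beta>1/4$, let $H^a_{\mathfrak w,\beta}=\{l\in L^2([0,\infty)):\mathfrak w\,l^a\in H_\beta\}$, where $H_\beta$ is the Sobolev space of those $f\in L^2(\mathbb R)$ whose Fourier transform $f^F$ satisfies $\|f\|_{H_\beta}=\|(1+|\cdot|^2)^{\beta/2}f^F\|_{L^2(\mathbb R)}<\infty$; let $H^a_{\mathfrak w,\beta}$ have the norm $\|\mathfrak w\,l^a\|_{H_\beta}$ (up to a normalising constant), and let $E_2=(H^a_{\mathfrak w,\beta})'$ with the dual norm. $E_1$, $E_2$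 carry their Borel $\sigma$-algebras. **Proposition 3.1.** The stochastic integrals above are well-defined, and $\{\partial_1^iU(x,h);\,i\in\{0,1\},x\in\mathbb R,h\in\mathscr D\}$ is a centred Gaussian process. Moreover: (i) For every $h\in\mathscr D$ the processes $y\mapsto\partial_1U(y,h)$ and $y\mapsto U(y,h')$, $y\ge x_0$, have $\mathcal F\otimes\mathscr B([x_0,\infty))$-measurable versions, and with any such versions, for every $x\ge x_0$, almost surely the integrals below exist and $$U(x,h)=U(x_0,h)+\int_{x_0}^x\partial_1U(y,h)\,dy,$$ $$\partial_1U(x,h)=\partial_1U(x_0,h)-\int_{x_0}^xU(y,h')\,dy-\iint B(dy,ds)\,(\mathbf 1_{(x_0,x]}\otimes h)(y,s).$$ (ii) For fixed $x\ge x_0$, $\{U(x,h);h\in\mathscr D\}$ and $\{\partial_1U(x,h);h\in\mathscr D\}$ are independent centred Gaussian processes with covariances $$\mathbb E\,U(x,h_1)U(x,h_2)=\Big\langle h_1\,;\frac{-\sqrt{|\cdot|}}{\sqrt{4\pi}}*h_2^a\Big\rangle,\qquad \mathbb E\,\partial_1U(x,h_1)\partial_1U(x,h_2)=\Big\langle h_1\,;\frac{1}{2\sqrt{4\pi|\cdot|}}*h_2^a\Big\rangle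 .$$ (iii) For every $\alpha>3/2$ and $x\ge x_0$, $\{U(x,h);h\in\mathscr D\}$ has a version that is an $E_1$-valued random variable. (iv) For every $\varepsilon>0$, $\mathfrak w$ and $\beta>1/4$ as above and $x\ge x_0$, $\{\partial_1U(x,h);h\in\mathscr D\}$ has a version that is an $E_2$-valued random variable. (v) For all $\alpha,\varepsilon,\mathfrak w,\beta$ as above there is a process $\{(U(x,\cdot),\partial_1U(x,\cdot));\,x\ge x_0\}$ with values in $E_1\times E_2$ that is a version of the field (for all $x\ge x_0$ and $h\in\mathscr D$, its pairings with $h$ are a.s. equal to $U(x,h)$ and $\partial_1U(x,h)$), is $\mathcal F\otimes\mathscr B([x_0,\infty))$-measurable and stationary, and satisfies $$\mathbb E\int_{x_0}^x\big(\|U(y,\cdot)\|_{E_1}^2+\|\partial_1U(y,\cdot)\|_{E_2}^2\big)\,dy<\infty\qquad\text{for all }x>x_0 .$$ It can be chosen so that moreover, for every $\omega$, the elements $U(x,\cdot)\in E_1$, $x\ge x_0$, are given by functions $t\mapsto U(x,t)$ with $U(x,0)=0$ for which $(x,t)\mapsto U(x,t)$ is continuous on $[x_0,\infty)\times[0,\infty)$;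 and, for all $x\ge x_0$, $t\ge0$, almost surely $U(x,t)=\iint B(dy,ds)\,g(y,s;x,t)$. -/

import Mathlib

open MeasureTheory ProbabilityTheory Set Filter Topology
open scoped NNReal ENNReal Distributions Convolution FourierTransform

noncomputable section

namespace HeatSPDE

/-! ### Brownian sheet and its Wiener integral -/

/-- A (two-sided in space) Brownian sheet `B x t`, `x ∈ ℝ`, `t ≥ 0`: a centred Gaussian field with
almost surely continuous paths whose covariance is `min t s` times the covariance
`(|x| + |y| - |x - y|) / 2` of a two-sided Brownian motion. -/
structure IsBrownianSheet {Ω : Type*} [MeasurableSpace Ω] (B : ℝ → ℝ≥0 → Ω → ℝ) (P : Measure Ω) :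
    Prop where
  gaussian : IsGaussianProcess (fun p : ℝ × ℝ≥0 ↦ B p.1 p.2) P
  centred : ∀ x t, ∫ ω, B x t ω ∂P = 0
  covariance : ∀ x y t s,
    ∫ ω, B x t ω * B y s ω ∂P = ((min t s : ℝ≥0) : ℝ) * ((|x| + |y| - |x - y|) / 2)
  continuous_paths : ∀ᵐ ω ∂P, Continuous (fun p : ℝ × ℝ≥0 ↦ B p.1 p.2 ω)

/-- Lebesgue measure on the half plane `ℝ × (0, ∞)` (first coordinate space, second time). -/
def halfPlane : Measure (ℝ × ℝ) := volume.restrict (univ ×ˢ Ioi 0)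

theorem memLp_rectangle (a b t : ℝ) :
    MemLp ((Ioc a b ×ˢ Ioc 0 t).indicator (fun _ ↦ (1 : ℝ))) 2 halfPlane := by
  refine memLp_indicator_const 2 (measurableSet_Ioc.prod measurableSet_Ioc) 1 (Or.inr ?_)
  refine ne_top_of_le_ne_top ?_ (Measure.restrict_apply_le _ _)
  rw [Measure.volume_eq_prod, Measure.prod_prod]
  exact ENNReal.mul_ne_top (by simp) (by simp)

/-- `I` is the Wiener integral with respect to the sheet `B`: a continuous linear map on
`L²(ℝ × (0, ∞))` that sends the indicator of a rectangle `(a, b] × (0, t]` to the increment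
`B b t - B a t`.  Such indicators span a dense subspace, so there is at most one such map. -/
def IsWienerIntegral {Ω : Type*} [MeasurableSpace Ω] (B : ℝ → ℝ≥0 → Ω → ℝ) (P : Measure Ω)
    (I : Lp ℝ 2 halfPlane →L[ℝ] Lp ℝ 2 P) : Prop :=
  ∀ (a b : ℝ) (t : ℝ≥0), a ≤ b →
    I ((memLp_rectangle a b t).toLp _) =ᵐ[P] fun ω ↦ B b t ω - B a t ω

open Classical in
/-- The Wiener integral map of `B` (it exists whenever `B` is a Brownian sheet). -/
def wienerIntegralMap {Ω : Type*} [MeasurableSpace Ω] (B : ℝ → ℝ≥0 → Ω → ℝ) (P : Measure Ω) :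
    Lp ℝ 2 halfPlane →L[ℝ] Lp ℝ 2 P :=
  if h : ∃ I, IsWienerIntegral B P I then h.choose else 0

open Classical in
/-- `∬ B(dy, ds) f(y, s)` for a deterministic square integrable `f` on `ℝ × (0, ∞)`. -/
def wienerIntegral {Ω : Type*} [MeasurableSpace Ω] (B : ℝ → ℝ≥0 → Ω → ℝ) (P : Measure Ω)
    (f : ℝ × ℝ → ℝ) : Ω → ℝ :=
  if hf : MemLp f 2 halfPlane then wienerIntegralMap B P (hf.toLp f) else 0

/-! ### The heat kernel and the field `(U, ∂₁U)` -/

/-- The heat kernel `g(y, s; x, t)`. -/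
def heatKernel (y s x t : ℝ) : ℝ :=
  if s < t then 1 / √(4 * Real.pi * (t - s)) * Real.exp (-(x - y) ^ 2 / (4 * (t - s))) else 0

/-- The open half line `(0, ∞)`. -/
def posHalfLine : TopologicalSpace.Opens ℝ := ⟨Ioi 0, isOpen_Ioi⟩

/-- Smooth functions with compact support in `(0, ∞)`, as functions on `ℝ` vanishing outside. -/
abbrev TestSpace : Type := 𝓓(posHalfLine, ℝ)

/-- `(y, s) ↦ ∫₀^∞ g(y, s; x, t) h(t) dt`. -/
def kernelU (x : ℝ) (h : ℝ → ℝ) (p : ℝ × ℝ) : ℝ :=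
  ∫ t in Ioi 0, heatKernel p.1 p.2 x t * h t

/-- `(y, s) ↦ ∫₀^∞ ∂₃g(y, s; x, t) h(t) dt`. -/
def kernelDU (x : ℝ) (h : ℝ → ℝ) (p : ℝ × ℝ) : ℝ :=
  ∫ t in Ioi 0, deriv (fun x' ↦ heatKernel p.1 p.2 x' t) x * h t

section Field

variable {Ω : Type*} [MeasurableSpace Ω] (B : ℝ → ℝ≥0 → Ω → ℝ) (P : Measure Ω)

/-- The random variable `U(x, h)`. -/
def U (x : ℝ) (h : ℝ → ℝ) : Ω → ℝ := wienerIntegral B P (kernelU x h)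

/-- The random variable `∂₁U(x, h)`. -/
def DU (x : ℝ) (h : ℝ → ℝ) : Ω → ℝ := wienerIntegral B P (kernelDU x h)

/-- The point values `U(x, t)` of the mild solution of the stochastic heat equation. -/
def pointU (x : ℝ) (t : ℝ≥0) : Ω → ℝ := wienerIntegral B P (fun p ↦ heatKernel p.1 p.2 x t)

/-- `∬ B(dy, ds) (1_{(a, b]} ⊗ h)(y, s)`. -/
def noise (a b : ℝ) (h : ℝ → ℝ) : Ω → ℝ :=
  wienerIntegral B P (fun p ↦ (Ioc a b).indicator (fun _ ↦ (1 : ℝ)) p.1 * h p.2)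

/-- The field `∂₁ⁱU(x, h)` indexed by `(i, x, h)`. -/
def field (q : Fin 2 × ℝ × TestSpace) : Ω → ℝ :=
  if q.1 = 0 then U B P q.2.1 q.2.2 else DU B P q.2.1 q.2.2

/-- `A` is a jointly measurable version of the real process `X` on the index set `[x₀, ∞)`. -/
def IsMeasurableVersion (x₀ : ℝ) (X A : ℝ → Ω → ℝ) : Prop :=
  Measurable (fun p : Ω × Ici x₀ ↦ A p.2 p.1) ∧ ∀ x, x₀ ≤ x → A x =ᵐ[P] X x

end Field

/-- The antisymmetric extension `l^a` of `l`; only the values of `l` on `(0, ∞)` matter. -/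
def antisymm (l : ℝ → ℝ) (t : ℝ) : ℝ := if 0 < t then l t else if t < 0 then -l (-t) else 0

/-! ### The weighted space `C_{0,α}` and the state space `E₁` -/

/-- Continuous `h` on `[0, ∞)` with `h(t) (1 + t)^α → 0` as `t → ∞`. -/
def weightedC0Submodule (α : ℝ) : Submodule ℝ C(ℝ≥0, ℝ) where
  carrier := {h | Tendsto (fun t : ℝ≥0 ↦ h t * (1 + (t : ℝ)) ^ α) atTop (𝓝 0)}
  zero_mem' := by simp
  add_mem' {f g} hf hg := by
    have := Tendsto.add (mem_ofPred.mp hf) (mem_ofPred.mp hg)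
    simpa [add_mul] using this
  smul_mem' c f hf := by
    have := Tendsto.const_mul c (mem_ofPred.mp hf)
    simpa [mul_assoc] using this

/-- The space `C_{0,α}`. -/
def WeightedC0 (α : ℝ) : Type := weightedC0Submodule α

namespace WeightedC0

variable {α : ℝ}

instance : AddCommGroup (WeightedC0 α) := inferInstanceAs (AddCommGroup (weightedC0Submodule α))
instance : Module ℝ (WeightedC0 α) := inferInstanceAs (Module ℝ (weightedC0Submodule α))

/-- The underlying continuous function on `[0, ∞)`. -/
def toCont (h : WeightedC0 α) : C(ℝ≥0, ℝ) := Subtype.val h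

/-- `h ↦ (1 + t)^α h(t)`, as a linear map into the functions vanishing at infinity. -/
def weightMap (α : ℝ) : WeightedC0 α →ₗ[ℝ] ZeroAtInftyContinuousMap ℝ≥0 ℝ where
  toFun h :=
    { toFun := fun t ↦ toCont h t * (1 + (t : ℝ)) ^ α
      continuous_toFun := by
        refine (toCont h).continuous.mul (Continuous.rpow_const (by fun_prop) fun t ↦ Or.inl ?_)
        positivity
      zero_at_infty' := by
        rw [cocompact_eq_atTop]
        exact Subtype.property h }
  map_add' f g := by
    ext t
    exact add_mul (toCont f t) (toCont g t) _
  map_smul' c f := by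
    ext t
    exact mul_assoc c (toCont f t) _

theorem weightMap_injective : Function.Injective (weightMap α) := by
  intro f g hfg
  refine Subtype.ext (ContinuousMap.ext fun t ↦ ?_)
  have h1 : toCont f t * (1 + (t : ℝ)) ^ α = toCont g t * (1 + (t : ℝ)) ^ α :=
    DFunLike.congr_fun hfg t
  have h2 : (1 + (t : ℝ)) ^ α ≠ 0 := (Real.rpow_pos_of_pos (by positivity) _).ne'
  exact mul_right_cancel₀ h2 h1

/-- The norm of `C_{0,α}` is pulled back along `h ↦ (1 + t)^α h(t)`. -/
instance : NormedAddCommGroup (WeightedC0 α) :=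
  NormedAddCommGroup.induced _ _ (weightMap α) weightMap_injective

instance : NormedSpace ℝ (WeightedC0 α) := NormedSpace.induced ℝ _ _ (weightMap α)

theorem norm_eq_iSup (h : WeightedC0 α) :
    ‖h‖ = ⨆ t : ℝ≥0, |toCont h t * (1 + (t : ℝ)) ^ α| := by
  have h1 : ‖h‖ = ‖(weightMap α h).toBCF‖ := rfl
  rw [h1, BoundedContinuousFunction.norm_eq_iSup_norm]
  rfl

/-- A test function as an element of `C_{0,α}`. -/
def ofTest (α : ℝ) (h : TestSpace) : WeightedC0 α :=
  (⟨⟨fun t : ℝ≥0 ↦ h (t : ℝ), h.continuous.comp NNReal.continuous_coe⟩, by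
    have hc := h.hasCompactSupport.isCompact.isBounded.subset_closedBall 0
    obtain ⟨r, hr⟩ := hc
    refine tendsto_const_nhds.congr' ?_
    filter_upwards [eventually_gt_atTop (Real.toNNReal r)] with t ht
    have h0 : h (t : ℝ) = 0 := by
      by_contra hne
      have hm := hr (subset_tsupport _ (Function.mem_support.mpr hne))
      have hlt : r < (t : ℝ) := by
        have := NNReal.coe_lt_coe.mpr ht
        exact lt_of_le_of_lt (Real.le_coe_toNNReal r) this
      rw [mem_closedBall_zero_iff, Real.norm_eq_abs] at hm
      exact absurd (le_trans (le_abs_self _) hm) (not_le.mpr hlt)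
    simp [h0]⟩ : weightedC0Submodule α)

end WeightedC0

/-- The functional `φ` on `C_{0,α}` is given by integration against the function `u` on
`[0, ∞)`. -/
def Represents {α : ℝ} (φ : StrongDual ℝ (WeightedC0 α)) (u : ℝ≥0 → ℝ) : Prop :=
  ∀ h : WeightedC0 α,
    IntegrableOn (fun t : ℝ ↦ u t.toNNReal * h.toCont t.toNNReal) (Ici 0) ∧
      φ h = ∫ t in Ici (0 : ℝ), u t.toNNReal * h.toCont t.toNNReal

/-- `E₁`: the elements of the dual of `C_{0,α}` given by a continuous function on `[0, ∞)`
vanishing at `0`, with the norm (and the Borel σ-algebra) of the dual. -/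
def E₁ (α : ℝ) : Submodule ℝ (StrongDual ℝ (WeightedC0 α)) where
  carrier := {φ | ∃ u : ℝ≥0 → ℝ, Continuous u ∧ u 0 = 0 ∧ Represents φ u}
  zero_mem' := ⟨0, continuous_const, rfl, fun h ↦ by simp⟩
  add_mem' := by
    rintro φ ψ ⟨u, hu, hu0, hφ⟩ ⟨v, hv, hv0, hψ⟩
    refine ⟨u + v, hu.add hv, by simp [hu0, hv0], fun h ↦ ?_⟩
    obtain ⟨i1, e1⟩ := hφ h
    obtain ⟨i2, e2⟩ := hψ h
    simp only [Pi.add_apply, add_mul]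
    exact ⟨i1.add i2, by rw [integral_add i1 i2, ← e1, ← e2]; rfl⟩
  smul_mem' := by
    rintro c φ ⟨u, hu, hu0, hφ⟩
    refine ⟨c • u, hu.const_smul c, by simp [hu0], fun h ↦ ?_⟩
    obtain ⟨i1, e1⟩ := hφ h
    simp only [Pi.smul_apply, smul_eq_mul, mul_assoc]
    exact ⟨i1.const_mul c, by rw [integral_const_mul, ← e1]; rfl⟩

/-! ### The weighted Sobolev space and the state space `E₂` -/

/-- A smooth weight `w ≥ 1 + |t|^{1/2+ε}` with equality outside a bounded neighbourhood of `0`. -/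
structure Weight (ε : ℝ) where
  toFun : ℝ → ℝ
  smooth : ContDiff ℝ ((⊤ : ℕ∞) : WithTop ℕ∞) toFun
  le_toFun : ∀ t, 1 + |t| ^ (1 / 2 + ε) ≤ toFun t
  eq_outside : ∃ r > 0, ∀ t, r ≤ |t| → toFun t = 1 + |t| ^ (1 / 2 + ε)

/-- `w l^a`, as a complex valued function on `ℝ`. -/
def weighted (w l : ℝ → ℝ) (t : ℝ) : ℂ := ((w t * antisymm l t : ℝ) : ℂ)

/-- The symbol `(1 + τ²)^{β/2}` at `τ = 2πξ` (the Fourier transform of Mathlib at `ξ` is the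
integral against `e^{-2πiξt}`). -/
def sobolevSymbol (β ξ : ℝ) : ℂ := (((1 + (2 * Real.pi * ξ) ^ 2) ^ (β / 2) : ℝ) : ℂ)

/-- Complex `L²(ℝ)`. -/
abbrev L2C : Type := Lp ℂ 2 (volume : Measure ℝ)

/-- The real space `L²([0, ∞))`. -/
abbrev L2Half : Type := Lp ℝ 2 (volume.restrict (Ici (0 : ℝ)))

/-- The function `(1 + τ²)^{β/2} f^F(τ)` at `τ = 2πξ`. -/
def bessel (β : ℝ) (f : L2C) (ξ : ℝ) : ℂ := sobolevSymbol β ξ * (𝓕 f : L2C) ξ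

theorem bessel_add (β : ℝ) (f g : L2C) :
    bessel β (f + g) =ᵐ[volume] bessel β f + bessel β g := by
  have h0 : (𝓕 (f + g) : L2C) = 𝓕 f + 𝓕 g := FourierTransform.fourier_add f g
  filter_upwards [Lp.coeFn_add (𝓕 f : L2C) (𝓕 g)] with ξ hξ
  simp only [bessel, h0, hξ, Pi.add_apply, mul_add]

theorem bessel_smul (β : ℝ) (c : ℂ) (f : L2C) :
    bessel β (c • f) =ᵐ[volume] c • bessel β f := by
  have h0 : (𝓕 (c • f) : L2C) = c • 𝓕 f := FourierTransform.fourier_smul c f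
  filter_upwards [Lp.coeFn_smul c (𝓕 f : L2C)] with ξ hξ
  simp only [bessel, h0, hξ, Pi.smul_apply, smul_eq_mul, mul_left_comm]

theorem bessel_zero (β : ℝ) : bessel β 0 =ᵐ[volume] 0 := by
  simpa using bessel_smul β 0 0

/-- The Sobolev space `H_β`, as a subspace of `L²(ℝ)`. -/
def sobolev (β : ℝ) : Submodule ℂ L2C where
  carrier := {f | MemLp (bessel β f) 2 volume}
  zero_mem' := MemLp.ae_eq (bessel_zero β).symm MemLp.zero
  add_mem' {f g} hf hg := MemLp.ae_eq (bessel_add β f g).symm (MemLp.add hf hg)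
  smul_mem' c f hf := MemLp.ae_eq (bessel_smul β c f).symm (MemLp.const_smul hf c)

theorem antisymm_ae {k l : ℝ → ℝ} (h : k =ᵐ[volume.restrict (Ici (0 : ℝ))] l) :
    antisymm k =ᵐ[volume] antisymm l := by
  have h1 : ∀ᵐ t : ℝ, 0 ≤ t → k t = l t := (ae_restrict_iff' measurableSet_Ici).mp h
  have h2 : ∀ᵐ t : ℝ, 0 ≤ -t → k (-t) = l (-t) :=
    (Measure.measurePreserving_neg (volume : Measure ℝ)).quasiMeasurePreserving.ae h1
  filter_upwards [h1, h2] with t ht1 ht2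
  unfold antisymm
  split_ifs with hp hn
  · exact ht1 hp.le
  · rw [ht2 (by linarith)]
  · rfl

theorem weighted_ae {w k l : ℝ → ℝ} (h : k =ᵐ[volume.restrict (Ici (0 : ℝ))] l) :
    weighted w k =ᵐ[volume] weighted w l := by
  filter_upwards [antisymm_ae h] with t ht
  simp [weighted, ht]

theorem weighted_add (w : ℝ → ℝ) (k l : L2Half) :
    weighted w (k + l : L2Half) =ᵐ[volume] weighted w k + weighted w l := by
  filter_upwards [weighted_ae (w := w) (Lp.coeFn_add k l)] with t ht
  rw [ht]
  simp only [weighted, antisymm, Pi.add_apply]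
  split_ifs <;> push_cast <;> ring

theorem weighted_smul (w : ℝ → ℝ) (c : ℝ) (l : L2Half) :
    weighted w (c • l : L2Half) =ᵐ[volume] c • weighted w l := by
  filter_upwards [weighted_ae (w := w) (Lp.coeFn_smul c l)] with t ht
  rw [ht]
  simp only [weighted, antisymm, Pi.smul_apply, smul_eq_mul, Complex.real_smul]
  split_ifs <;> push_cast <;> ring

theorem weighted_zero (w : ℝ → ℝ) : weighted w (0 : L2Half) =ᵐ[volume] 0 := by
  have := weighted_smul w 0 (0 : L2Half)
  simpa using this

/-- Those `l ∈ L²([0, ∞))` with `w l^a ∈ L²(ℝ)`. -/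
def weightedL2 (w : ℝ → ℝ) : Submodule ℝ L2Half where
  carrier := {l | MemLp (weighted w l) 2 volume}
  zero_mem' := MemLp.ae_eq (weighted_zero w).symm MemLp.zero
  add_mem' {k l} hk hl := MemLp.ae_eq (weighted_add w k l).symm (MemLp.add hk hl)
  smul_mem' c l hl := MemLp.ae_eq (weighted_smul w c l).symm (MemLp.const_smul hl c)

/-- `l ↦ w l^a` as a linear map into `L²(ℝ)`. -/
def weightedMap (w : ℝ → ℝ) : weightedL2 w →ₗ[ℝ] L2C where
  toFun l := MemLp.toLp (weighted w l.1) l.2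
  map_add' k l := by
    refine Lp.ext ?_
    filter_upwards [MemLp.coeFn_toLp (k + l).2, MemLp.coeFn_toLp k.2, MemLp.coeFn_toLp l.2,
      Lp.coeFn_add (MemLp.toLp _ k.2) (MemLp.toLp _ l.2), weighted_add w k.1 l.1]
      with t h1 h2 h3 h4 h5
    rw [h1, h4, Pi.add_apply, h2, h3]
    exact h5
  map_smul' c l := by
    refine Lp.ext ?_
    filter_upwards [MemLp.coeFn_toLp (c • l).2, MemLp.coeFn_toLp l.2,
      Lp.coeFn_smul c (MemLp.toLp _ l.2), weighted_smul w c l.1]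
      with t h1 h2 h3 h4
    rw [h1, RingHom.id_apply, h3, Pi.smul_apply, h2]
    exact h4

theorem weightedMap_injective {ε : ℝ} (w : Weight ε) :
    Function.Injective (weightedMap w.toFun) := by
  refine (injective_iff_map_eq_zero _).mpr fun l hl ↦ ?_
  have h1 : weighted w.toFun l.1 =ᵐ[volume] 0 := (MemLp.coeFn_toLp l.2).symm.trans (Lp.eq_zero_iff_ae_eq_zero.mp hl)
  refine Subtype.ext (Lp.ext ?_)
  refine EventuallyEq.trans ?_ (Lp.coeFn_zero ℝ 2 _).symm
  refine (ae_restrict_iff' measurableSet_Ici).mpr ?_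
  have h2 : ∀ᵐ t : ℝ, t ≠ 0 := by simp [ae_iff]
  filter_upwards [h1, h2] with t ht ht0 htI
  have hpos : 0 < t := lt_of_le_of_ne htI (Ne.symm ht0)
  have hw : 0 < w.toFun t := by
    have h3 := w.le_toFun t
    have h4 : 0 ≤ |t| ^ (1 / 2 + ε) := by positivity
    linarith
  simpa [weighted, antisymm, hpos, hw.ne'] using ht

/-- `f ↦ (1 + τ²)^{β/2} f^F`, `τ = 2πξ`, as a linear map from `H_β` into `L²(ℝ)`. -/
def besselMap (β : ℝ) : sobolev β →ₗ[ℂ] L2C where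
  toFun f := MemLp.toLp (bessel β f.1) f.2
  map_add' f g := by
    refine Lp.ext ?_
    filter_upwards [MemLp.coeFn_toLp (f + g).2, MemLp.coeFn_toLp f.2, MemLp.coeFn_toLp g.2,
      Lp.coeFn_add (MemLp.toLp _ f.2) (MemLp.toLp _ g.2), bessel_add β f.1 g.1]
      with t h1 h2 h3 h4 h5
    rw [h1, h4, Pi.add_apply, h2, h3]
    exact h5
  map_smul' c f := by
    refine Lp.ext ?_
    filter_upwards [MemLp.coeFn_toLp (c • f).2, MemLp.coeFn_toLp f.2,
      Lp.coeFn_smul c (MemLp.toLp _ f.2), bessel_smul β c f.1]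
      with t h1 h2 h3 h4
    rw [h1, RingHom.id_apply, h3, Pi.smul_apply, h2]
    exact h4

theorem besselMap_injective (β : ℝ) : Function.Injective (besselMap β) := by
  refine (injective_iff_map_eq_zero _).mpr fun f hf ↦ ?_
  have h1 : bessel β f.1 =ᵐ[volume] 0 := (MemLp.coeFn_toLp f.2).symm.trans (Lp.eq_zero_iff_ae_eq_zero.mp hf)
  have h2 : (𝓕 f.1 : L2C) = 0 := by
    refine Lp.ext ?_
    filter_upwards [h1, Lp.coeFn_zero ℂ 2 (volume : Measure ℝ)] with ξ hξ h0
    rw [h0]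
    have hs : sobolevSymbol β ξ ≠ 0 := by
      unfold sobolevSymbol
      exact_mod_cast (Real.rpow_pos_of_pos (by positivity) _).ne'
    exact (mul_eq_zero.mp hξ).resolve_left hs
  have h3 : ‖f.1‖ = 0 := by rw [← Lp.norm_fourier_eq f.1, h2, norm_zero]
  exact Subtype.ext (norm_eq_zero.mp h3)

/-- The space `H^a_{w,β}`: those `l ∈ L²([0, ∞))` with `w l^a ∈ H_β`. -/
def WeightedSobolev {ε : ℝ} (w : Weight ε) (β : ℝ) : Type :=
  Submodule.comap (weightedMap w.toFun) ((sobolev β).restrictScalars ℝ)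

namespace WeightedSobolev

variable {ε : ℝ} {w : Weight ε} {β : ℝ}

instance : AddCommGroup (WeightedSobolev w β) := inferInstanceAs (AddCommGroup
  (Submodule.comap (weightedMap w.toFun) ((sobolev β).restrictScalars ℝ)))
instance : Module ℝ (WeightedSobolev w β) := inferInstanceAs (Module ℝ
  (Submodule.comap (weightedMap w.toFun) ((sobolev β).restrictScalars ℝ)))

/-- `l ↦ (1 + τ²)^{β/2} (w l^a)^F`. -/
def toL2 (w : Weight ε) (β : ℝ) : WeightedSobolev w β →ₗ[ℝ] L2C :=
  ((besselMap β).restrictScalars ℝ).comp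
    ((weightedMap w.toFun).restrict (p := Submodule.comap (weightedMap w.toFun)
      ((sobolev β).restrictScalars ℝ)) (q := (sobolev β).restrictScalars ℝ) fun _ h ↦ h)

theorem toL2_injective : Function.Injective (toL2 w β) := by
  intro k l hkl
  have h1 := congrArg Subtype.val (besselMap_injective β hkl)
  exact Subtype.ext (weightedMap_injective w h1)

/-- The norm of `H^a_{w,β}` is the Sobolev norm `‖(1 + τ²)^{β/2} (w l^a)^F‖` in `L²(dξ)`,
`τ = 2πξ`. -/
instance : NormedAddCommGroup (WeightedSobolev w β) :=
  NormedAddCommGroup.induced _ _ (toL2 w β) toL2_injective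

instance : NormedSpace ℝ (WeightedSobolev w β) := NormedSpace.induced ℝ _ _ (toL2 w β)

end WeightedSobolev

theorem TestSpace.eq_zero (h : TestSpace) {t : ℝ} (ht : t ≤ 0) : h t = 0 := by
  by_contra hne
  have h1 : t ∈ Ioi (0 : ℝ) := h.tsupport_subset (subset_tsupport _ (Function.mem_support.mpr hne))
  exact absurd h1 (not_lt.mpr ht)

theorem TestSpace.memLp (h : TestSpace) : MemLp h 2 (volume.restrict (Ici (0 : ℝ))) :=
  (h.continuous.memLp_of_hasCompactSupport h.hasCompactSupport).restrict _

theorem TestSpace.antisymm_eq (h : TestSpace) : antisymm h = fun t ↦ h t - h (-t) := by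
  funext t
  unfold antisymm
  split_ifs with h1 h2
  · rw [TestSpace.eq_zero h (t := -t) (by linarith), sub_zero]
  · rw [TestSpace.eq_zero h h2.le, zero_sub]
  · have : t = 0 := by linarith
    subst this
    simp

theorem TestSpace.weighted_smooth {ε : ℝ} (w : Weight ε) (h : TestSpace) :
    ContDiff ℝ ((⊤ : ℕ∞) : WithTop ℕ∞) (weighted w.toFun h) ∧
      HasCompactSupport (weighted w.toFun h) := by
  have e : weighted w.toFun h = fun t ↦ ((w.toFun t * (h t - h (-t)) : ℝ) : ℂ) := by
    funext t
    rw [weighted, TestSpace.antisymm_eq]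
  have hs : ContDiff ℝ ((⊤ : ℕ∞) : WithTop ℕ∞) h := h.contDiff
  rw [e]
  constructor
  · exact Complex.ofRealCLM.contDiff.comp
      (w.smooth.mul (hs.sub (hs.comp contDiff_neg)))
  · have c1 : HasCompactSupport fun t ↦ h (-t) :=
      h.hasCompactSupport.comp_homeomorph (Homeomorph.neg ℝ)
    have c2 : HasCompactSupport fun t ↦ w.toFun t * (h t - h (-t)) :=
      (h.hasCompactSupport.sub c1).mul_left
    exact c2.comp_left (g := fun r : ℝ ↦ (r : ℂ)) Complex.ofReal_zero

theorem sobolevSymbol_growth (β : ℝ) : (sobolevSymbol β).HasTemperateGrowth := by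
  have h1 := Function.hasTemperateGrowth_one_add_norm_sq_rpow ℝ (β / 2)
  have h2 : (fun ξ : ℝ ↦ 2 * Real.pi * ξ).HasTemperateGrowth := by fun_prop
  have h3 := h1.comp h2
  have e : sobolevSymbol β = fun ξ ↦ Complex.ofRealCLM
      (((fun x : ℝ ↦ (1 + ‖x‖ ^ 2) ^ (β / 2)) ∘ fun ξ : ℝ ↦ 2 * Real.pi * ξ) ξ) := by
    funext ξ
    simp [sobolevSymbol, Real.norm_eq_abs, sq_abs]
  rw [e]
  exact Complex.ofRealCLM.hasTemperateGrowth.comp h3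

theorem memLp_bessel_schwartz (β : ℝ) (φ : SchwartzMap ℝ ℂ) :
    MemLp (bessel β (φ.toLp 2)) 2 volume := by
  have h1 : (𝓕 (φ.toLp 2) : L2C) = (𝓕 φ).toLp 2 := SchwartzMap.toLp_fourier_eq φ
  have h2 : bessel β (φ.toLp 2) =ᵐ[volume]
      SchwartzMap.smulLeftCLM ℂ (sobolevSymbol β) (𝓕 φ) := by
    filter_upwards [SchwartzMap.coeFn_toLp (𝓕 φ) 2 volume] with ξ hξ
    rw [SchwartzMap.smulLeftCLM_apply_apply (sobolevSymbol_growth β), bessel, h1, hξ, smul_eq_mul]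
  exact MemLp.ae_eq h2.symm (SchwartzMap.memLp _ 2 volume)

namespace WeightedSobolev

/-- A test function as an element of `H^a_{w,β}`. -/
def ofTest {ε : ℝ} (w : Weight ε) (β : ℝ) (h : TestSpace) : WeightedSobolev w β :=
  have hs := TestSpace.weighted_smooth w h
  have e : weighted w.toFun (MemLp.toLp h (TestSpace.memLp h)) =ᵐ[volume] weighted w.toFun h :=
    weighted_ae (MemLp.coeFn_toLp (TestSpace.memLp h))
  have m : MemLp (weighted w.toFun (MemLp.toLp h (TestSpace.memLp h))) 2 volume :=
    MemLp.ae_eq e.symm (hs.1.continuous.memLp_of_hasCompactSupport hs.2)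
  have k : MemLp (bessel β (MemLp.toLp _ m)) 2 volume := by
    have e2 : MemLp.toLp _ m = (hs.2.toSchwartzMap hs.1).toLp 2 := by
      refine Lp.ext ?_
      filter_upwards [MemLp.coeFn_toLp m, e, SchwartzMap.coeFn_toLp (hs.2.toSchwartzMap hs.1) 2
        volume] with t h1 h2 h3
      rw [h1, h2, h3]
      rfl
    rw [e2]
    exact memLp_bessel_schwartz β _
  ⟨⟨MemLp.toLp h (TestSpace.memLp h), m⟩, k⟩

end WeightedSobolev

/-- `E₂`: the dual of `H^a_{w,β}`, with its norm and Borel σ-algebra. -/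
abbrev E₂ {ε : ℝ} (w : Weight ε) (β : ℝ) : Type := StrongDual ℝ (WeightedSobolev w β)

end HeatSPDE

end

/-!
The Wiener integral against a Brownian sheet maps the indicator of `(a, b] × (0, t]` to an increment
of the sheet. By the covariance of the sheet this map is isometric, and the rectangles are total in
`L²` of the half plane, so it extends to an isometry of `L²` of the half plane into `L²(P)`. Its
values are jointly Gaussian (`IsBrownianSheet.isIsonormal`). The field is therefore determined by
the vectors `heatVec x t`, `uVec x h` and `duVec x h` of `L²` of the half plane, whose Wiener
integrals are the mild solution, `U(x, h)` and `∂₁U(x, h)`. Each probabilistic claim reduces to a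
claim on these vectors.

* Covariances are inner products. Chapman–Kolmogorov in space and an integration in time give
  differences of powers of `t + t'` and `|t - t'|`, which are convolutions with the antisymmetric
  extension (`inner_uVec_eq_convolution`, `inner_duVec_eq_convolution`). Reflection at `x` fixes
  `uVec x h` and changes the sign of `duVec x h`; hence they are orthogonal
  (`IsTest.inner_uVec_duVec`), and the two processes at `x` are independent.
* The evolution equations are identities in `L²` of the half plane (`uVec_sub`, `duVec_sub`). The
  second is an integration by parts in time, based on the heat equation for the space primitive of
  the heat kernel; the noise term comes from the jump of this primitive at time zero. They hold
  pathwise for every measurable version because pathwise integrals of a measurable version are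
  versions of Bochner integrals in `L²` (`ae_integral_eq_of_version`).
* Divided by `(1 + (x - x₀)) (1 + t)^{1/2}`, the heat kernel extends to a Hölder continuous function
  on the compactified quarter plane with values in `L²`. The theorem of Kolmogorov and Chentsov
  (`exists_continuous_version`) gives a continuous version there with a square integrable supremum
  (`exists_continuous_compactified`). Since `(1 + t)^{1/2 - α}` is integrable for `α > 3/2`, its
  slices define elements of `E₁` (`toE₁`).
* For `∂₁U` the argument is of Hilbert–Schmidt type. At almost every point `(y, s)` the function
  `t ↦ ∂₃g(y, s; x, t) / w(t)` lies in the Sobolev space of order `-β`. Writing the symbol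
  `(1 + τ²)^{-β}` as a mixture of Gaussians (`lintegral_sobolev_neg`) and integrating over `(y, s)`
  shows that the squared norm is integrable, and this is where `β > 1/4` is needed
  (`lintegral_energy_lt_top`). Let `eₙ` be test functions that are total and, up to vanishing
  terms, orthonormal in the weighted Sobolev norm (`exists_parseval_range`). The series of the
  functionals dual to `eₙ` with coefficients `∂₁U(x, eₙ)` converges in `E₂` almost surely and is a
  version of `∂₁U(x, ·)` (`exists_dualSeries_version`).
* Translation in space is an isometry of `L²` of the half plane that maps the vectors at `x` to
  those at `x + z`. Countably many Gaussian coordinates determine the pair of versions measurably,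
  so equality of Gram matrices gives stationarity (`identDistrib_shift`).
-/

set_option linter.unusedSectionVars false

noncomputable section

namespace HeatSPDE

/-! ### The Wiener integral of a Brownian sheet -/

/-- The index set of the rectangles `(a, b] × (0, t]`. -/
abbrev RectIndex : Type := {q : (ℝ × ℝ) × ℝ≥0 // q.1.1 ≤ q.1.2}

/-- The class of the indicator of a rectangle. -/
def rect (q : RectIndex) : Lp ℝ 2 halfPlane := (memLp_rectangle q.1.1.1 q.1.1.2 q.1.2).toLp _

theorem halfPlane_rectangle (a b t : ℝ) :
    halfPlane (Ioc a b ×ˢ Ioc 0 t) = ENNReal.ofReal (b - a) * ENNReal.ofReal t := by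
  rw [halfPlane, Measure.restrict_apply (measurableSet_Ioc.prod measurableSet_Ioc), prod_inter_prod,
    inter_univ, inter_eq_left.mpr (Ioc_subset_Ioi_self : Ioc (0 : ℝ) t ⊆ Ioi 0),
    Measure.volume_eq_prod, Measure.prod_prod]
  simp

theorem halfPlane_rectangle_ne_top (a b t : ℝ) : halfPlane (Ioc a b ×ˢ Ioc 0 t) ≠ ∞ := by
  rw [halfPlane_rectangle]
  exact ENNReal.mul_ne_top (by simp) (by simp)

instance : SigmaFinite halfPlane := by unfold halfPlane; infer_instance

theorem rect_eq_indicatorConstLp (q : RectIndex) :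
    rect q = indicatorConstLp 2 (measurableSet_Ioc.prod measurableSet_Ioc)
      (halfPlane_rectangle_ne_top q.1.1.1 q.1.1.2 q.1.2) (1 : ℝ) := rfl

theorem inner_rect (q : RectIndex) (g : Lp ℝ 2 halfPlane) :
    inner ℝ (rect q) g = ∫ p in Ioc q.1.1.1 q.1.1.2 ×ˢ Ioc 0 (q.1.2 : ℝ), g p ∂halfPlane := by
  rw [rect_eq_indicatorConstLp, L2.inner_indicatorConstLp_one]

/-- The covariance in space: the length of the overlap of two intervals is a second difference of
the distance. -/
theorem max_sub_eq_abs {a b a' b' : ℝ} (h : a ≤ b) (h' : a' ≤ b') :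
    max (min b b' - max a a') 0 = (|b - a'| + |a - b'| - |b - b'| - |a - a'|) / 2 := by
  rcases le_total a a' with h1 | h1 <;> rcases le_total b b' with h2 | h2 <;>
  rcases le_total b a' with h3 | h3 <;> rcases le_total a b' with h4 | h4 <;>
  simp only [max_eq_left h1, max_eq_right h1, min_eq_left h2, min_eq_right h2,
    abs_of_nonneg (sub_nonneg.mpr h1), abs_of_nonpos (sub_nonpos.mpr h1),
    abs_of_nonneg (sub_nonneg.mpr h2), abs_of_nonpos (sub_nonpos.mpr h2),
    abs_of_nonneg (sub_nonneg.mpr h3), abs_of_nonpos (sub_nonpos.mpr h3),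
    abs_of_nonneg (sub_nonneg.mpr h4), abs_of_nonpos (sub_nonpos.mpr h4)] <;>
  first
  | (rw [max_eq_left (by linarith)]; linarith)
  | (rw [max_eq_right (by linarith)]; linarith)

/-- The overlap of two rectangles has the area prescribed by the covariance of the sheet. -/
theorem inner_rect_rect (q r : RectIndex) :
    inner ℝ (rect q) (rect r) = ((min q.1.2 r.1.2 : ℝ≥0) : ℝ) *
      ((|q.1.1.2 - r.1.1.1| + |q.1.1.1 - r.1.1.2| - |q.1.1.2 - r.1.1.2|
        - |q.1.1.1 - r.1.1.1|) / 2) := by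
  rw [← max_sub_eq_abs q.2 r.2, inner_rect]
  have h1 : ∫ p in Ioc q.1.1.1 q.1.1.2 ×ˢ Ioc 0 (q.1.2 : ℝ), rect r p ∂halfPlane =
      ∫ p in Ioc q.1.1.1 q.1.1.2 ×ˢ Ioc 0 (q.1.2 : ℝ),
        (Ioc r.1.1.1 r.1.1.2 ×ˢ Ioc 0 (r.1.2 : ℝ)).indicator (fun _ ↦ (1 : ℝ)) p ∂halfPlane :=
    integral_congr_ae (ae_restrict_of_ae (MemLp.coeFn_toLp _))
  rw [h1, setIntegral_indicator (measurableSet_Ioc.prod measurableSet_Ioc), setIntegral_const,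
    prod_inter_prod, Ioc_inter_Ioc, Ioc_inter_Ioc, measureReal_def, sup_idem, halfPlane_rectangle]
  simp only [smul_eq_mul, mul_one, ENNReal.toReal_mul, ENNReal.toReal_ofReal']
  rw [mul_comm]
  congr 1
  simp

/-- A square integrable function on the half plane with vanishing integrals over all rectangles
`(a, b] × (0, t]` vanishes: these rectangles generate the Borel sets of every large box. -/
theorem eq_zero_of_inner_rect (g : Lp ℝ 2 halfPlane) (hg : ∀ q, inner ℝ (rect q) g = 0) :
    g = 0 := by
  have h0 : ∀ a b t : ℝ, ∫ p in Ioc a b ×ˢ Ioc 0 t, g p ∂halfPlane = 0 := by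
    intro a b t
    rcases le_or_gt b a with hab | hab
    · simp [Ioc_eq_empty_of_le hab]
    rcases le_or_gt t 0 with ht | ht
    · simp [Ioc_eq_empty_of_le ht]
    have := hg ⟨((a, b), ⟨t, ht.le⟩), hab.le⟩
    rwa [inner_rect] at this
  have hbox : ∀ n : ℕ, ∀ᵐ p ∂halfPlane.restrict (Ioc (-n : ℝ) n ×ˢ Ioc 0 (n : ℝ)), g p = 0 := by
    intro n
    set R : Set (ℝ × ℝ) := Ioc (-n : ℝ) n ×ˢ Ioc 0 (n : ℝ) with hR
    have hRm : MeasurableSet R := measurableSet_Ioc.prod measurableSet_Ioc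
    have hint : IntegrableOn g R halfPlane := by
      have : IsFiniteMeasure (halfPlane.restrict R) :=
        ⟨by rw [Measure.restrict_apply_univ]; exact (halfPlane_rectangle_ne_top _ _ _).lt_top⟩
      exact ((Lp.memLp g).restrict R).integrable (by norm_num)
    have key : ∀ s, MeasurableSet s → ∫ p in s, g p ∂halfPlane.restrict R = 0 := by
      have hspan : IsCountablySpanning (range (Iic : ℝ → Set ℝ)) :=
        ⟨fun k : ℕ ↦ Iic (k : ℝ), fun k ↦ ⟨k, rfl⟩, iUnion_Iic_of_not_bddAbove_range
          (not_bddAbove_iff.mpr fun x ↦ (exists_nat_gt x).elim fun k hk ↦ ⟨k, ⟨k, rfl⟩, hk⟩)⟩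
      have hgen := generateFrom_eq_prod
        ((borel_eq_generateFrom_Iic ℝ).symm.trans (BorelSpace.measurable_eq).symm)
        ((borel_eq_generateFrom_Iic ℝ).symm.trans (BorelSpace.measurable_eq).symm) hspan hspan
      refine MeasurableSpace.induction_on_inter
        (C := fun s _ ↦ ∫ p in s, g p ∂halfPlane.restrict R = 0) hgen.symm
        (isPiSystem_Iic.prod isPiSystem_Iic) ?_ ?_ ?_ ?_
      · simp
      · rintro _ ⟨_, ⟨b, rfl⟩, _, ⟨t, rfl⟩, rfl⟩
        rw [Measure.restrict_restrict (measurableSet_Iic.prod measurableSet_Iic), hR,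
          prod_inter_prod, inter_comm, Ioc_inter_Iic, inter_comm, Ioc_inter_Iic]
        exact h0 _ _ _
      · intro t ht h
        have := integral_add_compl ht hint
        rw [h, zero_add] at this
        rw [this]
        exact h0 _ _ _
      · intro f hf hfm h
        rw [integral_iUnion hfm hf hint.integrableOn]
        simp [h]
    exact Integrable.ae_eq_zero_of_forall_setIntegral_eq_zero hint fun s hs _ ↦ key s hs
  rw [Lp.eq_zero_iff_ae_eq_zero]
  have hU : halfPlane.restrict (⋃ n : ℕ, Ioc (-n : ℝ) n ×ˢ Ioc 0 (n : ℝ)) = halfPlane := by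
    refine Measure.restrict_eq_self_of_ae_mem ?_
    have hm : ∀ᵐ p ∂halfPlane, p ∈ (univ : Set ℝ) ×ˢ Ioi (0 : ℝ) :=
      ae_restrict_mem (MeasurableSet.univ.prod measurableSet_Ioi)
    filter_upwards [hm] with p hp
    obtain ⟨n, hn⟩ := exists_nat_gt (max |p.1| p.2)
    rw [max_lt_iff, abs_lt] at hn
    exact mem_iUnion.mpr ⟨n, ⟨hn.1.1, hn.1.2.le⟩, hp.2, hn.2.le⟩
  have h1 := (ae_restrict_iUnion_iff _ _).mpr hbox
  rwa [hU] at h1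

theorem denseRange_rect : DenseRange (Finsupp.linearCombination ℝ rect) := by
  have h : (Submodule.span ℝ (range rect)).topologicalClosure = ⊤ := by
    rw [Submodule.topologicalClosure_eq_top_iff, Submodule.eq_bot_iff]
    intro g hg
    exact eq_zero_of_inner_rect g fun q ↦
      (Submodule.mem_orthogonal _ _).mp hg _ (Submodule.subset_span ⟨q, rfl⟩)
  rw [DenseRange, ← LinearMap.coe_range, Finsupp.range_linearCombination]
  exact (Submodule.dense_iff_topologicalClosure_eq_top).mpr h

section Sheet

variable {Ω : Type*} [MeasurableSpace Ω] {P : Measure Ω} {B : ℝ → ℝ≥0 → Ω → ℝ}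

/-- The increment of the sheet over a rectangle. -/
def increment (B : ℝ → ℝ≥0 → Ω → ℝ) (q : RectIndex) (ω : Ω) : ℝ :=
  B q.1.1.2 q.1.2 ω - B q.1.1.1 q.1.2 ω

theorem IsBrownianSheet.memLp (hB : IsBrownianSheet B P) (x : ℝ) (t : ℝ≥0) : MemLp (B x t) 2 P :=
  (hB.gaussian.hasGaussianLaw_eval (x, t)).memLp_two

theorem IsBrownianSheet.memLp_increment (hB : IsBrownianSheet B P) (q : RectIndex) :
    MemLp (increment B q) 2 P := (hB.memLp _ _).sub (hB.memLp _ _)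

theorem IsBrownianSheet.integral_increment (hB : IsBrownianSheet B P) (q : RectIndex) :
    ∫ ω, increment B q ω ∂P = 0 := by
  have := hB.gaussian.isProbabilityMeasure
  simp only [increment]
  rw [integral_sub ((hB.memLp _ _).integrable (by norm_num))
    ((hB.memLp _ _).integrable (by norm_num)), hB.centred, hB.centred, sub_zero]

theorem IsBrownianSheet.inner_increment (hB : IsBrownianSheet B P) (q r : RectIndex) :
    inner ℝ ((hB.memLp_increment q).toLp _) ((hB.memLp_increment r).toLp _) =
      inner ℝ (rect q) (rect r) := by
  rw [inner_rect_rect, L2.inner_def]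
  have h1 : ∫ ω, inner ℝ ((hB.memLp_increment q).toLp _ ω) ((hB.memLp_increment r).toLp _ ω) ∂P =
      ∫ ω, (B q.1.1.2 q.1.2 ω * B r.1.1.2 r.1.2 ω - B q.1.1.2 q.1.2 ω * B r.1.1.1 r.1.2 ω
        - (B q.1.1.1 q.1.2 ω * B r.1.1.2 r.1.2 ω - B q.1.1.1 q.1.2 ω * B r.1.1.1 r.1.2 ω)) ∂P := by
    refine integral_congr_ae ?_
    filter_upwards [(hB.memLp_increment q).coeFn_toLp, (hB.memLp_increment r).coeFn_toLp]
      with ω h2 h3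
    rw [h2, h3]
    simp only [increment, RCLike.inner_apply, conj_trivial]
    ring
  have hi : ∀ x y t s, Integrable (fun ω ↦ B x t ω * B y s ω) P := fun x y t s ↦
    (hB.memLp x t).integrable_mul (hB.memLp y s)
  have hs := fun x y t s x' y' t' s' ↦ (hi x y t s).sub (hi x' y' t' s')
  simp only [Pi.sub_def] at hs
  rw [h1, integral_sub (hs _ _ _ _ _ _ _ _) (hs _ _ _ _ _ _ _ _),
    integral_sub (hi _ _ _ _) (hi _ _ _ _), integral_sub (hi _ _ _ _) (hi _ _ _ _)]
  simp only [hB.covariance]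
  ring

/-- Linear combinations of increments, as a map into `L²(P)`. -/
def incrementMap (hB : IsBrownianSheet B P) : (RectIndex →₀ ℝ) →ₗ[ℝ] Lp ℝ 2 P :=
  Finsupp.linearCombination ℝ fun q ↦ (hB.memLp_increment q).toLp _

theorem norm_incrementMap (hB : IsBrownianSheet B P) (c : RectIndex →₀ ℝ) :
    ‖incrementMap hB c‖ = ‖Finsupp.linearCombination ℝ rect c‖ := by
  have h : ‖incrementMap hB c‖ ^ 2 = ‖Finsupp.linearCombination ℝ rect c‖ ^ 2 := by
    rw [← real_inner_self_eq_norm_sq, ← real_inner_self_eq_norm_sq]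
    simp only [incrementMap, Finsupp.linearCombination_apply, Finsupp.sum, sum_inner, inner_sum,
      real_inner_smul_left, real_inner_smul_right, hB.inner_increment]
  exact (pow_left_inj₀ (norm_nonneg _) (norm_nonneg _) two_ne_zero).mp h

/-- The Wiener integral exists: the map from indicators of rectangles to increments is isometric,
and linear combinations of rectangles are dense. -/
theorem isWienerIntegral_wienerIntegralMap (hB : IsBrownianSheet B P) :
    IsWienerIntegral B P (wienerIntegralMap B P) := by
  have h : ∃ I, IsWienerIntegral B P I := by
    refine ⟨(incrementMap hB).extendOfNorm (Finsupp.linearCombination ℝ rect), ?_⟩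
    intro a b t hab
    have h1 := LinearMap.extendOfNorm_eq (f := incrementMap hB) denseRange_rect
      ⟨1, fun c ↦ by rw [norm_incrementMap, one_mul]⟩ (Finsupp.single ⟨((a, b), t), hab⟩ 1)
    simp only [incrementMap, Finsupp.linearCombination_single, one_smul] at h1
    change ((_ : Lp ℝ 2 P) : Ω → ℝ) =ᵐ[P] _
    erw [h1]
    exact MemLp.coeFn_toLp (hB.memLp_increment ⟨((a, b), t), hab⟩)
  rw [wienerIntegralMap, dif_pos h]
  exact h.choose_spec

theorem wienerIntegralMap_linearCombination (hB : IsBrownianSheet B P) (c : RectIndex →₀ ℝ) :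
    wienerIntegralMap B P (Finsupp.linearCombination ℝ rect c) = incrementMap hB c := by
  have h : ∀ q, wienerIntegralMap B P (rect q) = (hB.memLp_increment q).toLp _ := fun q ↦
    Lp.ext ((isWienerIntegral_wienerIntegralMap hB q.1.1.1 q.1.1.2 q.1.2 q.2).trans
      (MemLp.coeFn_toLp (hB.memLp_increment q)).symm)
  simp only [incrementMap, Finsupp.linearCombination_apply, Finsupp.sum, map_sum, map_smul, h]

theorem isGaussianProcess_increment (hB : IsBrownianSheet B P) :
    IsGaussianProcess (increment B) P := by
  classical
  refine hB.gaussian.of_isGaussianProcess fun q ↦ ⟨{(q.1.1.1, q.1.2), (q.1.1.2, q.1.2)},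
    ContinuousLinearMap.proj ⟨(q.1.1.2, q.1.2), by simp⟩
      - ContinuousLinearMap.proj ⟨(q.1.1.1, q.1.2), by simp⟩, fun ω ↦ ?_⟩
  simp [increment]

theorem integral_sq_eq_norm_sq (f : Lp ℝ 2 P) : ∫ ω, f ω ^ 2 ∂P = ‖f‖ ^ 2 := by
  rw [← real_inner_self_eq_norm_sq, L2.inner_def]
  simp [pow_two]

theorem map_incrementMap (hB : IsBrownianSheet B P) (c : RectIndex →₀ ℝ) :
    P.map (incrementMap hB c) = gaussianReal 0 (‖incrementMap hB c‖ ^ 2).toNNReal := by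
  have hP := hB.gaussian.isProbabilityMeasure
  have e : (incrementMap hB c : Ω → ℝ) =ᵐ[P] fun ω ↦ ∑ q ∈ c.support, c q • increment B q ω := by
    have h1 : ∀ q ∈ c.support, (c q • (hB.memLp_increment q).toLp _ : Lp ℝ 2 P) =ᵐ[P]
        fun ω ↦ c q • increment B q ω := by
      intro q _
      filter_upwards [Lp.coeFn_smul (c q) ((hB.memLp_increment q).toLp _),
        (hB.memLp_increment q).coeFn_toLp] with ω h2 h3
      rw [h2, Pi.smul_apply, h3]
    have h2 := (Lp.coeFn_finsetSum (μ := P) (p := 2) c.support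
      fun q ↦ (c q • (hB.memLp_increment q).toLp _ : Lp ℝ 2 P))
    have h3 : ∀ᵐ ω ∂P, ∀ q ∈ c.support, (c q • (hB.memLp_increment q).toLp _ : Lp ℝ 2 P) ω =
        c q • increment B q ω := (Finset.eventually_all _).mpr h1
    filter_upwards [h2, h3] with ω h4 h5
    rw [incrementMap, Finsupp.linearCombination_apply, Finsupp.sum, h4, Finset.sum_apply]
    exact Finset.sum_congr rfl h5
  have hg : HasGaussianLaw (incrementMap hB c) P :=
    (((isGaussianProcess_increment hB).smul c).hasGaussianLaw_fun_sum (I := c.support)).congr e.symm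
  have h0 : ∫ ω, incrementMap hB c ω ∂P = 0 := by
    have hi : ∀ q ∈ c.support, Integrable (fun ω ↦ c q • increment B q ω) P := fun q _ ↦
      ((hB.memLp_increment q).integrable (by norm_num)).smul (c q)
    rw [integral_congr_ae e, integral_finsetSum _ hi]
    refine Finset.sum_eq_zero fun q _ ↦ ?_
    rw [integral_smul, hB.integral_increment, smul_zero]
  rw [hg.map_eq_gaussianReal, h0, variance_of_integral_eq_zero hg.aemeasurable h0]
  rw [integral_sq_eq_norm_sq]

end Sheet

/-! ### Isonormal Gaussian processes -/

section Isonormal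

variable {Ω : Type*} [MeasurableSpace Ω] {P : Measure Ω} [IsProbabilityMeasure P]
  {H : Type*} [NormedAddCommGroup H] [InnerProductSpace ℝ H]

/-- An isonormal Gaussian process over `H`: a linear map into `L²(P)` under which the law of the
image of `f` is the centred Gaussian law of variance `‖f‖²`. -/
structure IsIsonormal (P : Measure Ω) (I : H →L[ℝ] Lp ℝ 2 P) : Prop where
  law : ∀ f, P.map (I f) = gaussianReal 0 (‖f‖ ^ 2).toNNReal

theorem aemeasurable_Lp (X : Lp ℝ 2 P) : AEMeasurable X P :=
  (Lp.aestronglyMeasurable X).aemeasurable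

theorem charFun_map_Lp (X : Lp ℝ 2 P) (t : ℝ) :
    charFun (P.map X) t = ∫ ω, Complex.exp (t * X ω * Complex.I) ∂P := by
  rw [charFun_apply_real, integral_map (aemeasurable_Lp X) (by fun_prop)]

theorem norm_exp_sub_exp_le (a b : ℝ) :
    ‖Complex.exp (a * Complex.I) - Complex.exp (b * Complex.I)‖ ≤ |a - b| := by
  have h : Complex.exp (a * Complex.I) - Complex.exp (b * Complex.I) =
      Complex.exp (b * Complex.I) * (Complex.exp (Complex.I * ((a - b : ℝ) : ℂ)) - 1) := by
    rw [mul_sub, ← Complex.exp_add, mul_one]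
    congr 2
    push_cast
    ring
  rw [h, norm_mul, Complex.norm_exp_ofReal_mul_I, one_mul]
  exact Real.norm_exp_I_mul_ofReal_sub_one_le

theorem integral_abs_le_norm (X : Lp ℝ 2 P) : ∫ ω, |X ω| ∂P ≤ ‖X‖ := by
  have h1 : eLpNorm X 1 P ≤ eLpNorm X 2 P :=
    eLpNorm_le_eLpNorm_of_exponent_le (by norm_num) (Lp.aestronglyMeasurable X)
  have h2 : ∫ ω, |X ω| ∂P = (eLpNorm X 1 P).toReal := by
    rw [eLpNorm_one_eq_lintegral_enorm, ← integral_norm_eq_lintegral_enorm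
      (Lp.aestronglyMeasurable X)]
    rfl
  rw [h2, Lp.norm_def]
  exact ENNReal.toReal_mono (Lp.eLpNorm_ne_top X) h1

/-- Convergence in `L²` implies convergence of characteristic functions. -/
theorem continuous_charFun_map (t : ℝ) :
    Continuous fun X : Lp ℝ 2 P ↦ charFun (P.map X) t := by
  have hi : ∀ X : Lp ℝ 2 P, Integrable (fun ω ↦ Complex.exp (t * X ω * Complex.I)) P := by
    intro X
    have hm := aemeasurable_Lp X
    refine Integrable.of_bound (C := 1) (by fun_prop) (ae_of_all _ fun ω ↦ ?_)
    rw [← Complex.ofReal_mul, Complex.norm_exp_ofReal_mul_I]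
  refine LipschitzWith.continuous (K := ⟨|t|, abs_nonneg t⟩) (LipschitzWith.of_dist_le_mul
    fun X Y ↦ ?_)
  rw [dist_eq_norm, charFun_map_Lp, charFun_map_Lp, ← integral_sub (hi X) (hi Y), dist_eq_norm]
  calc ‖∫ ω, (Complex.exp (t * X ω * Complex.I) - Complex.exp (t * Y ω * Complex.I)) ∂P‖
      ≤ ∫ ω, |t| * |(X - Y : Lp ℝ 2 P) ω| ∂P := by
        refine norm_integral_le_of_norm_le ?_ ?_
        · exact (((Lp.memLp (X - Y)).integrable (by norm_num)).abs).const_mul _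
        · filter_upwards [Lp.coeFn_sub X Y] with ω hω
          rw [hω, Pi.sub_apply, ← abs_mul, mul_sub, ← Complex.ofReal_mul, ← Complex.ofReal_mul]
          exact norm_exp_sub_exp_le _ _
    _ ≤ |t| * ‖X - Y‖ := by
        rw [integral_const_mul]
        exact mul_le_mul_of_nonneg_left (integral_abs_le_norm _) (abs_nonneg t)

theorem charFun_gaussianReal_norm (c t : ℝ) :
    charFun (gaussianReal 0 (c ^ 2).toNNReal) t = Complex.exp (-(c ^ 2 * t ^ 2 / 2 : ℝ)) := by
  rw [charFun_gaussianReal, Real.coe_toNNReal _ (sq_nonneg c)]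
  congr 1
  push_cast
  ring

/-- The Wiener integral is an isonormal process: finite combinations of increments are Gaussian, and
characteristic functions pass to the limit in `L²`. -/
theorem IsBrownianSheet.isIsonormal {B : ℝ → ℝ≥0 → Ω → ℝ} (hB : IsBrownianSheet B P) :
    IsIsonormal P (wienerIntegralMap B P) := by
  refine ⟨fun f ↦ ?_⟩
  have : IsProbabilityMeasure (P.map (wienerIntegralMap B P f)) :=
    Measure.isProbabilityMeasure_map (aemeasurable_Lp _)
  refine Measure.ext_of_charFun (funext fun t ↦ ?_)
  rw [charFun_gaussianReal_norm]
  refine denseRange_rect.induction_on f ?_ fun c ↦ ?_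
  · exact isClosed_eq ((continuous_charFun_map t).comp (wienerIntegralMap B P).continuous)
      (by fun_prop)
  · rw [wienerIntegralMap_linearCombination hB, map_incrementMap hB, charFun_gaussianReal_norm,
      norm_incrementMap]

variable {I : H →L[ℝ] Lp ℝ 2 P}

namespace IsIsonormal

theorem hasGaussianLaw (hI : IsIsonormal P I) (f : H) : HasGaussianLaw (I f) P :=
  ⟨by rw [hI.law]; infer_instance⟩

theorem integral_eq_zero (hI : IsIsonormal P I) (f : H) : ∫ ω, I f ω ∂P = 0 := by
  have h := integral_map (aemeasurable_Lp (I f)) (f := fun x : ℝ ↦ x) (by fun_prop)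
  rw [← h, hI.law, integral_id_gaussianReal]

theorem norm_map (hI : IsIsonormal P I) (f : H) : ‖I f‖ = ‖f‖ := by
  have h1 : Var[I f; P] = ‖f‖ ^ 2 := by
    rw [← variance_id_map (aemeasurable_Lp (I f)), hI.law, variance_id_gaussianReal,
      Real.coe_toNNReal _ (sq_nonneg _)]
  rw [variance_of_integral_eq_zero (aemeasurable_Lp _) (hI.integral_eq_zero f),
    integral_sq_eq_norm_sq] at h1
  exact (pow_left_inj₀ (norm_nonneg _) (norm_nonneg _) two_ne_zero).mp h1

theorem inner_map (hI : IsIsonormal P I) (f g : H) : inner ℝ (I f) (I g) = inner ℝ f g :=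
  LinearIsometry.inner_map_map ⟨I.toLinearMap, hI.norm_map⟩ f g

theorem integral_mul (hI : IsIsonormal P I) (f g : H) :
    ∫ ω, I f ω * I g ω ∂P = inner ℝ f g := by
  rw [← hI.inner_map, L2.inner_def]
  exact integral_congr_ae (ae_of_all _ fun ω ↦ mul_comm _ _)

/-- A finite linear combination of coordinates of an isonormal process is a coordinate. -/
theorem dual_ae_eq {ι : Type*} [Fintype ι] (J : ι → H) (L : StrongDual ℝ (ι → ℝ)) :
    (fun ω ↦ L fun i ↦ I (J i) ω) =ᵐ[P] I (∑ i, L (Pi.basisFun ℝ ι i) • J i) := by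
  classical
  have h1 := Lp.coeFn_finsetSum (μ := P) (p := 2) Finset.univ
    fun i ↦ (L (Pi.basisFun ℝ ι i) • I (J i) : Lp ℝ 2 P)
  have h2 : ∀ᵐ ω ∂P, ∀ i, (L (Pi.basisFun ℝ ι i) • I (J i) : Lp ℝ 2 P) ω =
      L (Pi.basisFun ℝ ι i) * I (J i) ω :=
    ae_all_iff.mpr fun i ↦ by
      filter_upwards [Lp.coeFn_smul (L (Pi.basisFun ℝ ι i)) (I (J i))] with ω h
      rw [h, Pi.smul_apply, smul_eq_mul]
  filter_upwards [h1, h2] with ω h3 h4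
  rw [map_sum]
  simp only [map_smul]
  rw [h3, Finset.sum_apply, Finset.sum_congr rfl fun i _ ↦ h4 i]
  conv_lhs => rw [← (Pi.basisFun ℝ ι).sum_repr fun i ↦ I (J i) ω]
  simp [mul_comm]

theorem isGaussianProcess (hI : IsIsonormal P I) {ι : Type*} (J : ι → H) :
    IsGaussianProcess (fun i ω ↦ I (J i) ω) P := by
  refine ⟨fun S ↦ ⟨isGaussian_of_isGaussian_map fun L ↦ ?_⟩⟩
  have hm : AEMeasurable (fun ω ↦ S.restrict (fun i ↦ I (J i) ω)) P :=
    aemeasurable_pi_iff.mpr fun i ↦ aemeasurable_Lp _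
  rw [AEMeasurable.map_map_of_aemeasurable (by fun_prop) hm,
    show L ∘ (fun ω ↦ S.restrict (fun i ↦ I (J i) ω)) = fun ω ↦ L fun i : S ↦ I (J i) ω from rfl,
    Measure.map_congr (dual_ae_eq (fun i : S ↦ J i) L), hI.law]
  infer_instance

/-- Two families of coordinates with the same Gram matrix have the same law. -/
theorem identDistrib (hI : IsIsonormal P I) {ι : Type*} [Countable ι] (J K : ι → H)
    (h : ∀ i j, inner ℝ (J i) (J j) = inner ℝ (K i) (K j)) :
    IdentDistrib (fun ω i ↦ I (J i) ω) (fun ω i ↦ I (K i) ω) P P := by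
  have hJ : AEMeasurable (fun ω i ↦ I (J i) ω) P :=
    aemeasurable_pi_iff.mpr fun i ↦ aemeasurable_Lp _
  have hK : AEMeasurable (fun ω i ↦ I (K i) ω) P :=
    aemeasurable_pi_iff.mpr fun i ↦ aemeasurable_Lp _
  refine (identDistrib_iff_forall_finset_identDistrib hJ hK).mpr fun S ↦ ?_
  have hJ' : AEMeasurable (fun ω ↦ S.restrict (fun i ↦ I (J i) ω)) P :=
    aemeasurable_pi_iff.mpr fun i ↦ aemeasurable_Lp _
  have hK' : AEMeasurable (fun ω ↦ S.restrict (fun i ↦ I (K i) ω)) P :=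
    aemeasurable_pi_iff.mpr fun i ↦ aemeasurable_Lp _
  refine ⟨hJ', hK', ?_⟩
  have := Measure.isProbabilityMeasure_map hJ'
  have := Measure.isProbabilityMeasure_map hK'
  refine Measure.ext_of_charFunDual (funext fun L ↦ ?_)
  rw [charFunDual_eq_charFun_map_one, charFunDual_eq_charFun_map_one,
    AEMeasurable.map_map_of_aemeasurable (by fun_prop) hJ',
    AEMeasurable.map_map_of_aemeasurable (by fun_prop) hK',
    show L ∘ (fun ω ↦ S.restrict (fun i ↦ I (J i) ω)) = fun ω ↦ L fun i : S ↦ I (J i) ω from rfl,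
    show L ∘ (fun ω ↦ S.restrict (fun i ↦ I (K i) ω)) = fun ω ↦ L fun i : S ↦ I (K i) ω from rfl,
    Measure.map_congr (dual_ae_eq (fun i : S ↦ J i) L),
    Measure.map_congr (dual_ae_eq (fun i : S ↦ K i) L), hI.law, hI.law,
    ← real_inner_self_eq_norm_sq, ← real_inner_self_eq_norm_sq]
  simp only [sum_inner, inner_sum, real_inner_smul_left, real_inner_smul_right, h]

/-- Orthogonal families of coordinates are independent, since all of them are jointly Gaussian. -/
theorem indepFun (hI : IsIsonormal P I) {S T : Type*} (J : S → H) (K : T → H)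
    (h : ∀ s t, inner ℝ (J s) (K t) = 0) :
    IndepFun (fun ω s ↦ I (J s) ω) (fun ω t ↦ I (K t) ω) P := by
  have e : (Sum.elim (fun s ω ↦ I (J s) ω) (fun t ω ↦ I (K t) ω) : S ⊕ T → Ω → ℝ) =
      fun i ω ↦ I (Sum.elim J K i) ω := by
    funext i
    cases i <;> rfl
  refine IsGaussianProcess.indepFun_of_covariance_eq_zero (e ▸ hI.isGaussianProcess _)
    (fun s ↦ aemeasurable_Lp _) (fun t ↦ aemeasurable_Lp _) fun s t ↦ ?_
  rw [covariance_eq_sub (Lp.memLp _) (Lp.memLp _)]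
  simp only [Pi.mul_apply, hI.integral_mul, h, hI.integral_eq_zero, mul_zero, sub_zero]

theorem memLp (hI : IsIsonormal P I) (f : H) {p : ℝ≥0∞} (hp : p ≠ ∞) : MemLp (I f) p P :=
  (hI.hasGaussianLaw f).memLp hp

/-- All `L^p` norms of a centred Gaussian variable are proportional. -/
theorem eLpNorm_eq (hI : IsIsonormal P I) (f : H) (p : ℝ≥0∞) :
    eLpNorm (I f) p P = ‖f‖ₑ * eLpNorm (fun x : ℝ ↦ x) p (gaussianReal 0 1) := by
  have h1 : eLpNorm (fun x : ℝ ↦ x) p (P.map (I f)) = eLpNorm (I f) p P :=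
    eLpNorm_map_measure (by fun_prop) (aemeasurable_Lp _)
  have h2 : gaussianReal 0 (‖f‖ ^ 2).toNNReal = (gaussianReal 0 1).map (‖f‖ * ·) := by
    rw [gaussianReal_map_const_mul, mul_zero, mul_one]
    congr 1
    exact NNReal.coe_injective (Real.coe_toNNReal _ (sq_nonneg _))
  rw [← h1, hI.law, h2, eLpNorm_map_measure (by fun_prop) (by fun_prop)]
  have := eLpNorm_const_smul (‖f‖) (fun x : ℝ ↦ x) p (gaussianReal 0 1)
  rw [enorm_norm] at this
  exact this

end IsIsonormal

end Isonormal

/-! ### Integrals and measurable versions of processes in `L²` -/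

section Versions

/-- The pathwise integral of a jointly measurable version of an `L²`-valued integrable function is
a version of its Bochner integral in `L²`. -/
theorem ae_integral_eq_of_version {T Ω : Type*} [MeasurableSpace T] [MeasurableSpace Ω]
    {ν : Measure T} {μ : Measure Ω} [SigmaFinite ν] [SigmaFinite μ] {F : T → Lp ℝ 2 μ}
    (hF : Integrable F ν) {A : T → Ω → ℝ}
    (hA : AEStronglyMeasurable (fun p : T × Ω ↦ A p.1 p.2) (ν.prod μ))
    (h : ∀ᵐ y ∂ν, A y =ᵐ[μ] F y) :
    ∀ᵐ ω ∂μ, Integrable (fun y ↦ A y ω) ν ∧ ∫ y, A y ω ∂ν = (∫ y, F y ∂ν : Lp ℝ 2 μ) ω := by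
  -- Fubini applies over sets of finite measure, where square integrable functions are integrable;
  -- integrals over such sets also determine the two sides.
  have hs : ∀ s, MeasurableSet s → μ s < ∞ →
      Integrable (fun p : T × Ω ↦ A p.1 p.2) (ν.prod (μ.restrict s)) := by
    intro s hs hμs
    have hfin : IsFiniteMeasure (μ.restrict s) := ⟨by rwa [Measure.restrict_apply_univ]⟩
    have hA' : AEStronglyMeasurable (fun p : T × Ω ↦ A p.1 p.2) (ν.prod (μ.restrict s)) :=
      hA.mono_ac (Measure.AbsolutelyContinuous.rfl.prod Measure.restrict_le_self.absolutelyContinuous)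
    have hint : ∀ X : Lp ℝ 2 μ, Integrable X (μ.restrict s) := fun X ↦
      ((Lp.memLp X).restrict s).integrable (by norm_num)
    refine (integrable_prod_iff hA').mpr ⟨?_, ?_⟩
    · filter_upwards [h] with y hy
      exact (hint (F y)).congr (ae_restrict_of_ae hy.symm)
    · have hb : Integrable (fun y ↦ ‖F y‖ * ‖indicatorConstLp 2 hs hμs.ne (1 : ℝ)‖) ν :=
        hF.norm.mul_const _
      refine hb.mono' (hA'.norm.integral_prod_right') ?_
      filter_upwards [h] with y hy
      have h1 : ∫ ω, ‖A y ω‖ ∂μ.restrict s = ∫ ω in s, |F y| ω ∂μ := by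
        refine integral_congr_ae (ae_restrict_of_ae ?_)
        filter_upwards [hy, Lp.coeFn_abs (F y)] with ω h2 h3
        rw [h2, h3, Real.norm_eq_abs]
      rw [Real.norm_of_nonneg (integral_nonneg fun ω ↦ norm_nonneg _), h1,
        ← L2.inner_indicatorConstLp_one hs hμs.ne, mul_comm, ← norm_abs_eq_norm (F y)]
      exact real_inner_le_norm _ _
  have hae : ∀ᵐ ω ∂μ, Integrable (fun y ↦ A y ω) ν := by
    have hk : ∀ k : ℕ, ∀ᵐ ω ∂μ.restrict (spanningSets μ k), Integrable (fun y ↦ A y ω) ν :=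
      fun k ↦ (hs _ (measurableSet_spanningSets μ k) (measure_spanningSets_lt_top μ k)).prod_left_ae
    have := (ae_restrict_iUnion_iff _ _).mpr hk
    rwa [iUnion_spanningSets, Measure.restrict_univ] at this
  have heq : (fun ω ↦ ∫ y, A y ω ∂ν) =ᵐ[μ] (∫ y, F y ∂ν : Lp ℝ 2 μ) := by
    refine ae_eq_of_forall_setIntegral_eq_of_sigmaFinite (fun s h1 h2 ↦ ?_) (fun s h1 h2 ↦ ?_)
      fun s h1 h2 ↦ ?_
    · exact (hs s h1 h2).integral_prod_right
    · have hfin : IsFiniteMeasure (μ.restrict s) := ⟨by rwa [Measure.restrict_apply_univ]⟩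
      exact ((Lp.memLp _).restrict s).integrable (by norm_num)
    · rw [← integral_integral_swap (hs s h1 h2), ← L2.inner_indicatorConstLp_one h1 h2.ne,
        ← integral_inner hF]
      refine integral_congr_ae ?_
      filter_upwards [h] with y hy
      rw [L2.inner_indicatorConstLp_one]
      exact integral_congr_ae (ae_restrict_of_ae hy)
  filter_upwards [hae, heq] with ω h1 h2
  exact ⟨h1, h2⟩

/-- Convergence in `L²` with summable squared errors implies almost sure convergence. -/
theorem ae_tendsto_of_tsum_lintegral {Ω : Type*} [MeasurableSpace Ω] {μ : Measure Ω}
    {f : ℕ → Ω → ℝ} {g : Ω → ℝ} (hf : ∀ n, AEMeasurable (f n) μ) (hg : AEMeasurable g μ)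
    (h : ∑' n, ∫⁻ ω, ‖f n ω - g ω‖ₑ ^ 2 ∂μ ≠ ∞) :
    ∀ᵐ ω ∂μ, Tendsto (fun n ↦ f n ω) atTop (𝓝 (g ω)) := by
  have hm : ∀ n, AEMeasurable (fun ω ↦ ‖f n ω - g ω‖ₑ ^ 2) μ := fun n ↦
    ((hf n).sub hg).enorm.pow_const 2
  rw [← lintegral_tsum hm] at h
  filter_upwards [ae_lt_top' (AEMeasurable.tsum hm) h] with ω hω
  have h1 := ENNReal.tendsto_atTop_zero_of_tsum_ne_top hω.ne
  rw [tendsto_iff_edist_tendsto_0]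
  have h2 := (ENNReal.continuous_rpow_const (y := 1 / 2)).tendsto 0 |>.comp h1
  simp only [Function.comp_def, ENNReal.zero_rpow_of_pos (by norm_num : (0 : ℝ) < 1 / 2)] at h2
  refine h2.congr fun n ↦ ?_
  rw [← ENNReal.rpow_natCast, ← ENNReal.rpow_mul, edist_eq_enorm_sub]
  norm_num

theorem lintegral_enorm_sub_sq {Ω : Type*} [MeasurableSpace Ω] {μ : Measure Ω} (X Y : Lp ℝ 2 μ) :
    ∫⁻ ω, ‖X ω - Y ω‖ₑ ^ 2 ∂μ = ‖X - Y‖ₑ ^ 2 := by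
  have h1 : ∫⁻ ω, ‖X ω - Y ω‖ₑ ^ 2 ∂μ = ∫⁻ ω, ‖(X - Y : Lp ℝ 2 μ) ω‖ₑ ^ 2 ∂μ := by
    refine lintegral_congr_ae ?_
    filter_upwards [Lp.coeFn_sub X Y] with ω h
    rw [h, Pi.sub_apply]
  rw [h1, Lp.enorm_def, eLpNorm_eq_lintegral_rpow_enorm_toReal (by norm_num) (by norm_num),
    ← ENNReal.rpow_natCast, ← ENNReal.rpow_mul]
  norm_num

/-- A uniformly continuous `L²`-valued function of a real parameter has a jointly measurable
version, the almost sure limit of step processes. -/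
theorem exists_measurable_version {Ω : Type*} [MeasurableSpace Ω] {μ : Measure Ω}
    {X : ℝ → Lp ℝ 2 μ} (hX : UniformContinuous X) :
    ∃ A : ℝ → Ω → ℝ, Measurable (fun p : ℝ × Ω ↦ A p.1 p.2) ∧ ∀ y, A y =ᵐ[μ] X y := by
  have hδ : ∀ n : ℕ, ∃ δ > 0, ∀ y z, dist y z < δ → dist (X y) (X z) < (1 / 2) ^ n := fun n ↦
    (Metric.uniformContinuous_iff.mp hX ((1 / 2) ^ n) (by positivity)).imp
      fun δ h ↦ ⟨h.1, fun y z hyz ↦ h.2 hyz⟩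
  choose δ hδ0 hδ using hδ
  -- Sampling the process at the mesh `δ n` makes an error of at most `2⁻ⁿ` in `L²`, which is
  -- summable.
  let S : ℕ → ℝ → Ω → ℝ := fun n y ω ↦ X ((⌊y / δ n⌋ : ℝ) * δ n) ω
  have hS : ∀ n, Measurable fun p : ℝ × Ω ↦ S n p.1 p.2 := by
    intro n
    have h1 : Measurable fun q : ℤ × Ω ↦ X ((q.1 : ℝ) * δ n) q.2 :=
      measurable_from_prod_countable_right fun k ↦
        (Lp.stronglyMeasurable (X ((k : ℝ) * δ n))).measurable
    have h2 : Measurable fun p : ℝ × Ω ↦ (⌊p.1 / δ n⌋, p.2) :=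
      ((measurable_fst.div_const _).floor).prodMk measurable_snd
    exact h1.comp h2
  refine ⟨fun y ω ↦ limsup (fun n ↦ S n y ω) atTop, Measurable.limsup hS, fun y ↦ ?_⟩
  have hae : ∀ᵐ ω ∂μ, Tendsto (fun n ↦ S n y ω) atTop (𝓝 (X y ω)) := by
    refine ae_tendsto_of_tsum_lintegral (fun n ↦ (Lp.aestronglyMeasurable _).aemeasurable)
      (Lp.aestronglyMeasurable _).aemeasurable ?_
    have hb : ∀ n, ∫⁻ ω, ‖S n y ω - X y ω‖ₑ ^ 2 ∂μ ≤ (1 / 2) ^ n := by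
      intro n
      rw [lintegral_enorm_sub_sq]
      have h1 : dist ((⌊y / δ n⌋ : ℝ) * δ n) y < δ n := by
        have h2 := Int.floor_le (y / δ n)
        have h3 := Int.lt_floor_add_one (y / δ n)
        rw [le_div_iff₀ (hδ0 n)] at h2
        rw [div_lt_iff₀ (hδ0 n)] at h3
        rw [Real.dist_eq, abs_lt]
        constructor <;> linarith
      have h2 := hδ n _ _ h1
      rw [dist_eq_norm] at h2
      have h3 : ‖X ((⌊y / δ n⌋ : ℝ) * δ n) - X y‖ₑ ≤ (1 / 2) ^ n := by
        rw [← ofReal_norm]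
        refine (ENNReal.ofReal_le_ofReal h2.le).trans (le_of_eq ?_)
        rw [ENNReal.ofReal_pow (by norm_num), ENNReal.ofReal_div_of_pos (by norm_num)]
        simp
      calc _ ≤ ((1 / 2 : ℝ≥0∞) ^ n) ^ 2 := pow_le_pow_left' h3 2
        _ ≤ (1 / 2) ^ n := by
          rw [← pow_mul]
          exact pow_le_pow_right_of_le_one' (by simp) (by omega)
    refine ne_top_of_le_ne_top ?_ (ENNReal.tsum_le_tsum hb)
    rw [ENNReal.tsum_geometric]
    simp
  filter_upwards [hae] with ω hω
  exact hω.limsup_eq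

end Versions

/-! ### Continuous versions of Gaussian fields on compact metric spaces -/

section Kolmogorov

variable {K : Type*} [MetricSpace K] [CompactSpace K]

/-- A continuous partition of unity subordinate to the balls of radius `2δ` around the points of a
finite `δ`-net. -/
theorem exists_partition (S : Finset K) {δ : ℝ} (hS : ∀ s, ∃ t ∈ S, dist s t < δ) :
    ∃ φ : K → C(K, ℝ), (∀ t s, 0 ≤ φ t s) ∧ (∀ s, ∑ t ∈ S, φ t s = 1) ∧
      ∀ t s, φ t s ≠ 0 → dist s t < 2 * δ := by
  let b : K → K → ℝ := fun t s ↦ max 0 (2 * δ - dist s t)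
  have hb0 : ∀ t s, 0 ≤ b t s := fun t s ↦ le_max_left _ _
  have hbc : ∀ t, Continuous (b t) := fun t ↦ by fun_prop
  have hpos : ∀ s, 0 < ∑ t ∈ S, b t s := by
    intro s
    obtain ⟨t, ht, hd⟩ := hS s
    have hδ : 0 < δ := lt_of_le_of_lt dist_nonneg hd
    refine Finset.sum_pos' (fun t _ ↦ hb0 t s) ⟨t, ht, lt_max_of_lt_right (by linarith)⟩
  refine ⟨fun t ↦ ⟨fun s ↦ b t s / ∑ t ∈ S, b t s, ?_⟩, fun t s ↦ ?_, fun s ↦ ?_, fun t s h ↦ ?_⟩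
  · exact (hbc t).div (continuous_finsetSum _ fun t _ ↦ hbc t) fun s ↦ (hpos s).ne'
  · exact div_nonneg (hb0 t s) (hpos s).le
  · simp only [ContinuousMap.coe_mk]
    rw [← Finset.sum_div, div_self (hpos s).ne']
  · by_contra hd
    refine h ?_
    simp only [ContinuousMap.coe_mk]
    rw [show b t s = 0 from max_eq_left (by linarith), zero_div]

variable {Ω : Type*} [MeasurableSpace Ω] {P : Measure Ω} [IsProbabilityMeasure P]
  {H : Type*} [NormedAddCommGroup H] [InnerProductSpace ℝ H] {I : H →L[ℝ] Lp ℝ 2 P}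

/-- The interpolation of the field `I ∘ W` from the points of `S`. -/
def interpolation (I : H →L[ℝ] Lp ℝ 2 P) (W : K → H) (S : Finset K) (φ : K → C(K, ℝ)) (ω : Ω) :
    C(K, ℝ) := ∑ t ∈ S, I (W t) ω • φ t

theorem memLp_interpolation (hI : IsIsonormal P I) (W : K → H) (S : Finset K) (φ : K → C(K, ℝ))
    {p : ℝ≥0∞} (hp : p ≠ ∞) : MemLp (interpolation I W S φ) p P :=
  memLp_finsetSum S fun t _ ↦
    ((ContinuousLinearMap.id ℝ ℝ).smulRight (φ t)).comp_memLp' (hI.memLp (W t) hp)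

/-- The difference of two interpolations is at each point an average of differences of the field
over pairs of close net points, so its supremum is controlled by the sum over all such pairs. -/
theorem pow_norm_interpolation_sub_le (W : K → H) {S S' : Finset K} {φ φ' : K → C(K, ℝ)}
    {δ δ' : ℝ} (h0 : ∀ t s, 0 ≤ φ t s) (h1 : ∀ s, ∑ t ∈ S, φ t s = 1)
    (h2 : ∀ t s, φ t s ≠ 0 → dist s t < 2 * δ) (h0' : ∀ t s, 0 ≤ φ' t s)
    (h1' : ∀ s, ∑ t ∈ S', φ' t s = 1) (h2' : ∀ t s, φ' t s ≠ 0 → dist s t < 2 * δ')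
    {p : ℕ} (hp : p ≠ 0) (ω : Ω) :
    ‖interpolation I W S φ ω - interpolation I W S' φ' ω‖ ^ p ≤
      ∑ q ∈ S ×ˢ S' with dist q.1 q.2 < 2 * δ + 2 * δ', |I (W q.1) ω - I (W q.2) ω| ^ p := by
  set R := ∑ q ∈ S ×ˢ S' with dist q.1 q.2 < 2 * δ + 2 * δ', |I (W q.1) ω - I (W q.2) ω| ^ p
    with hR
  have hR0 : 0 ≤ R := Finset.sum_nonneg fun q _ ↦ by positivity
  have hRp : (R ^ (1 / (p : ℝ))) ^ p = R := by
    rw [one_div, Real.rpow_inv_natCast_pow hR0 hp]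
  suffices h : ‖interpolation I W S φ ω - interpolation I W S' φ' ω‖ ≤ R ^ (1 / (p : ℝ)) by
    rw [← hRp]
    exact pow_le_pow_left₀ (norm_nonneg _) h p
  refine (ContinuousMap.norm_le _ (by positivity)).mpr fun s ↦ ?_
  rw [← pow_le_pow_iff_left₀ (norm_nonneg _) (by positivity) hp, hRp]
  have hw1 : ∑ q ∈ S ×ˢ S', φ q.1 s * φ' q.2 s = 1 := by
    rw [Finset.sum_product, ← Finset.sum_mul_sum S S' (fun t ↦ φ t s) fun t ↦ φ' t s, h1, h1',
      one_mul]
  have hw0 : ∀ q ∈ S ×ˢ S', 0 ≤ φ q.1 s * φ' q.2 s := fun q _ ↦ mul_nonneg (h0 _ _) (h0' _ _)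
  have e : (interpolation I W S φ ω - interpolation I W S' φ' ω) s =
      ∑ q ∈ S ×ˢ S', φ q.1 s * φ' q.2 s * (I (W q.1) ω - I (W q.2) ω) := by
    have e1 : ∑ q ∈ S ×ˢ S', φ q.1 s * φ' q.2 s * I (W q.1) ω =
        ∑ t ∈ S, I (W t) ω * φ t s := by
      rw [Finset.sum_product]
      refine Finset.sum_congr rfl fun t _ ↦ ?_
      simp only [mul_comm (φ t s), mul_assoc]
      rw [← Finset.sum_mul, h1', one_mul, mul_comm]
    have e2 : ∑ q ∈ S ×ˢ S', φ q.1 s * φ' q.2 s * I (W q.2) ω =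
        ∑ t ∈ S', I (W t) ω * φ' t s := by
      rw [Finset.sum_product_right]
      refine Finset.sum_congr rfl fun t _ ↦ ?_
      simp only [mul_assoc]
      rw [← Finset.sum_mul, h1, one_mul, mul_comm]
    simp only [mul_sub, Finset.sum_sub_distrib, e1, e2, interpolation, ContinuousMap.sub_apply,
      ContinuousMap.sum_apply, ContinuousMap.smul_apply, smul_eq_mul]
  rw [e, Real.norm_eq_abs]
  calc |∑ q ∈ S ×ˢ S', φ q.1 s * φ' q.2 s * (I (W q.1) ω - I (W q.2) ω)| ^ p
      ≤ (∑ q ∈ S ×ˢ S', φ q.1 s * φ' q.2 s * |I (W q.1) ω - I (W q.2) ω|) ^ p := by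
        refine pow_le_pow_left₀ (abs_nonneg _) ((Finset.abs_sum_le_sum_abs _ _).trans_eq ?_) p
        exact Finset.sum_congr rfl fun q hq ↦ by rw [abs_mul, abs_of_nonneg (hw0 q hq)]
    _ ≤ ∑ q ∈ S ×ˢ S', φ q.1 s * φ' q.2 s * |I (W q.1) ω - I (W q.2) ω| ^ p :=
        Real.pow_arith_mean_le_arith_mean_pow _ _ _ hw0 hw1 (fun q _ ↦ abs_nonneg _) p
    _ ≤ R := by
        rw [hR, Finset.sum_filter]
        refine Finset.sum_le_sum fun q hq ↦ ?_
        split_ifs with hd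
        · refine mul_le_of_le_one_left (by positivity) ?_
          rw [← hw1]
          exact Finset.single_le_sum (f := fun q : K × K ↦ φ q.1 s * φ' q.2 s) hw0 hq
        · have : φ q.1 s * φ' q.2 s = 0 := by
            by_contra hne
            refine hd ?_
            have d1 := h2 _ _ (left_ne_zero_of_mul hne)
            have d2 := h2' _ _ (right_ne_zero_of_mul hne)
            have d3 := dist_triangle_left q.1 q.2 s
            linarith
          rw [this, zero_mul]

theorem lintegral_pow_sub (hI : IsIsonormal P I) (f g : H) {p : ℕ} (hp : p ≠ 0) :
    ∫⁻ ω, ‖I f ω - I g ω‖ₑ ^ p ∂P =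
      (‖f - g‖ₑ * eLpNorm (fun x : ℝ ↦ x) p (gaussianReal 0 1)) ^ p := by
  rw [← hI.eLpNorm_eq, map_sub]
  have h1 := eLpNorm_nnreal_pow_eq_lintegral (μ := P) (f := (I f - I g : Lp ℝ 2 P)) (p := (p : ℝ≥0))
    (by exact_mod_cast hp)
  simp only [NNReal.coe_natCast, ENNReal.rpow_natCast, ENNReal.coe_natCast] at h1
  rw [h1]
  refine lintegral_congr_ae ?_
  filter_upwards [Lp.coeFn_sub (I f) (I g)] with ω h
  rw [h, Pi.sub_apply]

/-- **Kolmogorov–Chentsov.** If `W` is Hölder continuous on a compact metric space whose covering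
numbers grow at most geometrically, then the Gaussian field `I ∘ W` has a continuous version with
square integrable supremum: interpolations over finer and finer nets form a Cauchy sequence in
`L^p(P; C(K))` for large `p`. -/
theorem exists_continuous_version (hI : IsIsonormal P I) (W : K → H) {γ C D : ℝ} (hγ : 0 < γ)
    (hC : 0 ≤ C) (hD : 1 ≤ D) (hW : ∀ s t, ‖W s - W t‖ ≤ C * dist s t ^ γ)
    (hnet : ∀ n : ℕ, ∃ S : Finset K, (S.card : ℝ) ≤ D ^ (n + 1) ∧
      ∀ s, ∃ t ∈ S, dist s t < (1 / 2) ^ n) :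
    ∃ X : Ω → C(K, ℝ), StronglyMeasurable X ∧ MemLp X 2 P ∧
      ∀ s, (fun ω ↦ X ω s) =ᵐ[P] I (W s) := by
  choose S hcard hS using hnet
  choose φ h0 h1 h2 using fun n ↦ exists_partition (S n) (hS n)
  -- `p` is large enough for the moment bound to beat the number of pairs of net points
  obtain ⟨p, hp2, hpD⟩ : ∃ p : ℕ, 2 ≤ p ∧ D ^ 2 ≤ ((2 : ℝ) ^ (γ / 2)) ^ p := by
    have hr : 1 < (2 : ℝ) ^ (γ / 2) := Real.one_lt_rpow (by norm_num) (by positivity)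
    obtain ⟨k, hk⟩ := pow_unbounded_of_one_lt (D ^ 2) hr
    exact ⟨k + 2, by omega, hk.le.trans (pow_le_pow_right₀ hr.le (by omega))⟩
  have hp0 : p ≠ 0 := by omega
  have hpt : (p : ℝ≥0∞) ≠ ∞ := ENNReal.natCast_ne_top p
  have hp1 : Fact ((1 : ℝ≥0∞) ≤ p) := ⟨by exact_mod_cast (by omega : 1 ≤ p)⟩
  set m : ℝ≥0∞ := eLpNorm (fun x : ℝ ↦ x) p (gaussianReal 0 1) with hm
  have hmt : m ≠ ∞ := (memLp_id_gaussianReal' (μ := 0) (v := 1) p hpt).eLpNorm_ne_top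
  let X : ℕ → Ω → C(K, ℝ) := fun n ↦ interpolation I W (S n) (φ n)
  have hX : ∀ n, MemLp (X n) p P := fun n ↦ memLp_interpolation hI W _ _ hpt
  set r : ℝ := (2 : ℝ) ^ (-(γ / 2)) with hr
  have hr0 : 0 < r := by positivity
  have hr1 : r < 1 := Real.rpow_lt_one_of_one_lt_of_neg (by norm_num) (by linarith)
  set A : ℝ := D ^ 3 * (C * 4 ^ γ * m.toReal) with hA
  have hA0 : 0 ≤ A := by positivity
  have hstep : ∀ n, eLpNorm (X n - X (n + 1)) p P ≤ ENNReal.ofReal (A * r ^ n) := by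
    intro n
    set δ : ℝ := (1 / 2) ^ n with hδ
    have hδ0 : 0 < δ := by positivity
    have hpow : eLpNorm (X n - X (n + 1)) p P ^ p ≤ ENNReal.ofReal (A * r ^ n) ^ p := by
      have e1 := eLpNorm_nnreal_pow_eq_lintegral (μ := P) (f := X n - X (n + 1)) (p := (p : ℝ≥0))
        (by exact_mod_cast hp0)
      simp only [NNReal.coe_natCast, ENNReal.rpow_natCast, ENNReal.coe_natCast] at e1
      rw [e1]
      set T := (S n ×ˢ S (n + 1)).filter fun q ↦ dist q.1 q.2 < 2 * δ + 2 * (1 / 2) ^ (n + 1)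
        with hT
      have b1 : ∀ ω, ‖(X n - X (n + 1)) ω‖ₑ ^ p ≤ ∑ q ∈ T, ‖I (W q.1) ω - I (W q.2) ω‖ₑ ^ p := by
        intro ω
        have := pow_norm_interpolation_sub_le (I := I) W (h0 n) (h1 n) (h2 n) (h0 (n + 1))
          (h1 (n + 1)) (h2 (n + 1)) hp0 ω
        have h3 := ENNReal.ofReal_le_ofReal this
        rw [ENNReal.ofReal_pow (norm_nonneg _), ofReal_norm,
          ENNReal.ofReal_sum_of_nonneg fun q _ ↦ by positivity] at h3
        refine h3.trans_eq (Finset.sum_congr rfl fun q _ ↦ ?_)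
        rw [ENNReal.ofReal_pow (abs_nonneg _), ← Real.norm_eq_abs, ofReal_norm]
      have b2 : ∀ q ∈ T, ∫⁻ ω, ‖I (W q.1) ω - I (W q.2) ω‖ₑ ^ p ∂P ≤
          ENNReal.ofReal ((C * (4 * δ) ^ γ * m.toReal) ^ p) := by
        intro q hq
        have hd : dist q.1 q.2 ≤ 4 * δ := by
          have := (Finset.mem_filter.mp hq).2
          rw [pow_succ] at this
          linarith
        rw [lintegral_pow_sub hI _ _ hp0, ENNReal.ofReal_pow (by positivity),
          ENNReal.ofReal_mul (by positivity), ENNReal.ofReal_toReal hmt, ← ofReal_norm]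
        gcongr
        exact (hW _ _).trans (by gcongr)
      calc ∫⁻ ω, ‖(X n - X (n + 1)) ω‖ₑ ^ p ∂P
          ≤ ∫⁻ ω, ∑ q ∈ T, ‖I (W q.1) ω - I (W q.2) ω‖ₑ ^ p ∂P := lintegral_mono b1
        _ = ∑ q ∈ T, ∫⁻ ω, ‖I (W q.1) ω - I (W q.2) ω‖ₑ ^ p ∂P :=
            lintegral_finsetSum' _ fun q _ ↦
              (((aemeasurable_Lp _).sub (aemeasurable_Lp _)).enorm.pow_const p)
        _ ≤ T.card • ENNReal.ofReal ((C * (4 * δ) ^ γ * m.toReal) ^ p) :=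
            Finset.sum_le_card_nsmul _ _ _ b2
        _ ≤ ENNReal.ofReal (A * r ^ n) ^ p := by
            rw [nsmul_eq_mul, ← ENNReal.ofReal_natCast, ← ENNReal.ofReal_mul (by positivity),
              ← ENNReal.ofReal_pow (by positivity)]
            refine ENNReal.ofReal_le_ofReal ?_
            have c1 : (T.card : ℝ) ≤ D ^ 3 * (D ^ 2) ^ n := by
              have : (T.card : ℝ) ≤ (S n).card * (S (n + 1)).card := by
                rw [← Nat.cast_mul, ← Finset.card_product]
                exact_mod_cast Finset.card_filter_le _ _
              calc (T.card : ℝ) ≤ (S n).card * (S (n + 1)).card := this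
                _ ≤ D ^ (n + 1) * D ^ (n + 1 + 1) := by
                    gcongr
                    · exact hcard n
                    · exact hcard (n + 1)
                _ = D ^ 3 * (D ^ 2) ^ n := by ring
            have c2 : (4 * δ) ^ γ = 4 ^ γ * (r ^ n * r ^ n) := by
              rw [Real.mul_rpow (by norm_num) hδ0.le, hδ, hr, ← mul_pow,
                ← Real.rpow_add (by norm_num), ← Real.rpow_natCast, ← Real.rpow_natCast,
                ← Real.rpow_mul (by norm_num), ← Real.rpow_mul (by norm_num), one_div,
                Real.inv_rpow (by norm_num), ← Real.rpow_neg (by norm_num)]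
              congr 2
              ring
            have c3 : (D ^ 2) ^ n * (r ^ n) ^ p ≤ 1 := by
              have : D ^ 2 * r ^ p ≤ 1 := by
                have e3 : r = ((2 : ℝ) ^ (γ / 2))⁻¹ := by rw [hr, Real.rpow_neg (by norm_num)]
                rw [e3, inv_pow, ← div_eq_mul_inv]
                exact (div_le_one (by positivity)).mpr hpD
              rw [← pow_mul r, mul_comm n p, pow_mul, ← mul_pow]
              exact pow_le_one₀ (by positivity) this
            have c4 : D ^ 3 ≤ (D ^ 3) ^ p := le_self_pow₀ (one_le_pow₀ hD) hp0
            rw [c2, hA]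
            calc (T.card : ℝ) * (C * (4 ^ γ * (r ^ n * r ^ n)) * m.toReal) ^ p
                ≤ (D ^ 3 * (D ^ 2) ^ n) * (C * (4 ^ γ * (r ^ n * r ^ n)) * m.toReal) ^ p := by
                  gcongr
              _ = D ^ 3 * ((D ^ 2) ^ n * (r ^ n) ^ p) * (C * 4 ^ γ * m.toReal * r ^ n) ^ p := by
                  simp only [mul_pow]
                  ring
              _ ≤ (D ^ 3) ^ p * 1 * (C * 4 ^ γ * m.toReal * r ^ n) ^ p := by gcongr
              _ = (D ^ 3 * (C * 4 ^ γ * m.toReal) * r ^ n) ^ p := by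
                  simp only [mul_pow]
                  ring
    exact (ENNReal.pow_le_pow_left_iff hp0).mp hpow
  let Y : ℕ → Lp C(K, ℝ) p P := fun n ↦ (hX n).toLp _
  have hY : CauchySeq Y := by
    refine cauchySeq_of_le_geometric r A hr1 fun n ↦ ?_
    rw [Lp.dist_def]
    have e : eLpNorm (⇑(Y n) - ⇑(Y (n + 1))) p P = eLpNorm (X n - X (n + 1)) p P :=
      eLpNorm_congr_ae ((hX n).coeFn_toLp.sub (hX (n + 1)).coeFn_toLp)
    rw [e]
    exact ENNReal.toReal_le_of_le_ofReal (by positivity) (hstep n)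
  obtain ⟨Z, hZ⟩ := cauchySeq_tendsto_of_complete hY
  refine ⟨Z, Lp.stronglyMeasurable Z, (Lp.memLp Z).mono_exponent (by exact_mod_cast hp2),
    fun s ↦ ?_⟩
  have hXs : ∀ n, (fun ω ↦ X n ω s) =ᵐ[P] I (∑ t ∈ S n, φ n t s • W t) := by
    intro n
    have e1 := Lp.coeFn_finsetSum (μ := P) (p := 2) (S n) fun t ↦ (φ n t s • I (W t) : Lp ℝ 2 P)
    have e2 : ∀ᵐ ω ∂P, ∀ t ∈ S n, (φ n t s • I (W t) : Lp ℝ 2 P) ω = φ n t s * I (W t) ω :=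
      (Finset.eventually_all _).mpr fun t _ ↦ by
        filter_upwards [Lp.coeFn_smul (φ n t s) (I (W t))] with ω h
        rw [h, Pi.smul_apply, smul_eq_mul]
    filter_upwards [e1, e2] with ω h3 h4
    rw [map_sum]
    simp only [map_smul]
    rw [h3, Finset.sum_apply, Finset.sum_congr rfl h4]
    simp only [X, interpolation, ContinuousMap.sum_apply, ContinuousMap.smul_apply, smul_eq_mul,
      mul_comm]
  have hXm : ∀ n, AEStronglyMeasurable (fun ω ↦ X n ω s) P := fun n ↦
    (Lp.aestronglyMeasurable _).congr (hXs n).symm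
  have hZm : AEStronglyMeasurable (fun ω ↦ Z ω s) P :=
    (ContinuousMap.evalCLM ℝ s).continuous.comp_aestronglyMeasurable (Lp.aestronglyMeasurable Z)
  -- The interpolations at `s` converge to `Z s` in `L^p` and to `I (W s)` in `L²`; both imply
  -- convergence in measure, so the limits agree.
  refine tendstoInMeasure_ae_unique (f := fun n ω ↦ X n ω s) (u := atTop)
    (tendstoInMeasure_of_tendsto_eLpNorm (p := p) (by exact_mod_cast hp0) hXm hZm ?_)
    (tendstoInMeasure_of_tendsto_eLpNorm (p := 2) (by norm_num) hXm (Lp.aestronglyMeasurable _) ?_)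
  · have hZ' := (Lp.tendsto_Lp_iff_tendsto_eLpNorm' _ _).mp hZ
    refine tendsto_of_tendsto_of_tendsto_of_le_of_le tendsto_const_nhds hZ' (fun _ ↦ zero_le)
      fun n ↦ ?_
    refine eLpNorm_mono_ae ?_
    filter_upwards [(hX n).coeFn_toLp] with ω h
    simp only [Pi.sub_apply, Y, h]
    exact ContinuousMap.norm_coe_le_norm (X n ω - Z ω) s
  · have hlim : Tendsto (fun n ↦ ∑ t ∈ S n, φ n t s • W t) atTop (𝓝 (W s)) := by
      rw [tendsto_iff_norm_sub_tendsto_zero]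
      have hb : ∀ n, ‖∑ t ∈ S n, φ n t s • W t - W s‖ ≤ C * (2 * (1 / 2) ^ n) ^ γ := by
        intro n
        have e : ∑ t ∈ S n, φ n t s • W t - W s = ∑ t ∈ S n, φ n t s • (W t - W s) := by
          simp only [smul_sub, Finset.sum_sub_distrib]
          rw [← Finset.sum_smul, h1 n s, one_smul]
        rw [e]
        calc _ ≤ ∑ t ∈ S n, φ n t s * (C * (2 * (1 / 2) ^ n) ^ γ) := by
              refine norm_sum_le_of_le _ fun t _ ↦ ?_
              rw [norm_smul, Real.norm_of_nonneg (h0 n t s)]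
              rcases eq_or_ne (φ n t s) 0 with hz | hz
              · simp [hz]
              · have hd := h2 n t s hz
                rw [dist_comm] at hd
                refine mul_le_mul_of_nonneg_left ((hW t s).trans ?_) (h0 n t s)
                gcongr
          _ = C * (2 * (1 / 2) ^ n) ^ γ := by rw [← Finset.sum_mul, h1 n s, one_mul]
      refine squeeze_zero (fun n ↦ norm_nonneg _) hb ?_
      have : Tendsto (fun n : ℕ ↦ (2 : ℝ) * (1 / 2) ^ n) atTop (𝓝 (2 * 0)) :=
        (tendsto_pow_atTop_nhds_zero_of_lt_one (by norm_num) (by norm_num)).const_mul 2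
      have h3 := (this.rpow_const (p := γ) (Or.inr hγ.le)).const_mul C
      simpa [Real.zero_rpow hγ.ne'] using h3
    have h4 := (Lp.tendsto_Lp_iff_tendsto_eLpNorm' _ _).mp ((I.continuous.tendsto _).comp hlim)
    refine h4.congr fun n ↦ eLpNorm_congr_ae ?_
    exact (hXs n).symm.sub (ae_eq_refl _)

end Kolmogorov

/-! ### Space integrals of the heat kernel -/

/-- The heat kernel as a function of the elapsed time `τ` and the displacement `z`. -/
def gauss (τ z : ℝ) : ℝ :=
  if 0 < τ then 1 / √(4 * Real.pi * τ) * Real.exp (-z ^ 2 / (4 * τ)) else 0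

/-- The space derivative of the heat kernel. -/
def dgauss (τ z : ℝ) : ℝ := -(z / (2 * τ)) * gauss τ z

theorem heatKernel_eq (y s x t : ℝ) : heatKernel y s x t = gauss (t - s) (x - y) := by
  simp only [heatKernel, gauss, sub_pos]

theorem gauss_of_pos {τ : ℝ} (hτ : 0 < τ) (z : ℝ) :
    gauss τ z = 1 / √(4 * Real.pi * τ) * Real.exp (-z ^ 2 / (4 * τ)) := if_pos hτ

theorem gauss_of_nonpos {τ : ℝ} (hτ : τ ≤ 0) (z : ℝ) : gauss τ z = 0 := if_neg hτ.not_gt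

theorem gauss_nonneg (τ z : ℝ) : 0 ≤ gauss τ z := by
  unfold gauss
  split_ifs <;> positivity

theorem gauss_neg (τ z : ℝ) : gauss τ (-z) = gauss τ z := by simp [gauss]

theorem dgauss_neg (τ z : ℝ) : dgauss τ (-z) = -dgauss τ z := by
  simp only [dgauss, gauss_neg]
  ring

theorem dgauss_of_nonpos {τ : ℝ} (hτ : τ ≤ 0) (z : ℝ) : dgauss τ z = 0 := by
  rw [dgauss, gauss_of_nonpos hτ, mul_zero]

theorem measurable_gauss : Measurable fun q : ℝ × ℝ ↦ gauss q.1 q.2 :=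
  Measurable.ite (measurableSet_lt measurable_const measurable_fst) (by fun_prop) measurable_const

theorem measurable_dgauss : Measurable fun q : ℝ × ℝ ↦ dgauss q.1 q.2 := by
  have := measurable_gauss
  unfold dgauss
  fun_prop

theorem hasDerivAt_gauss (τ z : ℝ) : HasDerivAt (gauss τ) (dgauss τ z) z := by
  rcases lt_or_ge 0 τ with hτ | hτ
  · have h1 : HasDerivAt (fun z : ℝ ↦ -z ^ 2 / (4 * τ)) (-(2 * z) / (4 * τ)) z := by
      have := ((hasDerivAt_pow 2 z).neg).div_const (4 * τ)
      simpa using this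
    have h2 := (h1.exp).const_mul (1 / √(4 * Real.pi * τ))
    have e : gauss τ = fun z ↦ 1 / √(4 * Real.pi * τ) * Real.exp (-z ^ 2 / (4 * τ)) :=
      funext (gauss_of_pos hτ)
    rw [e]
    refine h2.congr_deriv ?_
    rw [dgauss, gauss_of_pos hτ]
    field_simp
    ring
  · have e : gauss τ = fun _ ↦ 0 := funext (gauss_of_nonpos hτ)
    rw [e, dgauss_of_nonpos hτ]
    exact hasDerivAt_const z 0

theorem deriv_heatKernel (y s x t : ℝ) :
    deriv (fun x' ↦ heatKernel y s x' t) x = dgauss (t - s) (x - y) := by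
  simp only [heatKernel_eq]
  exact ((hasDerivAt_gauss (t - s) (x - y)).comp_sub_const x y).deriv

theorem gauss_zero {τ : ℝ} (hτ : 0 < τ) : gauss τ 0 = 1 / √(4 * Real.pi) * τ ^ (-(1 / 2) : ℝ) := by
  rw [gauss_of_pos hτ, Real.sqrt_mul (by positivity), Real.rpow_neg hτ.le, ← Real.sqrt_eq_rpow]
  simp
  ring

theorem gauss_le_gauss_zero (τ z : ℝ) : gauss τ z ≤ gauss τ 0 := by
  rcases lt_or_ge 0 τ with hτ | hτ
  · rw [gauss_of_pos hτ, gauss_of_pos hτ]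
    gcongr ?_ * Real.exp ?_
    rw [div_le_div_iff_of_pos_right (by positivity)]
    nlinarith [sq_nonneg z]
  · rw [gauss_of_nonpos hτ, gauss_of_nonpos hτ]

/-- Chapman–Kolmogorov for the heat kernel. -/
theorem integral_gauss_mul_gauss {τ τ' : ℝ} (hτ : 0 < τ) (hτ' : 0 < τ') (x x' : ℝ) :
    Integrable (fun y ↦ gauss τ (x - y) * gauss τ' (x' - y)) ∧
      ∫ y, gauss τ (x - y) * gauss τ' (x' - y) = gauss (τ + τ') (x - x') := by
  have hpi := Real.pi_pos
  set b : ℝ := (τ + τ') / (4 * τ * τ') with hb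
  have hb0 : 0 < b := by positivity
  set c : ℝ := (x * τ' + x' * τ) / (τ + τ') with hc
  set A : ℝ := 1 / √(4 * Real.pi * τ) * (1 / √(4 * Real.pi * τ')) *
    Real.exp (-(x - x') ^ 2 / (4 * (τ + τ'))) with hA
  have e : (fun y ↦ gauss τ (x - y) * gauss τ' (x' - y)) =
      fun y ↦ A * Real.exp (-b * (y - c) ^ 2) := by
    funext y
    rw [gauss_of_pos hτ, gauss_of_pos hτ', hA, mul_mul_mul_comm, ← Real.exp_add, mul_assoc _ _
      (Real.exp (-b * (y - c) ^ 2)), ← Real.exp_add]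
    congr 2
    rw [hb, hc]
    field_simp
    ring
  have hi : Integrable fun y ↦ Real.exp (-b * (y - c) ^ 2) :=
    (integrable_exp_neg_mul_sq hb0).comp_sub_right c
  rw [e]
  refine ⟨hi.const_mul A, ?_⟩
  rw [integral_const_mul, integral_sub_right_eq_self (fun y ↦ Real.exp (-b * y ^ 2)) c,
    integral_gaussian, gauss_of_pos (by positivity), hA, mul_right_comm]
  congr 1
  rw [div_mul_div_comm, one_mul, ← Real.sqrt_mul (by positivity), one_div_mul_eq_div,
    ← Real.sqrt_div' _ (by positivity), ← Real.sqrt_one, ← Real.sqrt_div' _ (by positivity), hb]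
  congr 1
  field_simp

theorem integral_sq_mul_exp_neg_mul_sq {b : ℝ} (hb : 0 < b) :
    Integrable (fun z : ℝ ↦ z ^ 2 * Real.exp (-b * z ^ 2)) ∧
      ∫ z : ℝ, z ^ 2 * Real.exp (-b * z ^ 2) = √Real.pi / 2 * b ^ (-(3 / 2) : ℝ) := by
  have hi : Integrable (fun z : ℝ ↦ z ^ 2 * Real.exp (-b * z ^ 2)) := by
    have := integrable_rpow_mul_exp_neg_mul_sq hb (s := 2) (by norm_num)
    simpa only [Real.rpow_two] using this
  refine ⟨hi, ?_⟩
  have h1 : ∫ z : ℝ, z ^ 2 * Real.exp (-b * z ^ 2) =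
      2 * ∫ z in Ioi (0 : ℝ), z ^ 2 * Real.exp (-b * z ^ 2) := by
    have := integral_comp_abs (f := fun z : ℝ ↦ z ^ 2 * Real.exp (-b * z ^ 2))
    simpa only [sq_abs] using this
  have h2 := integral_rpow_mul_exp_neg_mul_rpow (p := 2) (q := 2) (b := b) (by norm_num)
    (by norm_num) hb
  simp only [Real.rpow_two] at h2
  have hG : Real.Gamma ((2 + 1) / 2) = √Real.pi / 2 := by
    rw [show ((2 : ℝ) + 1) / 2 = 1 / 2 + 1 by norm_num, Real.Gamma_add_one (by norm_num),
      Real.Gamma_one_half_eq]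
    ring
  rw [h1, h2, hG, show -((2 : ℝ) + 1) / 2 = -(3 / 2) by norm_num]
  ring

/-- At a common base point the product of two space derivatives of the heat kernel is
nonnegative. -/
theorem dgauss_mul_dgauss_nonneg (τ τ' z : ℝ) : 0 ≤ dgauss τ z * dgauss τ' z := by
  rcases lt_or_ge 0 τ with hτ | hτ
  · rcases lt_or_ge 0 τ' with hτ' | hτ'
    · have e : dgauss τ z * dgauss τ' z = z ^ 2 / (4 * τ * τ') * (gauss τ z * gauss τ' z) := by
        simp only [dgauss]
        field_simp
        ring
      rw [e]
      exact mul_nonneg (by positivity) (mul_nonneg (gauss_nonneg _ _) (gauss_nonneg _ _))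
    · rw [dgauss_of_nonpos hτ', mul_zero]
  · rw [dgauss_of_nonpos hτ, zero_mul]

/-- Chapman–Kolmogorov for the space derivatives at a common base point. -/
theorem integral_dgauss_mul_dgauss {τ τ' : ℝ} (hτ : 0 < τ) (hτ' : 0 < τ') :
    Integrable (fun z ↦ dgauss τ z * dgauss τ' z) ∧
      ∫ z, dgauss τ z * dgauss τ' z = 1 / (2 * √(4 * Real.pi)) * (τ + τ') ^ (-(3 / 2) : ℝ) := by
  have hpi := Real.pi_pos
  set b : ℝ := (τ + τ') / (4 * τ * τ') with hb
  have hb0 : 0 < b := by positivity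
  set A : ℝ := 1 / (2 * τ) * (1 / (2 * τ')) * (1 / √(4 * Real.pi * τ) * (1 / √(4 * Real.pi * τ')))
    with hA
  have e : (fun z ↦ dgauss τ z * dgauss τ' z) = fun z ↦ A * (z ^ 2 * Real.exp (-b * z ^ 2)) := by
    funext z
    have : Real.exp (-b * z ^ 2) = Real.exp (-z ^ 2 / (4 * τ)) * Real.exp (-z ^ 2 / (4 * τ')) := by
      rw [← Real.exp_add]
      congr 1
      rw [hb]
      field_simp
      ring
    rw [dgauss, dgauss, gauss_of_pos hτ, gauss_of_pos hτ', hA, this]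
    ring
  obtain ⟨hi, hv⟩ := integral_sq_mul_exp_neg_mul_sq hb0
  rw [e]
  refine ⟨hi.const_mul A, ?_⟩
  rw [integral_const_mul, hv, hA, hb, Real.div_rpow (by positivity) (by positivity)]
  have h3 : ∀ u : ℝ, 0 < u → u ^ (-(3 / 2) : ℝ) = 1 / (u * √u) := by
    intro u hu
    rw [Real.rpow_neg hu.le, show (3 / 2 : ℝ) = 1 + 1 / 2 by norm_num, Real.rpow_add hu,
      Real.rpow_one, ← Real.sqrt_eq_rpow, one_div]
  rw [h3 _ (by positivity), h3 _ (by positivity : 0 < 4 * τ * τ')]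
  have q1 : √(4 * Real.pi * τ) = 2 * √Real.pi * √τ := by
    rw [Real.sqrt_mul (by positivity), Real.sqrt_mul (by norm_num),
      show (4 : ℝ) = 2 ^ 2 by norm_num, Real.sqrt_sq (by norm_num)]
  have q2 : √(4 * Real.pi * τ') = 2 * √Real.pi * √τ' := by
    rw [Real.sqrt_mul (by positivity), Real.sqrt_mul (by norm_num),
      show (4 : ℝ) = 2 ^ 2 by norm_num, Real.sqrt_sq (by norm_num)]
  have q3 : √(4 * τ * τ') = 2 * √τ * √τ' := by
    rw [Real.sqrt_mul (by positivity), Real.sqrt_mul (by norm_num),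
      show (4 : ℝ) = 2 ^ 2 by norm_num, Real.sqrt_sq (by norm_num)]
  have q4 : √(4 * Real.pi) = 2 * √Real.pi := by
    rw [Real.sqrt_mul (by norm_num), show (4 : ℝ) = 2 ^ 2 by norm_num, Real.sqrt_sq (by norm_num)]
  rw [q1, q2, q3, q4]
  have s1 := Real.sqrt_pos.mpr hτ
  have s2 := Real.sqrt_pos.mpr hτ'
  have s3 := Real.sqrt_pos.mpr hpi
  have s4 := Real.sqrt_pos.mpr (add_pos hτ hτ')
  field_simp
  norm_num

/-- A bound for the space derivative that is integrable in time near `τ = 0` for each `z ≠ 0`, and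
integrable in `z` near `0` for each `τ`. -/
theorem abs_dgauss_le {τ : ℝ} (hτ : 0 < τ) {z : ℝ} (hz : z ≠ 0) :
    |dgauss τ z| ≤ 2 * τ ^ (-(3 / 4) : ℝ) * |z| ^ (-(1 / 2) : ℝ) := by
  have hz' : 0 < |z| := abs_pos.mpr hz
  have hpi := Real.pi_gt_three
  have hsq : 1 / √(4 * Real.pi * τ) ≤ τ ^ (-(1 / 2) : ℝ) := by
    rw [Real.rpow_neg hτ.le, ← Real.sqrt_eq_rpow, one_div]
    exact inv_anti₀ (Real.sqrt_pos.mpr hτ) (Real.sqrt_le_sqrt (by nlinarith))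
  set v : ℝ := z ^ 2 / (4 * τ) with hv
  have hv0 : 0 < v := by positivity
  have hexp : Real.exp (-v) ≤ v ^ (-(3 / 4) : ℝ) := by
    rw [Real.rpow_def_of_pos hv0]
    refine Real.exp_le_exp.mpr ?_
    have := Real.log_le_sub_one_of_pos hv0
    nlinarith
  have e1 : |dgauss τ z| = |z| / (2 * τ) * (1 / √(4 * Real.pi * τ)) * Real.exp (-v) := by
    rw [dgauss, gauss_of_pos hτ, abs_mul, abs_neg, abs_div, abs_of_pos (by positivity : 0 < 2 * τ),
      abs_of_nonneg (by positivity : 0 ≤ 1 / √(4 * Real.pi * τ) * Real.exp (-z ^ 2 / (4 * τ))),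
      hv, neg_div]
    ring
  have e2 : v ^ (-(3 / 4) : ℝ) = (4 : ℝ) ^ (3 / 4 : ℝ) * τ ^ (3 / 4 : ℝ) * |z| ^ (-(3 / 2) : ℝ) := by
    rw [hv, ← sq_abs, Real.div_rpow (by positivity) (by positivity), ← Real.rpow_natCast,
      ← Real.rpow_mul hz'.le, Real.rpow_neg (by positivity : 0 ≤ 4 * τ),
      Real.mul_rpow (by norm_num) hτ.le, div_inv_eq_mul]
    norm_num
    ring
  have e3 : (4 : ℝ) ^ (3 / 4 : ℝ) ≤ 4 := by
    conv_rhs => rw [← Real.rpow_one 4]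
    exact Real.rpow_le_rpow_of_exponent_le (by norm_num) (by norm_num)
  rw [e1]
  calc |z| / (2 * τ) * (1 / √(4 * Real.pi * τ)) * Real.exp (-v)
      ≤ |z| / (2 * τ) * τ ^ (-(1 / 2) : ℝ) * (4 * τ ^ (3 / 4 : ℝ) * |z| ^ (-(3 / 2) : ℝ)) := by
        gcongr
        refine hexp.trans ?_
        rw [e2]
        gcongr
    _ = 2 * (τ ^ (-1 : ℝ) * τ ^ (-(1 / 2) : ℝ) * τ ^ (3 / 4 : ℝ)) *
        (|z| ^ (1 : ℝ) * |z| ^ (-(3 / 2) : ℝ)) := by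
        rw [Real.rpow_one, Real.rpow_neg_one]
        field_simp
        ring
    _ = 2 * τ ^ (-(3 / 4) : ℝ) * |z| ^ (-(1 / 2) : ℝ) := by
        rw [← Real.rpow_add hτ, ← Real.rpow_add hτ, ← Real.rpow_add hz']
        norm_num

/-! ### The heat kernel in `L²` of the half plane -/

theorem halfPlane_eq_prod :
    halfPlane = (volume : Measure ℝ).prod (volume.restrict (Ioi (0 : ℝ))) := by
  rw [halfPlane, Measure.volume_eq_prod, ← Measure.prod_restrict, Measure.restrict_univ]

theorem integral_sub_two_mul_rpow {d m r : ℝ} (hr : -1 < r) :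
    IntervalIntegrable (fun s : ℝ ↦ (d - 2 * s) ^ r) volume 0 m ∧
      ∫ s in (0 : ℝ)..m, (d - 2 * s) ^ r = (d ^ (r + 1) - (d - 2 * m) ^ (r + 1)) / (2 * (r + 1)) := by
  constructor
  · have h := intervalIntegral.intervalIntegrable_rpow' hr (a := d) (b := d - 2 * m)
    have h2 := (h.comp_sub_left d).comp_mul_left (c := 2)
    simpa [sub_sub_cancel] using h2
  · rw [intervalIntegral.integral_comp_sub_mul (fun u : ℝ ↦ u ^ r) two_ne_zero,
      integral_rpow (Or.inl hr), mul_zero, sub_zero, smul_eq_mul]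
    field_simp

theorem add_sub_two_mul_min (t t' : ℝ) : t + t' - 2 * min t t' = |t - t'| := by
  rcases le_total t t' with h | h
  · rw [min_eq_left h, abs_of_nonpos (by linarith)]
    ring
  · rw [min_eq_right h, abs_of_nonneg (by linarith)]
    ring

/-- `(y, s) ↦ g(y, s; x, t)`. -/
def pointKernel (x t : ℝ) (p : ℝ × ℝ) : ℝ := gauss (t - p.2) (x - p.1)

theorem measurable_pointKernel : Measurable fun q : (ℝ × ℝ) × (ℝ × ℝ) ↦
    pointKernel q.1.1 q.1.2 q.2 :=
  measurable_gauss.comp (by fun_prop : Measurable fun q : (ℝ × ℝ) × (ℝ × ℝ) ↦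
    (q.1.2 - q.2.2, q.1.1 - q.2.1))

theorem measurable_pointKernel_right (x t : ℝ) : Measurable (pointKernel x t) :=
  measurable_pointKernel.comp (by fun_prop : Measurable fun p : ℝ × ℝ ↦ ((x, t), p))

theorem pointKernel_nonneg (x t : ℝ) (p : ℝ × ℝ) : 0 ≤ pointKernel x t p := gauss_nonneg _ _

theorem integral_pointKernel_space (x x' t t' s : ℝ) :
    Integrable (fun y ↦ pointKernel x t (y, s) * pointKernel x' t' (y, s)) ∧
      ∫ y, pointKernel x t (y, s) * pointKernel x' t' (y, s) =
        (Iio (min t t')).indicator (fun s ↦ gauss (t + t' - 2 * s) (x - x')) s := by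
  simp only [pointKernel]
  by_cases hs : s < min t t'
  · rw [indicator_of_mem (show s ∈ Iio (min t t') from hs)]
    rw [lt_min_iff] at hs
    have := integral_gauss_mul_gauss (sub_pos.mpr hs.1) (sub_pos.mpr hs.2) x x'
    rwa [show t - s + (t' - s) = t + t' - 2 * s by ring] at this
  · rw [indicator_of_notMem (show s ∉ Iio (min t t') from hs)]
    have h0 : ∀ y, gauss (t - s) (x - y) * gauss (t' - s) (x' - y) = 0 := by
      intro y
      rcases min_le_iff.mp (not_lt.mp hs) with h | h
      · rw [gauss_of_nonpos (sub_nonpos.mpr h), zero_mul]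
      · rw [gauss_of_nonpos (sub_nonpos.mpr h), mul_zero]
    simp [h0]

theorem integrableOn_gauss_time {t t' : ℝ} (z : ℝ) :
    IntegrableOn (fun s ↦ gauss (t + t' - 2 * s) z) (Ioo 0 (min t t')) := by
  rcases le_or_gt (min t t') 0 with hm | hm
  · simp [Ioo_eq_empty_of_le hm]
  have h1 := (integral_sub_two_mul_rpow (d := t + t') (m := min t t') (r := -(1 / 2))
    (by norm_num)).1
  rw [intervalIntegrable_iff_integrableOn_Ioo_of_le hm.le] at h1
  refine (h1.const_mul (1 / √(4 * Real.pi))).mono' ?_ ?_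
  · exact (measurable_gauss.comp (by fun_prop : Measurable fun s : ℝ ↦
      (t + t' - 2 * s, z))).aestronglyMeasurable
  · refine (ae_restrict_iff' measurableSet_Ioo).mpr (ae_of_all _ fun s hs ↦ ?_)
    have h2 := add_sub_two_mul_min t t'
    have h3 := abs_nonneg (t - t')
    rw [Real.norm_of_nonneg (gauss_nonneg _ _), ← gauss_zero (by linarith [hs.2])]
    exact gauss_le_gauss_zero _ _

/-- The integral over the half plane: Chapman–Kolmogorov in space at each time `s` before `t` and
`t'`. -/
theorem integral_pointKernel (x x' t t' : ℝ) :
    Integrable (fun p ↦ pointKernel x t p * pointKernel x' t' p) halfPlane ∧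
      ∫ p, pointKernel x t p * pointKernel x' t' p ∂halfPlane =
        ∫ s in Ioo 0 (min t t'), gauss (t + t' - 2 * s) (x - x') := by
  have hset : Ioi 0 ∩ Iio (min t t') = Ioo 0 (min t t') := rfl
  have hm : AEStronglyMeasurable (fun p ↦ pointKernel x t p * pointKernel x' t' p)
      ((volume : Measure ℝ).prod (volume.restrict (Ioi (0 : ℝ)))) :=
    ((measurable_pointKernel_right x t).mul
      (measurable_pointKernel_right x' t')).aestronglyMeasurable
  have hi : Integrable (fun p ↦ pointKernel x t p * pointKernel x' t' p)
      ((volume : Measure ℝ).prod (volume.restrict (Ioi (0 : ℝ)))) := by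
    refine (integrable_prod_iff' hm).mpr
      ⟨ae_of_all _ fun s ↦ (integral_pointKernel_space x x' t t' s).1, ?_⟩
    have e : ∀ s, ∫ y, ‖pointKernel x t (y, s) * pointKernel x' t' (y, s)‖ =
        (Iio (min t t')).indicator (fun s ↦ gauss (t + t' - 2 * s) (x - x')) s := by
      intro s
      rw [← (integral_pointKernel_space x x' t t' s).2]
      exact integral_congr_ae (ae_of_all _ fun y ↦ Real.norm_of_nonneg
        (mul_nonneg (pointKernel_nonneg _ _ _) (pointKernel_nonneg _ _ _)))
    simp only [e]
    rw [integrable_indicator_iff measurableSet_Iio, IntegrableOn,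
      Measure.restrict_restrict measurableSet_Iio, inter_comm, hset]
    exact integrableOn_gauss_time _
  rw [halfPlane_eq_prod]
  refine ⟨hi, ?_⟩
  rw [integral_prod_symm _ hi]
  simp only [(integral_pointKernel_space x x' t t' _).2]
  rw [setIntegral_indicator measurableSet_Iio, hset]

theorem memLp_pointKernel (x t : ℝ) : MemLp (pointKernel x t) 2 halfPlane := by
  refine (memLp_two_iff_integrable_sq (measurable_pointKernel_right x t).aestronglyMeasurable).mpr ?_
  simpa only [pow_two] using (integral_pointKernel x x t t).1

/-- The heat kernel `g(·; x, t)` as an element of `L²` of the half plane. -/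
def heatVec (x t : ℝ) : Lp ℝ 2 halfPlane := (memLp_pointKernel x t).toLp _

theorem inner_toLp {X : Type*} [MeasurableSpace X] {μ : Measure X} {f g : X → ℝ}
    (hf : MemLp f 2 μ) (hg : MemLp g 2 μ) :
    inner ℝ (hf.toLp f) (hg.toLp g) = ∫ p, f p * g p ∂μ := by
  rw [L2.inner_def]
  refine integral_congr_ae ?_
  filter_upwards [hf.coeFn_toLp, hg.coeFn_toLp] with p h1 h2
  rw [h1, h2]
  exact mul_comm _ _

theorem inner_heatVec (x x' t t' : ℝ) : inner ℝ (heatVec x t) (heatVec x' t') =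
    ∫ s in Ioo 0 (min t t'), gauss (t + t' - 2 * s) (x - x') := by
  rw [heatVec, heatVec, inner_toLp, (integral_pointKernel x x' t t').2]

/-- The covariance of the mild solution at one point of space. -/
theorem inner_heatVec_self {t t' : ℝ} (ht : 0 ≤ t) (ht' : 0 ≤ t') (x : ℝ) :
    inner ℝ (heatVec x t) (heatVec x t') = (√(t + t') - √|t - t'|) / √(4 * Real.pi) := by
  have h2 := add_sub_two_mul_min t t'
  rw [inner_heatVec, sub_self]
  have e : ∫ s in Ioo 0 (min t t'), gauss (t + t' - 2 * s) 0 =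
      ∫ s in Ioo 0 (min t t'), 1 / √(4 * Real.pi) * (t + t' - 2 * s) ^ (-(1 / 2) : ℝ) := by
    refine setIntegral_congr_fun measurableSet_Ioo fun s hs ↦ gauss_zero ?_
    have h3 := abs_nonneg (t - t')
    linarith [hs.2]
  rw [e, integral_const_mul, ← integral_Ioc_eq_integral_Ioo,
    ← intervalIntegral.integral_of_le (le_min ht ht'),
    (integral_sub_two_mul_rpow (by norm_num)).2, h2]
  norm_num
  rw [← Real.sqrt_eq_rpow, ← Real.sqrt_eq_rpow]
  ring

theorem norm_heatVec_sq_le {t : ℝ} (ht : 0 ≤ t) (x : ℝ) : ‖heatVec x t‖ ^ 2 ≤ √t := by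
  have hpi := Real.pi_gt_three
  rw [← real_inner_self_eq_norm_sq, inner_heatVec_self ht ht, sub_self, abs_zero, Real.sqrt_zero,
    sub_zero, ← Real.sqrt_div' _ (by positivity)]
  refine Real.sqrt_le_sqrt ?_
  rw [div_le_iff₀ (by positivity)]
  nlinarith

/-- Hölder continuity in time. By concavity of the square root, the contributions of `t + t`, `t' +
t'` and `t + t'` have a nonpositive sum. -/
theorem norm_heatVec_sub_time_sq_le {t t' : ℝ} (ht : 0 ≤ t) (ht' : 0 ≤ t') (x : ℝ) :
    ‖heatVec x t - heatVec x t'‖ ^ 2 ≤ √|t - t'| := by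
  have hpi := Real.pi_gt_three
  have h4 : 2 ≤ √(4 * Real.pi) := by
    rw [show (2 : ℝ) = √(2 ^ 2) from (Real.sqrt_sq (by norm_num)).symm]
    exact Real.sqrt_le_sqrt (by nlinarith)
  have hconc : √(t + t) + √(t' + t') ≤ 2 * √(t + t') := by
    have q1 := Real.sq_sqrt (by positivity : 0 ≤ t + t)
    have q2 := Real.sq_sqrt (by positivity : 0 ≤ t' + t')
    have q3 := Real.sq_sqrt (by positivity : 0 ≤ t + t')
    refine abs_le_of_sq_le_sq' ?_ (by positivity) |>.2
    nlinarith [sq_nonneg (√(t + t) - √(t' + t'))]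
  rw [norm_sub_sq_real, ← real_inner_self_eq_norm_sq, ← real_inner_self_eq_norm_sq,
    inner_heatVec_self ht ht, inner_heatVec_self ht' ht', inner_heatVec_self ht ht']
  simp only [sub_self, abs_zero, Real.sqrt_zero, sub_zero]
  have e : √(t + t) / √(4 * Real.pi) - 2 * ((√(t + t') - √|t - t'|) / √(4 * Real.pi)) +
      √(t' + t') / √(4 * Real.pi) =
      (√(t + t) + √(t' + t') - 2 * √(t + t') + 2 * √|t - t'|) / √(4 * Real.pi) := by ring
  rw [e, div_le_iff₀ (by positivity)]
  nlinarith [Real.sqrt_nonneg |t - t'|]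

/-- Trading regularity in `z` for a singularity in `τ` that is still integrable, by `1 - e^{-v} ≤
v^{1/4}`. -/
theorem gauss_zero_sub_gauss_le {τ : ℝ} (hτ : 0 < τ) (z : ℝ) :
    gauss τ 0 - gauss τ z ≤ |z| ^ (1 / 2 : ℝ) * τ ^ (-(3 / 4) : ℝ) := by
  have hpi := Real.pi_gt_three
  set v : ℝ := z ^ 2 / (4 * τ) with hv
  have hv0 : 0 ≤ v := by positivity
  have h1 : 1 - Real.exp (-v) ≤ v ^ (1 / 4 : ℝ) := by
    rcases le_or_gt 1 v with h | h
    · have h5 := Real.one_le_rpow h (by norm_num : (0 : ℝ) ≤ 1 / 4)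
      have h6 := Real.exp_pos (-v)
      linarith
    · have h5 := Real.add_one_le_exp (-v)
      have h6 := Real.rpow_le_rpow_of_exponent_ge' hv0 h.le (by norm_num : (0 : ℝ) ≤ 1 / 4)
        (by norm_num : (1 / 4 : ℝ) ≤ 1)
      rw [Real.rpow_one] at h6
      linarith
  have h2 : v ^ (1 / 4 : ℝ) ≤ |z| ^ (1 / 2 : ℝ) * τ ^ (-(1 / 4) : ℝ) := by
    have : v ≤ |z| ^ 2 * τ ^ (-1 : ℝ) := by
      rw [hv, sq_abs, Real.rpow_neg_one, ← div_eq_mul_inv]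
      exact div_le_div_of_nonneg_left (sq_nonneg z) hτ (by linarith)
    refine (Real.rpow_le_rpow hv0 this (by norm_num)).trans_eq ?_
    rw [Real.mul_rpow (by positivity) (by positivity), ← Real.rpow_natCast,
      ← Real.rpow_mul (abs_nonneg z), ← Real.rpow_mul hτ.le]
    norm_num
  have h3 : 1 / √(4 * Real.pi * τ) ≤ τ ^ (-(1 / 2) : ℝ) := by
    rw [Real.rpow_neg hτ.le, ← Real.sqrt_eq_rpow, one_div]
    exact inv_anti₀ (Real.sqrt_pos.mpr hτ) (Real.sqrt_le_sqrt (by nlinarith))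
  have e : gauss τ 0 - gauss τ z = 1 / √(4 * Real.pi * τ) * (1 - Real.exp (-v)) := by
    rw [gauss_of_pos hτ, gauss_of_pos hτ, hv, neg_div]
    simp
    ring_nf
  rw [e]
  calc 1 / √(4 * Real.pi * τ) * (1 - Real.exp (-v))
      ≤ τ ^ (-(1 / 2) : ℝ) * (|z| ^ (1 / 2 : ℝ) * τ ^ (-(1 / 4) : ℝ)) := by
        refine mul_le_mul h3 (h1.trans h2) ?_ (by positivity)
        rw [sub_nonneg, Real.exp_le_one_iff]
        linarith
    _ = |z| ^ (1 / 2 : ℝ) * (τ ^ (-(1 / 2) : ℝ) * τ ^ (-(1 / 4) : ℝ)) := by ring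
    _ = |z| ^ (1 / 2 : ℝ) * τ ^ (-(3 / 4) : ℝ) := by
        rw [← Real.rpow_add hτ]
        norm_num

/-- Hölder continuity in space. -/
theorem norm_heatVec_sub_space_sq_le {t : ℝ} (ht : 0 ≤ t) (x y : ℝ) :
    ‖heatVec x t - heatVec y t‖ ^ 2 ≤ 8 * t ^ (1 / 4 : ℝ) * |x - y| ^ (1 / 2 : ℝ) := by
  have hself : ∀ w : ℝ, inner ℝ (heatVec w t) (heatVec w t) =
      ∫ s in Ioo 0 (min t t), gauss (t + t - 2 * s) 0 := fun w ↦ by rw [inner_heatVec, sub_self]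
  rw [norm_sub_sq_real, ← real_inner_self_eq_norm_sq, ← real_inner_self_eq_norm_sq, hself, hself,
    inner_heatVec, min_self]
  have hi0 := integrableOn_gauss_time (t := t) (t' := t) 0
  have hiz := integrableOn_gauss_time (t := t) (t' := t) (x - y)
  rw [min_self] at hi0 hiz
  have h1 : ∫ s in Ioo 0 t, (gauss (t + t - 2 * s) 0 - gauss (t + t - 2 * s) (x - y)) ≤
      ∫ s in Ioo 0 t, |x - y| ^ (1 / 2 : ℝ) * (t + t - 2 * s) ^ (-(3 / 4) : ℝ) := by
    have h2 := (integral_sub_two_mul_rpow (d := t + t) (m := t) (r := -(3 / 4)) (by norm_num)).1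
    rw [intervalIntegrable_iff_integrableOn_Ioo_of_le ht] at h2
    refine setIntegral_mono_on (hi0.sub hiz) (h2.const_mul _) measurableSet_Ioo fun s hs ↦ ?_
    exact gauss_zero_sub_gauss_le (by linarith [hs.2]) _
  rw [integral_sub hi0 hiz, integral_const_mul, ← integral_Ioc_eq_integral_Ioo (f := fun s ↦
    (t + t - 2 * s) ^ (-(3 / 4) : ℝ)), ← intervalIntegral.integral_of_le ht,
    (integral_sub_two_mul_rpow (by norm_num)).2] at h1
  have h3 : t + t - 2 * t = 0 := by ring
  have h5 : (t + t) ^ (1 / 4 : ℝ) ≤ 2 * t ^ (1 / 4 : ℝ) := by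
    rw [← two_mul, Real.mul_rpow (by norm_num) ht]
    have : (2 : ℝ) ^ (1 / 4 : ℝ) ≤ 2 := by
      conv_rhs => rw [← Real.rpow_one 2]
      exact Real.rpow_le_rpow_of_exponent_le (by norm_num) (by norm_num)
    gcongr
  rw [h3, show (-(3 / 4) + 1 : ℝ) = 1 / 4 by norm_num, Real.zero_rpow (by norm_num), sub_zero] at h1
  have h6 : 0 ≤ |x - y| ^ (1 / 2 : ℝ) := by positivity
  have h7 : |x - y| ^ (1 / 2 : ℝ) * ((t + t) ^ (1 / 4 : ℝ) / (2 * (1 / 4))) ≤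
      4 * t ^ (1 / 4 : ℝ) * |x - y| ^ (1 / 2 : ℝ) := by
    calc |x - y| ^ (1 / 2 : ℝ) * ((t + t) ^ (1 / 4 : ℝ) / (2 * (1 / 4)))
        = 2 * (|x - y| ^ (1 / 2 : ℝ) * (t + t) ^ (1 / 4 : ℝ)) := by
          generalize (t + t) ^ (1 / 4 : ℝ) = u
          ring
      _ ≤ 2 * (|x - y| ^ (1 / 2 : ℝ) * (2 * t ^ (1 / 4 : ℝ))) := by gcongr
      _ = 4 * t ^ (1 / 4 : ℝ) * |x - y| ^ (1 / 2 : ℝ) := by ring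
  linarith

/-! ### The smeared heat kernel -/

/-- The properties of test functions that matter for smearing the heat kernel in time; they are
shared by the derivatives of test functions. -/
structure IsTest (h : ℝ → ℝ) : Prop where
  continuous : Continuous h
  hasCompactSupport : HasCompactSupport h

theorem TestSpace.isTest (h : TestSpace) : IsTest h :=
  ⟨h.continuous, h.hasCompactSupport⟩

theorem TestSpace.isTest_deriv (h : TestSpace) : IsTest (deriv h) :=
  ⟨h.contDiff.continuous_deriv (by simp), h.hasCompactSupport.deriv⟩

theorem heatVec_of_nonpos {t : ℝ} (ht : t ≤ 0) (x : ℝ) : heatVec x t = 0 := by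
  rw [← norm_eq_zero, ← sq_eq_zero_iff, ← real_inner_self_eq_norm_sq, inner_heatVec, min_self,
    Ioo_eq_empty_of_le ht]
  simp

theorem heatVec_max (x t : ℝ) : heatVec x (max t 0) = heatVec x t := by
  rcases le_total t 0 with h | h
  · rw [max_eq_right h, heatVec_of_nonpos h, heatVec_of_nonpos le_rfl]
  · rw [max_eq_left h]

theorem continuous_heatVec (x : ℝ) : Continuous (heatVec x) := by
  refine continuous_iff_continuousAt.mpr fun t ↦ tendsto_iff_norm_sub_tendsto_zero.mpr ?_
  have hc : Continuous fun t' ↦ √√|max t' 0 - max t 0| := by fun_prop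
  refine squeeze_zero (fun _ ↦ norm_nonneg _) (fun t' ↦ ?_) (hc.tendsto' t 0 (by simp))
  rw [← heatVec_max x t', ← heatVec_max x t]
  exact Real.le_sqrt_of_sq_le (norm_heatVec_sub_time_sq_le (le_max_right _ _) (le_max_right _ _) x)

theorem IsTest.integrable_smul_heatVec {h : ℝ → ℝ} (hh : IsTest h) (x : ℝ) :
    Integrable fun t ↦ h t • heatVec x t :=
  (hh.continuous.smul (continuous_heatVec x)).integrable_of_hasCompactSupport
    hh.hasCompactSupport.smul_right

/-- The function `(y, s) ↦ ∫ g(y, s; x, t) h(t) dt` as a Bochner integral in `L²`. -/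
def uVec (x : ℝ) (h : ℝ → ℝ) : Lp ℝ 2 halfPlane := ∫ t in Ioi 0, h t • heatVec x t

theorem kernelU_eq (x : ℝ) (h : ℝ → ℝ) (p : ℝ × ℝ) :
    kernelU x h p = ∫ t in Ioi 0, pointKernel x t p * h t := by
  simp only [kernelU, heatKernel_eq, pointKernel]

/-- The pointwise time integral is almost everywhere the Bochner integral in `L²`. -/
theorem IsTest.kernelU_ae {h : ℝ → ℝ} (hh : IsTest h) (x : ℝ) :
    kernelU x h =ᵐ[halfPlane] uVec x h := by
  have hm : Measurable fun q : ℝ × (ℝ × ℝ) ↦ pointKernel x q.1 q.2 * h q.1 :=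
    (measurable_pointKernel.comp (by fun_prop : Measurable fun q : ℝ × (ℝ × ℝ) ↦
      ((x, q.1), q.2))).mul (hh.continuous.measurable.comp measurable_fst)
  have := ae_integral_eq_of_version (ν := volume.restrict (Ioi (0 : ℝ)))
    (hh.integrable_smul_heatVec x).integrableOn
    (A := fun t p ↦ pointKernel x t p * h t) hm.aestronglyMeasurable
    (ae_of_all _ fun t ↦ by
      filter_upwards [(memLp_pointKernel x t).coeFn_toLp, Lp.coeFn_smul (h t) (heatVec x t)]
        with p h1 h2
      rw [h2, Pi.smul_apply, smul_eq_mul, heatVec, h1, mul_comm])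
  filter_upwards [this] with p hp
  rw [kernelU_eq, hp.2, uVec]

theorem IsTest.memLp_kernelU {h : ℝ → ℝ} (hh : IsTest h) (x : ℝ) :
    MemLp (kernelU x h) 2 halfPlane :=
  (Lp.memLp (uVec x h)).ae_eq (hh.kernelU_ae x).symm

theorem IsTest.uVec_eq {h : ℝ → ℝ} (hh : IsTest h) (x : ℝ) :
    (hh.memLp_kernelU x).toLp _ = uVec x h :=
  Lp.ext ((hh.memLp_kernelU x).coeFn_toLp.trans (hh.kernelU_ae x))

theorem IsTest.inner_uVec_left {h : ℝ → ℝ} (hh : IsTest h) (x : ℝ) (f : Lp ℝ 2 halfPlane) :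
    inner ℝ f (uVec x h) = ∫ t in Ioi 0, h t * inner ℝ f (heatVec x t) := by
  rw [uVec, ← integral_inner (hh.integrable_smul_heatVec x).integrableOn]
  simp only [inner_smul_right]

theorem IsTest.inner_uVec {h k : ℝ → ℝ} (hh : IsTest h) (hk : IsTest k) (x : ℝ) :
    inner ℝ (uVec x h) (uVec x k) =
      ∫ t in Ioi 0, h t * ∫ t' in Ioi 0, k t' * ((√(t + t') - √|t - t'|) / √(4 * Real.pi)) := by
  rw [real_inner_comm, hh.inner_uVec_left]
  refine setIntegral_congr_fun measurableSet_Ioi fun t ht ↦ ?_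
  rw [real_inner_comm, hk.inner_uVec_left]
  congr 1
  refine setIntegral_congr_fun measurableSet_Ioi fun t' ht' ↦ ?_
  rw [inner_heatVec_self (le_of_lt ht) (le_of_lt ht')]

theorem IsTest.norm_uVec_sub_le {h : ℝ → ℝ} (hh : IsTest h) :
    ∃ C, 0 ≤ C ∧ ∀ x y, ‖uVec x h - uVec y h‖ ≤ C * |x - y| ^ (1 / 4 : ℝ) := by
  refine ⟨∫ t in Ioi 0, |h t| * √(8 * t ^ (1 / 4 : ℝ)),
    integral_nonneg fun t ↦ by positivity, fun x y ↦ ?_⟩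
  have hx := (hh.integrable_smul_heatVec x).integrableOn (s := Ioi 0)
  have hy := (hh.integrable_smul_heatVec y).integrableOn (s := Ioi 0)
  have hc : Continuous fun t : ℝ ↦ |h t| * √(8 * t ^ (1 / 4 : ℝ)) :=
    hh.continuous.abs.mul (Real.continuous_sqrt.comp (continuous_const.mul
      (Real.continuous_rpow_const (by norm_num))))
  have hi : Integrable fun t : ℝ ↦ |h t| * √(8 * t ^ (1 / 4 : ℝ)) :=
    hc.integrable_of_hasCompactSupport (hh.hasCompactSupport.norm.mul_right)
  rw [uVec, uVec, ← integral_sub hx hy, ← integral_mul_const]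
  refine norm_integral_le_of_norm_le (hi.integrableOn.mul_const _)
    ((ae_restrict_iff' measurableSet_Ioi).mpr (ae_of_all _ fun t ht ↦ ?_))
  rw [← smul_sub, norm_smul, Real.norm_eq_abs, mul_assoc]
  refine mul_le_mul_of_nonneg_left ?_ (abs_nonneg _)
  have h1 := Real.le_sqrt_of_sq_le (norm_heatVec_sub_space_sq_le (le_of_lt ht) x y)
  refine h1.trans_eq ?_
  rw [Real.sqrt_mul (by have : (0 : ℝ) < t := ht; positivity), Real.sqrt_eq_rpow (|x - y| ^ _),
    ← Real.rpow_mul (abs_nonneg _)]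
  norm_num

theorem uniformContinuous_of_norm_sub_le {E : Type*} [SeminormedAddCommGroup E] {f : ℝ → E}
    {ω : ℝ → ℝ} (hω : Continuous ω) (h0 : ω 0 = 0) (hf : ∀ x y, ‖f x - f y‖ ≤ ω |x - y|) :
    UniformContinuous f := by
  refine Metric.uniformContinuous_iff.mpr fun ε hε ↦ ?_
  obtain ⟨δ, hδ, h1⟩ := Metric.continuousAt_iff.mp hω.continuousAt ε hε
  refine ⟨δ, hδ, fun {x y} hxy ↦ ?_⟩
  have h2 := h1 (x := |x - y|) (by rwa [Real.dist_0_eq_abs, abs_abs, ← Real.dist_eq])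
  rw [h0, Real.dist_0_eq_abs] at h2
  rw [dist_eq_norm]
  exact ((hf x y).trans (le_abs_self _)).trans_lt h2

theorem IsTest.uniformContinuous_uVec {h : ℝ → ℝ} (hh : IsTest h) :
    UniformContinuous fun x ↦ uVec x h := by
  obtain ⟨C, -, hC⟩ := hh.norm_uVec_sub_le
  exact uniformContinuous_of_norm_sub_le (ω := fun r ↦ C * r ^ (1 / 4 : ℝ))
    (continuous_const.mul (Real.continuous_rpow_const (by norm_num)))
    (by norm_num) hC

/-! ### The smeared derivative of the heat kernel -/

/-- `(y, s) ↦ ∂₃g(y, s; x, t)`. -/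
def pointDKernel (x t : ℝ) (p : ℝ × ℝ) : ℝ := dgauss (t - p.2) (x - p.1)

theorem measurable_pointDKernel : Measurable fun q : (ℝ × ℝ) × (ℝ × ℝ) ↦
    pointDKernel q.1.1 q.1.2 q.2 :=
  measurable_dgauss.comp (by fun_prop : Measurable fun q : (ℝ × ℝ) × (ℝ × ℝ) ↦
    (q.1.2 - q.2.2, q.1.1 - q.2.1))

theorem kernelDU_eq (x : ℝ) (h : ℝ → ℝ) (p : ℝ × ℝ) :
    kernelDU x h p = ∫ t in Ioi 0, pointDKernel x t p * h t := by
  simp only [kernelDU, deriv_heatKernel, pointDKernel]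

/-- The covariance of two superpositions `∫ Φ(·, t) ν(dt)` in `L²`. -/
theorem integral_mul_integral_of_integrable {X T : Type*} [MeasurableSpace X] [MeasurableSpace T]
    {μ : Measure X} {ν : Measure T} [SigmaFinite μ] [SigmaFinite ν] {Φ Ψ : X → T → ℝ}
    (h : Integrable (fun q : X × (T × T) ↦ Φ q.1 q.2.1 * Ψ q.1 q.2.2) (μ.prod (ν.prod ν))) :
    Integrable (fun p ↦ (∫ t, Φ p t ∂ν) * ∫ t, Ψ p t ∂ν) μ ∧
      ∫ p, (∫ t, Φ p t ∂ν) * ∫ t, Ψ p t ∂ν ∂μ =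
        ∫ r : T × T, (∫ p, Φ p r.1 * Ψ p r.2 ∂μ) ∂ν.prod ν := by
  have e : ∀ p, (∫ t, Φ p t ∂ν) * ∫ t, Ψ p t ∂ν =
      ∫ r : T × T, Φ p r.1 * Ψ p r.2 ∂ν.prod ν := fun p ↦ (integral_prod_mul _ _).symm
  simp only [e]
  exact ⟨h.integral_prod_left, integral_integral_swap h⟩

theorem ae_prod_ne : ∀ᵐ r : ℝ × ℝ, r.1 ≠ r.2 := by
  rw [Measure.volume_eq_prod, Measure.ae_prod_iff_ae_ae]
  · refine ae_of_all _ fun t ↦ ?_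
    simp [ae_iff]
  · exact (measurableSet_eq_fun measurable_fst measurable_snd).compl

theorem locallyIntegrable_abs_rpow {a : ℝ} (ha : -1 < a) :
    LocallyIntegrable fun r : ℝ ↦ |r| ^ a := by
  refine locallyIntegrable_of_norm_le_rpow (α := -a) (C := 1) (by simp)
    (by simpa using neg_lt.mpr ha) (ae_of_all _ fun r ↦ ?_)
    (by measurability : Measurable fun r : ℝ ↦ |r| ^ a).aestronglyMeasurable
  rw [one_mul, Real.norm_of_nonneg (by positivity), Real.norm_eq_abs, neg_neg]

/-- The singularity `|t - t'|^{-1/2}` is integrable against test functions. -/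
theorem integrable_mul_abs_sub_rpow {h k : ℝ → ℝ} (hc : Continuous h) (hs : HasCompactSupport h)
    (kc : Continuous k) (ks : HasCompactSupport k) :
    Integrable fun r : ℝ × ℝ ↦ h r.1 * k r.2 * |r.1 - r.2| ^ (-(1 / 2) : ℝ) := by
  obtain ⟨R, hR⟩ := hs.isCompact.isBounded.subset_closedBall 0
  obtain ⟨S, hS⟩ := ks.isCompact.isBounded.subset_closedBall 0
  let κ : ℝ → ℝ := (Metric.closedBall 0 (R + S)).indicator fun r ↦ |r| ^ (-(1 / 2) : ℝ)
  have hκ : Integrable κ := by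
    rw [integrable_indicator_iff Metric.isClosed_closedBall.measurableSet]
    exact (locallyIntegrable_abs_rpow (by norm_num)).integrableOn_isCompact (isCompact_closedBall _ _)
  have h1 := (kc.integrable_of_hasCompactSupport ks (μ := volume)).convolution_integrand
    (ContinuousLinearMap.mul ℝ ℝ) hκ
  obtain ⟨M, hM⟩ := hc.bounded_above_of_compact_support hs
  have h2 := h1.bdd_mul (f := fun r : ℝ × ℝ ↦ h r.1) (c := M)
    (hc.comp continuous_fst).aestronglyMeasurable (ae_of_all _ fun r ↦ hM r.1)
  rw [Measure.volume_eq_prod]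
  refine h2.congr (ae_of_all _ fun r ↦ ?_)
  simp only [ContinuousLinearMap.mul_apply']
  rw [← mul_assoc]
  by_cases h3 : h r.1 = 0
  · simp [h3]
  by_cases h4 : k r.2 = 0
  · simp [h4]
  have h5 := hR (subset_tsupport _ (Function.mem_support.mpr h3))
  have h6 := hS (subset_tsupport _ (Function.mem_support.mpr h4))
  rw [mem_closedBall_zero_iff] at h5 h6
  rw [show κ (r.1 - r.2) = |r.1 - r.2| ^ (-(1 / 2) : ℝ) from indicator_of_mem
    (mem_closedBall_zero_iff.mpr ((norm_sub_le _ _).trans (add_le_add h5 h6))) _]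

theorem integral_sub_two_mul_rpow_neg {t t' : ℝ} (ht : 0 < t) (ht' : 0 < t') (hne : t ≠ t') :
    IntegrableOn (fun s : ℝ ↦ (t + t' - 2 * s) ^ (-(3 / 2) : ℝ)) (Ioo 0 (min t t')) ∧
      ∫ s in Ioo 0 (min t t'), (t + t' - 2 * s) ^ (-(3 / 2) : ℝ) =
        |t - t'| ^ (-(1 / 2) : ℝ) - (t + t') ^ (-(1 / 2) : ℝ) := by
  have hm := lt_min ht ht'
  have h2 := add_sub_two_mul_min t t'
  have h3 : 0 < |t - t'| := abs_pos.mpr (sub_ne_zero.mpr hne)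
  have hpos : ∀ s ∈ uIcc 0 (min t t'), 0 < t + t' - 2 * s := fun s hs ↦ by
    rw [uIcc_of_le hm.le] at hs
    linarith [hs.2]
  have hd : ∀ s ∈ uIcc 0 (min t t'), HasDerivAt (fun s : ℝ ↦ (t + t' - 2 * s) ^ (-(1 / 2) : ℝ))
      ((t + t' - 2 * s) ^ (-(3 / 2) : ℝ)) s := fun s hs ↦ by
    have h4 := (((hasDerivAt_id s).const_mul 2).const_sub (t + t')).rpow_const
      (p := -(1 / 2)) (Or.inl (hpos s hs).ne')
    simp only [id_eq] at h4
    convert h4 using 1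
    rw [show (-(1 / 2) - 1 : ℝ) = -(3 / 2) by norm_num]
    ring
  have hi : IntervalIntegrable (fun s : ℝ ↦ (t + t' - 2 * s) ^ (-(3 / 2) : ℝ)) volume 0
      (min t t') := by
    refine ContinuousOn.intervalIntegrable fun s hs ↦ ?_
    exact ((by fun_prop : Continuous fun s ↦ t + t' - 2 * s).continuousAt.rpow_const
      (Or.inl (hpos s hs).ne')).continuousWithinAt
  refine ⟨(intervalIntegrable_iff_integrableOn_Ioo_of_le hm.le).mp hi, ?_⟩
  rw [← integral_Ioc_eq_integral_Ioo, ← intervalIntegral.integral_of_le hm.le,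
    intervalIntegral.integral_eq_sub_of_hasDerivAt hd hi, h2, mul_zero, sub_zero]

theorem pointDKernel_mul_nonneg (x t t' : ℝ) (p : ℝ × ℝ) :
    0 ≤ pointDKernel x t p * pointDKernel x t' p := dgauss_mul_dgauss_nonneg _ _ _

theorem integral_pointDKernel_space (x t t' s : ℝ) :
    Integrable (fun y ↦ pointDKernel x t (y, s) * pointDKernel x t' (y, s)) ∧
      ∫ y, pointDKernel x t (y, s) * pointDKernel x t' (y, s) =
        (Iio (min t t')).indicator
          (fun s ↦ 1 / (2 * √(4 * Real.pi)) * (t + t' - 2 * s) ^ (-(3 / 2) : ℝ)) s := by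
  simp only [pointDKernel]
  by_cases hs : s < min t t'
  · rw [indicator_of_mem (show s ∈ Iio (min t t') from hs)]
    rw [lt_min_iff] at hs
    have := integral_dgauss_mul_dgauss (sub_pos.mpr hs.1) (sub_pos.mpr hs.2)
    rw [show t - s + (t' - s) = t + t' - 2 * s by ring] at this
    exact ⟨this.1.comp_sub_left x, (integral_sub_left_eq_self
      (fun z ↦ dgauss (t - s) z * dgauss (t' - s) z) volume x).trans this.2⟩
  · rw [indicator_of_notMem (show s ∉ Iio (min t t') from hs)]
    have h0 : ∀ y, dgauss (t - s) (x - y) * dgauss (t' - s) (x - y) = 0 := by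
      intro y
      rcases min_le_iff.mp (not_lt.mp hs) with h | h
      · rw [dgauss_of_nonpos (sub_nonpos.mpr h), zero_mul]
      · rw [dgauss_of_nonpos (sub_nonpos.mpr h), mul_zero]
    simp [h0]

/-- The covariance of the derivative of the heat kernel at two times. It is finite off the diagonal
only. -/
theorem integral_pointDKernel (x : ℝ) {t t' : ℝ} (ht : 0 < t) (ht' : 0 < t') (hne : t ≠ t') :
    Integrable (fun p ↦ pointDKernel x t p * pointDKernel x t' p) halfPlane ∧
      ∫ p, pointDKernel x t p * pointDKernel x t' p ∂halfPlane =
        1 / (2 * √(4 * Real.pi)) *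
          (|t - t'| ^ (-(1 / 2) : ℝ) - (t + t') ^ (-(1 / 2) : ℝ)) := by
  have hset : Ioi 0 ∩ Iio (min t t') = Ioo 0 (min t t') := rfl
  have hmeas : ∀ t, Measurable (pointDKernel x t) := fun t ↦
    measurable_pointDKernel.comp (by fun_prop : Measurable fun p : ℝ × ℝ ↦ ((x, t), p))
  have ht3 := integral_sub_two_mul_rpow_neg ht ht' hne
  have hm : AEStronglyMeasurable (fun p ↦ pointDKernel x t p * pointDKernel x t' p)
      ((volume : Measure ℝ).prod (volume.restrict (Ioi (0 : ℝ)))) :=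
    ((hmeas t).mul (hmeas t')).aestronglyMeasurable
  have hi : Integrable (fun p ↦ pointDKernel x t p * pointDKernel x t' p)
      ((volume : Measure ℝ).prod (volume.restrict (Ioi (0 : ℝ)))) := by
    refine (integrable_prod_iff' hm).mpr
      ⟨ae_of_all _ fun s ↦ (integral_pointDKernel_space x t t' s).1, ?_⟩
    have e : ∀ s, ∫ y, ‖pointDKernel x t (y, s) * pointDKernel x t' (y, s)‖ =
        (Iio (min t t')).indicator
          (fun s ↦ 1 / (2 * √(4 * Real.pi)) * (t + t' - 2 * s) ^ (-(3 / 2) : ℝ)) s := by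
      intro s
      rw [← (integral_pointDKernel_space x t t' s).2]
      exact integral_congr_ae (ae_of_all _ fun y ↦ Real.norm_of_nonneg
        (pointDKernel_mul_nonneg _ _ _ _))
    simp only [e]
    rw [integrable_indicator_iff measurableSet_Iio, IntegrableOn,
      Measure.restrict_restrict measurableSet_Iio, inter_comm, hset]
    exact ht3.1.const_mul _
  rw [halfPlane_eq_prod]
  refine ⟨hi, ?_⟩
  rw [integral_prod_symm _ hi]
  simp only [(integral_pointDKernel_space x t t' _).2]
  rw [setIntegral_indicator measurableSet_Iio, hset, integral_const_mul, ht3.2]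

theorem ae_restrict_prod_ne : ∀ᵐ r : ℝ × ℝ ∂(volume.restrict (Ioi (0 : ℝ))).prod
    (volume.restrict (Ioi (0 : ℝ))), 0 < r.1 ∧ 0 < r.2 ∧ r.1 ≠ r.2 := by
  rw [Measure.prod_restrict, ← Measure.volume_eq_prod]
  refine (ae_restrict_iff' (measurableSet_Ioi.prod measurableSet_Ioi)).mpr ?_
  filter_upwards [ae_prod_ne] with r hr hr'
  exact ⟨hr'.1, hr'.2, hr⟩

/-- Absolute convergence of the covariance integral of the smeared derivative: the integrand in
space-time has a constant sign, and its integral has the integrable singularity `|t - t'|^{-1/2}`.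
-/
theorem IsTest.integrable_pointDKernel {h k : ℝ → ℝ} (hh : IsTest h) (hk : IsTest k) (x : ℝ) :
    Integrable (fun q : (ℝ × ℝ) × (ℝ × ℝ) ↦
      (pointDKernel x q.2.1 q.1 * h q.2.1) * (pointDKernel x q.2.2 q.1 * k q.2.2))
      (halfPlane.prod ((volume.restrict (Ioi (0 : ℝ))).prod (volume.restrict (Ioi (0 : ℝ))))) := by
  have hm1 : Measurable fun q : (ℝ × ℝ) × (ℝ × ℝ) ↦ pointDKernel x q.2.1 q.1 * h q.2.1 :=
    (measurable_pointDKernel.comp (by fun_prop : Measurable fun q : (ℝ × ℝ) × (ℝ × ℝ) ↦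
      ((x, q.2.1), q.1))).mul (hh.continuous.measurable.comp (by fun_prop))
  have hm2 : Measurable fun q : (ℝ × ℝ) × (ℝ × ℝ) ↦ pointDKernel x q.2.2 q.1 * k q.2.2 :=
    (measurable_pointDKernel.comp (by fun_prop : Measurable fun q : (ℝ × ℝ) × (ℝ × ℝ) ↦
      ((x, q.2.2), q.1))).mul (hk.continuous.measurable.comp (by fun_prop))
  have e : ∀ p r : ℝ × ℝ, (pointDKernel x r.1 p * h r.1) * (pointDKernel x r.2 p * k r.2) =
      h r.1 * k r.2 * (pointDKernel x r.1 p * pointDKernel x r.2 p) := fun p r ↦ by ring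
  refine (integrable_prod_iff' (hm1.mul hm2).aestronglyMeasurable).mpr ⟨?_, ?_⟩
  · filter_upwards [ae_restrict_prod_ne] with r hr
    simp only [Pi.mul_apply, e]
    exact (integral_pointDKernel x hr.1 hr.2.1 hr.2.2).1.const_mul _
  · have hi := integrable_mul_abs_sub_rpow hh.continuous hh.hasCompactSupport hk.continuous
      hk.hasCompactSupport
    rw [Measure.prod_restrict, ← Measure.volume_eq_prod]
    refine (hi.norm.restrict).mono'
      (hm1.mul hm2).norm.stronglyMeasurable.integral_prod_left.aestronglyMeasurable ?_
    rw [Measure.volume_eq_prod, ← Measure.prod_restrict]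
    filter_upwards [ae_restrict_prod_ne] with r hr
    have h1 : ∫ p, ‖(pointDKernel x r.1 p * h r.1) * (pointDKernel x r.2 p * k r.2)‖ ∂halfPlane =
        |h r.1 * k r.2| * (1 / (2 * √(4 * Real.pi)) *
          (|r.1 - r.2| ^ (-(1 / 2) : ℝ) - (r.1 + r.2) ^ (-(1 / 2) : ℝ))) := by
      rw [← (integral_pointDKernel x hr.1 hr.2.1 hr.2.2).2, ← integral_const_mul]
      refine integral_congr_ae (ae_of_all _ fun p ↦ ?_)
      beta_reduce
      rw [e, norm_mul, Real.norm_eq_abs, Real.norm_of_nonneg (pointDKernel_mul_nonneg _ _ _ _)]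
    simp only [Pi.mul_apply]
    rw [Real.norm_of_nonneg (integral_nonneg fun p ↦ norm_nonneg _), h1, norm_mul,
      Real.norm_eq_abs, Real.norm_of_nonneg (by positivity : 0 ≤ |r.1 - r.2| ^ (-(1 / 2) : ℝ))]
    refine mul_le_mul_of_nonneg_left ?_ (abs_nonneg _)
    have h3 : 0 ≤ (r.1 + r.2) ^ (-(1 / 2) : ℝ) := Real.rpow_nonneg (by linarith [hr.1, hr.2.1]) _
    have h4 : 0 ≤ |r.1 - r.2| ^ (-(1 / 2) : ℝ) := by positivity
    have h5 : 1 / (2 * √(4 * Real.pi)) ≤ 1 := by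
      have : 1 ≤ √(4 * Real.pi) := Real.one_le_sqrt.mpr (by linarith [Real.pi_gt_three])
      rw [div_le_one (by positivity)]
      linarith
    have h6 : 0 ≤ 1 / (2 * √(4 * Real.pi)) := by positivity
    nlinarith [mul_nonneg h6 h3, mul_nonneg (sub_nonneg.mpr h5) h4]

theorem IsTest.measurable_kernelDU {h : ℝ → ℝ} (hh : IsTest h) :
    Measurable fun q : ℝ × (ℝ × ℝ) ↦ kernelDU q.1 h q.2 := by
  simp only [kernelDU_eq]
  have hm1 : Measurable fun q : (ℝ × (ℝ × ℝ)) × ℝ ↦ pointDKernel q.1.1 q.2 q.1.2 * h q.2 :=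
    (measurable_pointDKernel.comp (by fun_prop : Measurable fun q : (ℝ × (ℝ × ℝ)) × ℝ ↦
      ((q.1.1, q.2), q.1.2))).mul (hh.continuous.measurable.comp (by fun_prop))
  exact hm1.stronglyMeasurable.integral_prod_right.measurable

theorem IsTest.memLp_kernelDU {h : ℝ → ℝ} (hh : IsTest h) (x : ℝ) :
    MemLp (kernelDU x h) 2 halfPlane := by
  have hm : Measurable (kernelDU x h) := hh.measurable_kernelDU.comp (by fun_prop :
    Measurable fun p : ℝ × ℝ ↦ (x, p))
  refine (memLp_two_iff_integrable_sq hm.aestronglyMeasurable).mpr ?_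
  simpa only [pow_two, kernelDU_eq] using
    (integral_mul_integral_of_integrable (Φ := fun p t ↦ pointDKernel x t p * h t)
      (Ψ := fun p t ↦ pointDKernel x t p * h t) (hh.integrable_pointDKernel hh x)).1

/-- The function `(y, s) ↦ ∫ ∂₃g(y, s; x, t) h(t) dt` in `L²`; the value is `0` unless the integral
defines a square integrable function. -/
def duVec (x : ℝ) (h : ℝ → ℝ) : Lp ℝ 2 halfPlane :=
  open Classical in if hm : MemLp (kernelDU x h) 2 halfPlane then hm.toLp _ else 0

theorem IsTest.duVec_eq {h : ℝ → ℝ} (hh : IsTest h) (x : ℝ) :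
    (hh.memLp_kernelDU x).toLp _ = duVec x h := by
  rw [duVec, dif_pos (hh.memLp_kernelDU x)]

theorem IsTest.duVec_ae {h : ℝ → ℝ} (hh : IsTest h) (x : ℝ) :
    duVec x h =ᵐ[halfPlane] kernelDU x h := by
  rw [← hh.duVec_eq]
  exact MemLp.coeFn_toLp _

/-- The covariance of the smeared derivatives at one point of space. -/
theorem IsTest.inner_duVec {h k : ℝ → ℝ} (hh : IsTest h) (hk : IsTest k) (x : ℝ) :
    Integrable (fun r : ℝ × ℝ ↦ h r.1 * k r.2 * (1 / (2 * √(4 * Real.pi)) *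
        (|r.1 - r.2| ^ (-(1 / 2) : ℝ) - (r.1 + r.2) ^ (-(1 / 2) : ℝ))))
        ((volume.restrict (Ioi (0 : ℝ))).prod (volume.restrict (Ioi (0 : ℝ)))) ∧
    inner ℝ (duVec x h) (duVec x k) =
      ∫ r : ℝ × ℝ, h r.1 * k r.2 * (1 / (2 * √(4 * Real.pi)) *
        (|r.1 - r.2| ^ (-(1 / 2) : ℝ) - (r.1 + r.2) ^ (-(1 / 2) : ℝ)))
        ∂(volume.restrict (Ioi (0 : ℝ))).prod (volume.restrict (Ioi (0 : ℝ))) := by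
  have h0 := hh.integrable_pointDKernel hk x
  have h1 := integral_mul_integral_of_integrable (Φ := fun p t ↦ pointDKernel x t p * h t)
    (Ψ := fun p t ↦ pointDKernel x t p * k t) h0
  have h2 := h0.integral_prod_right
  have e : (fun r : ℝ × ℝ ↦ ∫ p, (pointDKernel x r.1 p * h r.1) * (pointDKernel x r.2 p * k r.2)
      ∂halfPlane) =ᵐ[(volume.restrict (Ioi (0 : ℝ))).prod (volume.restrict (Ioi (0 : ℝ)))]
      fun r ↦ h r.1 * k r.2 * (1 / (2 * √(4 * Real.pi)) *
        (|r.1 - r.2| ^ (-(1 / 2) : ℝ) - (r.1 + r.2) ^ (-(1 / 2) : ℝ))) := by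
    filter_upwards [ae_restrict_prod_ne] with r hr
    rw [← (integral_pointDKernel x hr.1 hr.2.1 hr.2.2).2, ← integral_const_mul]
    congr 1
    ext p
    ring
  refine ⟨h2.congr e, ?_⟩
  rw [← hh.duVec_eq, ← hk.duVec_eq, inner_toLp]
  simp only [kernelDU_eq]
  rw [h1.2]
  exact integral_congr_ae e

/-! ### Translation and reflection in space -/

theorem measurePreserving_prodMap_id {φ : ℝ → ℝ} (hφ : MeasurePreserving φ volume volume) :
    MeasurePreserving (Prod.map φ (id : ℝ → ℝ)) halfPlane halfPlane := by
  rw [halfPlane_eq_prod]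
  exact hφ.prod (MeasurePreserving.id _)

/-- Translation by `z` in space, as an isometry of `L²` of the half plane. -/
def shift (z : ℝ) : Lp ℝ 2 halfPlane →ₗᵢ[ℝ] Lp ℝ 2 halfPlane :=
  Lp.compMeasurePreservingₗᵢ ℝ _
    (measurePreserving_prodMap_id (measurePreserving_sub_right volume z))

/-- Reflection at `x` in space, as an isometry of `L²` of the half plane. -/
def reflect (x : ℝ) : Lp ℝ 2 halfPlane →ₗᵢ[ℝ] Lp ℝ 2 halfPlane :=
  Lp.compMeasurePreservingₗᵢ ℝ _
    (measurePreserving_prodMap_id (Measure.measurePreserving_sub_left volume (2 * x)))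

theorem toLp_congr_fun {f g : ℝ × ℝ → ℝ} (hf : MemLp f 2 halfPlane) (hg : MemLp g 2 halfPlane)
    (h : ∀ p, f p = g p) : hf.toLp f = hg.toLp g :=
  (MemLp.toLp_eq_toLp_iff hf hg).mpr (ae_of_all _ h)

theorem shift_heatVec (z x t : ℝ) : shift z (heatVec x t) = heatVec (x + z) t := by
  refine (Lp.toLp_compMeasurePreserving (memLp_pointKernel x t) _).trans
    (toLp_congr_fun _ _ fun p ↦ ?_)
  simp only [pointKernel, Function.comp, Prod.map, id]
  ring_nf

theorem reflect_heatVec (x t : ℝ) : reflect x (heatVec x t) = heatVec x t := by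
  refine (Lp.toLp_compMeasurePreserving (memLp_pointKernel x t) _).trans
    (toLp_congr_fun _ _ fun p ↦ ?_)
  simp only [pointKernel, Function.comp, Prod.map, id]
  rw [← gauss_neg]
  ring_nf

theorem IsTest.shift_duVec {h : ℝ → ℝ} (hh : IsTest h) (z x : ℝ) :
    shift z (duVec x h) = duVec (x + z) h := by
  rw [← hh.duVec_eq, ← hh.duVec_eq]
  refine (Lp.toLp_compMeasurePreserving (hh.memLp_kernelDU x) _).trans
    (toLp_congr_fun _ _ fun p ↦ ?_)
  simp only [kernelDU_eq, pointDKernel, Function.comp, Prod.map, id,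
    sub_sub_eq_add_sub]

theorem IsTest.reflect_duVec {h : ℝ → ℝ} (hh : IsTest h) (x : ℝ) :
    reflect x (duVec x h) = -duVec x h := by
  rw [← hh.duVec_eq, ← MemLp.toLp_neg]
  refine (Lp.toLp_compMeasurePreserving (hh.memLp_kernelDU x) _).trans
    (toLp_congr_fun _ _ fun p ↦ ?_)
  simp only [kernelDU_eq, pointDKernel, Function.comp, Prod.map, id, Pi.neg_apply]
  rw [← integral_neg]
  congr 1
  ext t
  rw [← neg_mul, ← dgauss_neg]
  ring_nf

/-- The heat kernel is even and its space derivative is odd under reflection at `x`. -/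
theorem IsTest.inner_heatVec_duVec {h : ℝ → ℝ} (hh : IsTest h) (x t : ℝ) :
    inner ℝ (heatVec x t) (duVec x h) = 0 := by
  have h1 := (reflect x).inner_map_map (heatVec x t) (duVec x h)
  rw [reflect_heatVec, hh.reflect_duVec, inner_neg_right] at h1
  linarith

/-- The smeared heat kernel and its derivative at the same point of space are orthogonal. -/
theorem IsTest.inner_uVec_duVec {h k : ℝ → ℝ} (hh : IsTest h) (hk : IsTest k) (x : ℝ) :
    inner ℝ (uVec x k) (duVec x h) = 0 := by
  rw [real_inner_comm, hk.inner_uVec_left]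
  have e : ∀ t, inner ℝ (duVec x h) (heatVec x t) = 0 := fun t ↦ by
    rw [real_inner_comm, hh.inner_heatVec_duVec]
  simp [e]

theorem IsTest.shift_uVec {h : ℝ → ℝ} (hh : IsTest h) (z x : ℝ) :
    shift z (uVec x h) = uVec (x + z) h := by
  have := (shift z).toContinuousLinearMap.integral_comp_comm
    ((hh.integrable_smul_heatVec x).integrableOn (s := Ioi 0))
  rw [uVec, uVec]
  refine this.symm.trans ?_
  simp [shift_heatVec]

theorem IsTest.norm_uVec {h : ℝ → ℝ} (hh : IsTest h) (x y : ℝ) : ‖uVec x h‖ = ‖uVec y h‖ := by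
  rw [← (shift (y - x)).norm_map (uVec x h), hh.shift_uVec, add_sub_cancel]

theorem IsTest.norm_duVec {h : ℝ → ℝ} (hh : IsTest h) (x y : ℝ) : ‖duVec x h‖ = ‖duVec y h‖ := by
  rw [← (shift (y - x)).norm_map (duVec x h), hh.shift_duVec, add_sub_cancel]

/-! ### The noise term -/

theorem IsTest.integral_noise {h : ℝ → ℝ} (hh : IsTest h) {a b : ℝ} (hab : a ≤ b) :
    Integrable (fun p : ℝ × ℝ ↦ ((Ioc a b).indicator (fun _ ↦ (1 : ℝ)) p.1 * h p.2) ^ 2)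
      halfPlane ∧
    ∫ p, ((Ioc a b).indicator (fun _ ↦ (1 : ℝ)) p.1 * h p.2) ^ 2 ∂halfPlane =
      (b - a) * ∫ t in Ioi 0, h t ^ 2 := by
  have e : ∀ y, (Ioc a b).indicator (fun _ ↦ (1 : ℝ)) y ^ 2 =
      (Ioc a b).indicator (fun _ ↦ (1 : ℝ)) y := fun y ↦ by
    by_cases hy : y ∈ Ioc a b <;> simp [hy]
  have h1 : Integrable ((Ioc a b).indicator fun _ ↦ (1 : ℝ)) :=
    (integrable_indicator_iff measurableSet_Ioc).mpr (by simp)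
  have h2 : Integrable (fun t ↦ h t ^ 2) (volume.restrict (Ioi (0 : ℝ))) := by
    have h3 : HasCompactSupport fun t ↦ h t ^ 2 :=
      hh.hasCompactSupport.comp_left (g := fun r : ℝ ↦ r ^ 2) (by simp)
    have h4 : Integrable (fun t ↦ h t ^ 2) volume :=
      (hh.continuous.pow 2).integrable_of_hasCompactSupport h3
    exact h4.restrict
  simp only [mul_pow, e, halfPlane_eq_prod]
  refine ⟨Integrable.mul_prod (f := (Ioc a b).indicator fun _ ↦ (1 : ℝ))
    (g := fun t ↦ h t ^ 2) h1 h2, ?_⟩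
  have h3 := integral_prod_mul (μ := volume) (ν := volume.restrict (Ioi (0 : ℝ)))
    ((Ioc a b).indicator fun _ ↦ (1 : ℝ)) (fun t ↦ h t ^ 2)
  rw [integral_indicator measurableSet_Ioc, setIntegral_const, smul_eq_mul, mul_one,
    Real.volume_real_Ioc_of_le hab] at h3
  exact h3

theorem IsTest.memLp_noise {h : ℝ → ℝ} (hh : IsTest h) {a b : ℝ} (hab : a ≤ b) :
    MemLp (fun p : ℝ × ℝ ↦ (Ioc a b).indicator (fun _ ↦ (1 : ℝ)) p.1 * h p.2) 2 halfPlane := by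
  refine (memLp_two_iff_integrable_sq ?_).mpr (hh.integral_noise hab).1
  exact (((measurable_const.indicator measurableSet_Ioc).comp measurable_fst).mul
    (hh.continuous.measurable.comp measurable_snd)).aestronglyMeasurable

theorem IsTest.norm_noise {h : ℝ → ℝ} (hh : IsTest h) {a b : ℝ} (hab : a ≤ b) :
    ‖(hh.memLp_noise hab).toLp _‖ = √(∫ t in Ioi 0, h t ^ 2) * (b - a) ^ (1 / 2 : ℝ) := by
  rw [← Real.sqrt_eq_rpow, mul_comm, ← Real.sqrt_mul (sub_nonneg.mpr hab),
    ← (hh.integral_noise hab).2]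
  simp only [pow_two]
  rw [← inner_toLp (hh.memLp_noise hab) (hh.memLp_noise hab), real_inner_self_eq_norm_sq,
    Real.sqrt_sq (norm_nonneg _)]

/-! ### The evolution equations in space -/

theorem integrable_abs_sub_rpow_mul {a : ℝ} (ha : -1 < a) {h : ℝ → ℝ} (hc : Continuous h)
    (hs : HasCompactSupport h) (s : ℝ) : Integrable fun t ↦ |t - s| ^ a * h t := by
  have h1 := (locallyIntegrable_abs_rpow ha).integrable_smul_right_of_hasCompactSupport
    (hc.comp (continuous_add_const s)) (hs.comp_homeomorph (Homeomorph.addRight s))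
  simpa using h1.comp_sub_right s

theorem continuous_gauss (τ : ℝ) : Continuous (gauss τ) :=
  continuous_iff_continuousAt.mpr fun z ↦ (hasDerivAt_gauss τ z).continuousAt

/-- The primitive of the standard heat kernel vanishing at `0`, an error function. -/
def gaussPrim (r : ℝ) : ℝ := ∫ u in (0 : ℝ)..r, gauss 1 u

theorem hasDerivAt_gaussPrim (r : ℝ) : HasDerivAt gaussPrim (gauss 1 r) r :=
  ((continuous_gauss 1).integral_hasStrictDerivAt 0 r).hasDerivAt

theorem gaussPrim_neg (r : ℝ) : gaussPrim (-r) = -gaussPrim r := by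
  have h1 := intervalIntegral.integral_comp_neg (gauss 1) (a := 0) (b := r)
  simp only [gauss_neg, neg_zero] at h1
  rw [gaussPrim, gaussPrim, h1, intervalIntegral.integral_symm]

theorem integral_gauss_one_Ioi :
    IntegrableOn (gauss 1) (Ioi 0) ∧ ∫ u in Ioi 0, gauss 1 u = 1 / 2 := by
  have e : gauss 1 = fun u ↦ 1 / √(4 * Real.pi) * Real.exp (-(1 / 4) * u ^ 2) := by
    funext u
    rw [gauss_of_pos one_pos]
    congr 2
    · rw [mul_one]
    · ring
  rw [e]
  refine ⟨((integrable_exp_neg_mul_sq (by norm_num)).const_mul _).integrableOn, ?_⟩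
  rw [integral_const_mul, integral_gaussian_Ioi, show Real.pi / (1 / 4) = 4 * Real.pi by ring]
  have : √(4 * Real.pi) ≠ 0 := by positivity
  field_simp

theorem tendsto_gaussPrim_atTop : Tendsto gaussPrim atTop (𝓝 (1 / 2)) := by
  rw [← integral_gauss_one_Ioi.2]
  exact intervalIntegral_tendsto_integral_Ioi 0 integral_gauss_one_Ioi.1 tendsto_id

theorem abs_gaussPrim_le (r : ℝ) : |gaussPrim r| ≤ 1 / 2 := by
  have h1 : ∀ r : ℝ, 0 ≤ r → |gaussPrim r| ≤ 1 / 2 := by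
    intro r hr
    rw [gaussPrim, intervalIntegral.integral_of_le hr,
      abs_of_nonneg (integral_nonneg fun u ↦ gauss_nonneg _ _), ← integral_gauss_one_Ioi.2]
    exact setIntegral_mono_set integral_gauss_one_Ioi.1 (ae_of_all _ fun u ↦ gauss_nonneg _ _)
      Ioc_subset_Ioi_self.eventuallyLE
  rcases le_total 0 r with hr | hr
  · exact h1 r hr
  · rw [← neg_neg r, gaussPrim_neg, abs_neg]
    exact h1 _ (by linarith)

theorem gauss_one_div_sqrt {τ : ℝ} (hτ : 0 < τ) (z : ℝ) :
    gauss 1 (z / √τ) = √τ * gauss τ z := by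
  have h1 : √τ ≠ 0 := (Real.sqrt_pos.mpr hτ).ne'
  rw [gauss_of_pos one_pos, gauss_of_pos hτ, div_pow, Real.sq_sqrt hτ.le, mul_one,
    Real.sqrt_mul (by positivity : 0 ≤ 4 * Real.pi) τ]
  have h2 : -(z ^ 2 / τ) / 4 = -z ^ 2 / (4 * τ) := by field_simp
  rw [mul_one, h2]
  field_simp

theorem hasDerivAt_gaussPrim_space {τ : ℝ} (hτ : 0 < τ) (z : ℝ) :
    HasDerivAt (fun z ↦ gaussPrim (z / √τ)) (gauss τ z) z := by
  have h1 : √τ ≠ 0 := (Real.sqrt_pos.mpr hτ).ne'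
  refine ((hasDerivAt_gaussPrim (z / √τ)).comp z ((hasDerivAt_id z).div_const √τ)).congr_deriv ?_
  rw [gauss_one_div_sqrt hτ]
  field_simp

theorem hasDerivAt_gaussPrim_time {τ : ℝ} (hτ : 0 < τ) (z : ℝ) :
    HasDerivAt (fun τ ↦ gaussPrim (z / √τ)) (dgauss τ z) τ := by
  have h1 : √τ ≠ 0 := (Real.sqrt_pos.mpr hτ).ne'
  have h2 : HasDerivAt (fun τ : ℝ ↦ z / √τ) (-(z * (1 / (2 * √τ))) / √τ ^ 2) τ := by
    simpa using (hasDerivAt_const τ z).fun_div (Real.hasDerivAt_sqrt hτ.ne') h1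
  refine ((hasDerivAt_gaussPrim (z / √τ)).comp τ h2).congr_deriv ?_
  rw [gauss_one_div_sqrt hτ, Real.sq_sqrt hτ.le, dgauss]
  field_simp

/-- As the elapsed time tends to `0`, the space primitive of the heat kernel tends to a step
function. -/
theorem tendsto_gaussPrim_div_sqrt {z : ℝ} (hz : z ≠ 0) (s : ℝ) :
    Tendsto (fun t ↦ gaussPrim (z / √(t - s))) (𝓝[>] s) (𝓝 (SignType.sign z / 2)) := by
  have h1 : Tendsto (fun t ↦ √(t - s)) (𝓝[>] s) (𝓝[>] 0) := by
    refine tendsto_nhdsWithin_iff.mpr ⟨?_, ?_⟩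
    · have : Continuous fun t ↦ √(t - s) := by fun_prop
      exact (this.tendsto' s 0 (by simp)).mono_left nhdsWithin_le_nhds
    · filter_upwards [self_mem_nhdsWithin] with t ht
      exact Real.sqrt_pos.mpr (sub_pos.mpr ht)
  have h2 : ∀ {z : ℝ}, 0 < z →
      Tendsto (fun t ↦ gaussPrim (z / √(t - s))) (𝓝[>] s) (𝓝 (1 / 2)) := by
    intro z hz
    refine tendsto_gaussPrim_atTop.comp ?_
    simp only [div_eq_mul_inv]
    exact (tendsto_inv_nhdsGT_zero.comp h1).const_mul_atTop hz
  rcases hz.lt_or_gt with hz | hz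
  · have h3 := (h2 (neg_pos.mpr hz)).neg
    simp only [neg_div, gaussPrim_neg, neg_neg] at h3
    simpa [sign_neg hz, neg_div] using h3
  · simpa [sign_pos hz] using h2 hz

theorem integrable_dgauss_mul {h : ℝ → ℝ} (hh : IsTest h) {z : ℝ} (hz : z ≠ 0) (s : ℝ) :
    Integrable fun t ↦ dgauss (t - s) z * h t := by
  have h1 := (integrable_abs_sub_rpow_mul (a := -(3 / 4)) (by norm_num) hh.continuous
    hh.hasCompactSupport s).norm.const_mul (2 * |z| ^ (-(1 / 2) : ℝ))
  refine h1.mono' ?_ (ae_of_all _ fun t ↦ ?_)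
  · exact ((measurable_dgauss.comp (by fun_prop : Measurable fun t : ℝ ↦ (t - s, z))).mul
      hh.continuous.measurable).aestronglyMeasurable
  · rw [norm_mul, norm_mul, ← mul_assoc]
    refine mul_le_mul_of_nonneg_right ?_ (norm_nonneg _)
    rcases le_or_gt (t - s) 0 with ht | ht
    · rw [dgauss_of_nonpos ht, norm_zero]
      positivity
    · refine (abs_dgauss_le ht hz).trans_eq ?_
      rw [Real.norm_of_nonneg (by positivity), abs_of_pos ht]
      ring

theorem TestSpace.hasDerivAt (h : TestSpace) (t : ℝ) : HasDerivAt h (deriv h t) t :=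
  (h.contDiff.differentiable (by simp) t).hasDerivAt

/-- Integration by parts in time: `∂ₓg` is the time derivative of the space primitive of `g`. The
boundary term at `t = s` comes from the jump of that primitive. -/
theorem integral_dgauss_mul (h : TestSpace) {z : ℝ} (hz : z ≠ 0) {s : ℝ} (hs : 0 ≤ s) :
    IntegrableOn (fun t ↦ gaussPrim (z / √(t - s)) * deriv h t) (Ioi s) ∧
    ∫ t in Ioi 0, dgauss (t - s) z * h t =
      -(SignType.sign z / 2 * h s) - ∫ t in Ioi s, gaussPrim (z / √(t - s)) * deriv h t := by
  have hd : ∀ t ∈ Ioi s, HasDerivAt (fun t ↦ gaussPrim (z / √(t - s))) (dgauss (t - s) z) t :=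
    fun t ht ↦ (hasDerivAt_gaussPrim_time (sub_pos.mpr ht) z).comp_sub_const t s
  have hi : IntegrableOn (fun t ↦ gaussPrim (z / √(t - s)) * deriv h t) (Ioi s) := by
    refine Integrable.bdd_mul (c := 1 / 2) ?_ ?_ (ae_of_all _ fun t ↦ abs_gaussPrim_le _)
    · exact (h.isTest_deriv.continuous.integrable_of_hasCompactSupport
        h.isTest_deriv.hasCompactSupport).integrableOn
    · have hc : Measurable gaussPrim := (continuous_iff_continuousAt.mpr fun r ↦
        (hasDerivAt_gaussPrim r).continuousAt).measurable
      exact (hc.comp (by fun_prop : Measurable fun t : ℝ ↦ z / √(t - s))).aestronglyMeasurable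
  refine ⟨hi, ?_⟩
  have h1 : ∫ t in Ioi 0, dgauss (t - s) z * h t = ∫ t in Ioi s, dgauss (t - s) z * h t := by
    refine setIntegral_eq_of_subset_of_forall_sdiff_eq_zero measurableSet_Ioi
      (Ioi_subset_Ioi hs) fun t ht ↦ ?_
    rw [dgauss_of_nonpos (sub_nonpos.mpr (not_lt.mp ht.2)), zero_mul]
  have h2 := integral_Ioi_mul_deriv_eq_deriv_mul (a := s) (b' := 0) hd
    (fun t _ ↦ h.hasDerivAt t) hi (integrable_dgauss_mul h.isTest hz s).integrableOn
    ((tendsto_gaussPrim_div_sqrt hz s).mul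
      (h.continuous.continuousAt.tendsto.mono_left nhdsWithin_le_nhds))
    (by
      refine (tendsto_const_nhds (x := (0 : ℝ))).congr' ?_
      have h3 : ∀ᶠ t in atTop, h t = 0 := by
        have := h.hasCompactSupport.isCompact.isBounded
        obtain ⟨R, hR⟩ := this.subset_closedBall 0
        filter_upwards [eventually_gt_atTop R] with t ht
        by_contra hne
        have h4 := hR (subset_tsupport _ (Function.mem_support.mpr hne))
        rw [mem_closedBall_zero_iff, Real.norm_eq_abs] at h4
        exact absurd ((le_abs_self t).trans h4) (not_le.mpr ht)
      filter_upwards [h3] with t ht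
      simp [ht])
  rw [h1, h2]
  ring

theorem continuous_dgauss (τ : ℝ) : Continuous (dgauss τ) := by
  have := continuous_gauss τ
  unfold dgauss
  fun_prop

theorem gauss_le_rpow (τ z : ℝ) : gauss τ z ≤ |τ| ^ (-(1 / 2) : ℝ) := by
  rcases le_or_gt τ 0 with hτ | hτ
  · rw [gauss_of_nonpos hτ]
    positivity
  · refine (gauss_le_gauss_zero τ z).trans ?_
    rw [gauss_zero hτ, abs_of_pos hτ]
    refine mul_le_of_le_one_left (by positivity) ?_
    rw [div_le_one (by positivity)]
    exact Real.one_le_sqrt.mpr (by linarith [Real.pi_gt_three])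

theorem integrable_gauss_mul {h : ℝ → ℝ} (hh : IsTest h) (z s : ℝ) :
    Integrable fun t ↦ gauss (t - s) z * h t := by
  have h1 := (integrable_abs_sub_rpow_mul (a := -(1 / 2)) (by norm_num) hh.continuous
    hh.hasCompactSupport s).norm
  refine h1.mono' ?_ (ae_of_all _ fun t ↦ ?_)
  · exact ((measurable_gauss.comp (by fun_prop : Measurable fun t : ℝ ↦ (t - s, z))).mul
      hh.continuous.measurable).aestronglyMeasurable
  · rw [norm_mul, norm_mul]
    refine mul_le_mul_of_nonneg_right ?_ (norm_nonneg _)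
    rw [Real.norm_of_nonneg (gauss_nonneg _ _), Real.norm_of_nonneg (by positivity)]
    exact gauss_le_rpow _ _

theorem integrable_gauss_mul_prod {h : ℝ → ℝ} (hh : IsTest h) (a b y s : ℝ) :
    Integrable (fun q : ℝ × ℝ ↦ gauss (q.2 - s) (q.1 - y) * h q.2)
      ((volume.restrict (Ioc a b)).prod volume) := by
  have h1 := (integrable_abs_sub_rpow_mul (a := -(1 / 2)) (by norm_num) hh.continuous
    hh.hasCompactSupport s).norm
  have h2 : Integrable (fun _ : ℝ ↦ (1 : ℝ)) (volume.restrict (Ioc a b)) := integrable_const 1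
  refine (h2.mul_prod h1).mono' ?_ (ae_of_all _ fun q ↦ ?_)
  · exact ((measurable_gauss.comp (by fun_prop : Measurable fun q : ℝ × ℝ ↦
      (q.2 - s, q.1 - y))).mul (hh.continuous.measurable.comp measurable_snd)).aestronglyMeasurable
  · rw [one_mul, norm_mul, norm_mul]
    refine mul_le_mul_of_nonneg_right ?_ (norm_nonneg _)
    rw [Real.norm_of_nonneg (gauss_nonneg _ _), Real.norm_of_nonneg (by positivity)]
    exact gauss_le_rpow _ _

theorem integrable_dgauss_mul_prod {h : ℝ → ℝ} (hh : IsTest h) (a b y s : ℝ) :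
    Integrable (fun q : ℝ × ℝ ↦ dgauss (q.2 - s) (q.1 - y) * h q.2)
      ((volume.restrict (Ioc a b)).prod volume) := by
  have h1 := (integrable_abs_sub_rpow_mul (a := -(3 / 4)) (by norm_num) hh.continuous
    hh.hasCompactSupport s).norm
  have h2 : Integrable (fun x : ℝ ↦ 2 * |x - y| ^ (-(1 / 2) : ℝ))
      (volume.restrict (Ioc a b)) := by
    have h3 := ((locallyIntegrable_abs_rpow (a := -(1 / 2)) (by norm_num)).integrableOn_isCompact
      (isCompact_Icc (a := a - y) (b := b - y))).const_mul 2
    have h4 : MeasurePreserving (fun x : ℝ ↦ x - y) := measurePreserving_sub_right volume y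
    have h5 := (h4.integrableOn_comp_preimage (MeasurableEquiv.subRight y).measurableEmbedding).mpr
      h3
    refine h5.mono_set fun x hx ↦ ⟨?_, ?_⟩
    · exact sub_le_sub_right hx.1.le y
    · exact sub_le_sub_right hx.2 y
  refine (h2.mul_prod h1).mono' ?_ ?_
  · exact ((measurable_dgauss.comp (by fun_prop : Measurable fun q : ℝ × ℝ ↦
      (q.2 - s, q.1 - y))).mul (hh.continuous.measurable.comp measurable_snd)).aestronglyMeasurable
  · have hne : ∀ᵐ x ∂volume.restrict (Ioc a b), x - y ≠ 0 := by
      refine ae_restrict_of_ae ?_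
      simp [sub_ne_zero, ae_iff]
    have hne' := Measure.quasiMeasurePreserving_fst (μ := volume.restrict (Ioc a b))
      (ν := (volume : Measure ℝ)) |>.ae hne
    filter_upwards [hne'] with q hq
    rw [norm_mul, norm_mul, ← mul_assoc]
    refine mul_le_mul_of_nonneg_right ?_ (norm_nonneg _)
    rcases le_or_gt (q.2 - s) 0 with ht | ht
    · rw [dgauss_of_nonpos ht, norm_zero]
      positivity
    · refine (abs_dgauss_le ht hq).trans_eq ?_
      rw [Real.norm_of_nonneg (by positivity), abs_of_pos ht]
      ring

/-- The first evolution equation for the kernels: the fundamental theorem of calculus in `x`. -/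
theorem kernelU_sub (h : TestSpace) {x₀ x : ℝ} (hx : x₀ ≤ x) (p : ℝ × ℝ) :
    kernelU x h p - kernelU x₀ h p = ∫ y in Ioc x₀ x, kernelDU y h p := by
  have hi := integrable_dgauss_mul_prod h.isTest x₀ x p.1 p.2
  have hi' : Integrable (Function.uncurry fun y t : ℝ ↦ dgauss (t - p.2) (y - p.1) * h t)
      ((volume.restrict (Ioc x₀ x)).prod (volume.restrict (Ioi 0))) :=
    hi.mono_measure (Measure.prod_mono le_rfl Measure.restrict_le_self)
  simp only [kernelU_eq, kernelDU_eq, pointKernel, pointDKernel]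
  rw [integral_integral_swap hi', ← integral_sub (integrable_gauss_mul h.isTest _ _).integrableOn
    (integrable_gauss_mul h.isTest _ _).integrableOn]
  congr 1
  ext t
  rw [integral_mul_const, ← sub_mul, ← intervalIntegral.integral_of_le hx]
  congr 1
  have hc : Continuous fun y ↦ dgauss (t - p.2) (y - p.1) :=
    (continuous_dgauss _).comp (continuous_sub_right _)
  exact (intervalIntegral.integral_eq_sub_of_hasDerivAt
    (fun y _ ↦ (hasDerivAt_gauss (t - p.2) (y - p.1)).comp_sub_const y p.1)
    (hc.intervalIntegrable _ _)).symm

/-- The second evolution equation for the kernels. The boundary terms of the integrations by parts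
at `x` and at `x₀` differ by the sign jump, which is the indicator of `(x₀, x]`. -/
theorem kernelDU_sub (h : TestSpace) {x₀ x : ℝ} (hx : x₀ ≤ x) {p : ℝ × ℝ} (h1 : p.1 ≠ x)
    (h2 : p.1 ≠ x₀) (h3 : 0 < p.2) :
    kernelDU x h p - kernelDU x₀ h p = -(∫ y in Ioc x₀ x, kernelU y (deriv h) p) -
      (Ioc x₀ x).indicator (fun _ ↦ (1 : ℝ)) p.1 * h p.2 := by
  have hi := integrable_gauss_mul_prod h.isTest_deriv x₀ x p.1 p.2
  have hi' : Integrable (Function.uncurry fun y t : ℝ ↦ gauss (t - p.2) (y - p.1) * deriv h t)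
      ((volume.restrict (Ioc x₀ x)).prod (volume.restrict (Ioi 0))) :=
    hi.mono_measure (Measure.prod_mono le_rfl Measure.restrict_le_self)
  obtain ⟨i1, e1⟩ := integral_dgauss_mul h (sub_ne_zero.mpr h1.symm) h3.le
  obtain ⟨i2, e2⟩ := integral_dgauss_mul h (sub_ne_zero.mpr h2.symm) h3.le
  have e3 : ∫ y in Ioc x₀ x, kernelU y (deriv h) p =
      (∫ t in Ioi p.2, gaussPrim ((x - p.1) / √(t - p.2)) * deriv h t) -
        ∫ t in Ioi p.2, gaussPrim ((x₀ - p.1) / √(t - p.2)) * deriv h t := by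
    simp only [kernelU_eq, pointKernel]
    rw [integral_integral_swap hi', ← integral_sub i1 i2]
    have e4 : ∫ t in Ioi 0, ∫ y in Ioc x₀ x, gauss (t - p.2) (y - p.1) * deriv h t =
        ∫ t in Ioi p.2, ∫ y in Ioc x₀ x, gauss (t - p.2) (y - p.1) * deriv h t := by
      refine setIntegral_eq_of_subset_of_forall_sdiff_eq_zero measurableSet_Ioi
        (Ioi_subset_Ioi h3.le) fun t ht ↦ ?_
      simp [gauss_of_nonpos (sub_nonpos.mpr (not_lt.mp ht.2))]
    rw [e4]
    refine setIntegral_congr_fun measurableSet_Ioi fun t ht ↦ ?_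
    rw [integral_mul_const, ← sub_mul, ← intervalIntegral.integral_of_le hx]
    congr 1
    have hc : Continuous fun y ↦ gauss (t - p.2) (y - p.1) :=
      (continuous_gauss _).comp (continuous_sub_right _)
    exact intervalIntegral.integral_eq_sub_of_hasDerivAt
      (fun y _ ↦ (hasDerivAt_gaussPrim_space (sub_pos.mpr ht) (y - p.1)).comp_sub_const y p.1)
      (hc.intervalIntegrable _ _)
  -- Both sides are `1` if `p.1` lies between `x₀` and `x`, and `0` otherwise.
  have e5 : (SignType.sign (x - p.1) : ℝ) / 2 - SignType.sign (x₀ - p.1) / 2 =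
      (Ioc x₀ x).indicator (fun _ ↦ (1 : ℝ)) p.1 := by
    rcases h1.lt_or_gt with h4 | h4 <;> rcases h2.lt_or_gt with h5 | h5
    · rw [indicator_of_notMem fun hm ↦ absurd hm.1 h5.not_gt, sign_pos (sub_pos.mpr h4),
        sign_pos (sub_pos.mpr h5), sub_self]
    · rw [indicator_of_mem (show p.1 ∈ Ioc x₀ x from ⟨h5, h4.le⟩), sign_pos (sub_pos.mpr h4),
        sign_neg (sub_neg.mpr h5)]
      norm_num
    · linarith
    · rw [indicator_of_notMem fun hm ↦ absurd hm.2 h4.not_ge, sign_neg (sub_neg.mpr h4),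
        sign_neg (sub_neg.mpr h5), sub_self]
  rw [e3, ← e5, kernelDU_eq, kernelDU_eq]
  simp only [pointDKernel]
  rw [e1, e2]
  ring

/-- The second evolution equation, in `L²` of the half plane. -/
theorem duVec_sub (h : TestSpace) {x₀ x : ℝ} (hx : x₀ ≤ x) :
    duVec x h - duVec x₀ h = -(∫ y in Ioc x₀ x, uVec y (deriv h)) -
      (h.isTest.memLp_noise hx).toLp _ := by
  have hint : Integrable (fun y ↦ uVec y (deriv h)) (volume.restrict (Ioc x₀ x)) :=
    h.isTest_deriv.uniformContinuous_uVec.continuous.integrableOn_Ioc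
  have hm : Measurable fun q : ℝ × (ℝ × ℝ) ↦ kernelU q.1 (deriv h) q.2 := by
    simp only [kernelU_eq]
    have hm1 : Measurable fun q : (ℝ × (ℝ × ℝ)) × ℝ ↦
        pointKernel q.1.1 q.2 q.1.2 * deriv h q.2 :=
      (measurable_pointKernel.comp (by fun_prop : Measurable fun q : (ℝ × (ℝ × ℝ)) × ℝ ↦
        ((q.1.1, q.2), q.1.2))).mul (h.isTest_deriv.continuous.measurable.comp (by fun_prop))
    exact hm1.stronglyMeasurable.integral_prod_right.measurable
  have hv := ae_integral_eq_of_version hint (A := fun y ↦ kernelU y (deriv h))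
    hm.aestronglyMeasurable (ae_of_all _ fun y ↦ h.isTest_deriv.kernelU_ae y)
  have hne : ∀ z : ℝ, ∀ᵐ p ∂halfPlane, p.1 ≠ z := fun z ↦ by
    rw [halfPlane_eq_prod]
    have hz : ∀ᵐ y : ℝ, y ≠ z := by simp [ae_iff]
    exact Measure.quasiMeasurePreserving_fst.ae hz
  have hpos : ∀ᵐ p ∂halfPlane, 0 < p.2 := by
    rw [halfPlane_eq_prod]
    exact Measure.quasiMeasurePreserving_snd.ae (ae_restrict_mem measurableSet_Ioi)
  refine Lp.ext ?_
  filter_upwards [hv, hne x, hne x₀, hpos, h.isTest.duVec_ae x, h.isTest.duVec_ae x₀,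
    Lp.coeFn_sub (duVec x h) (duVec x₀ h), (h.isTest.memLp_noise hx).coeFn_toLp,
    Lp.coeFn_sub (-(∫ y in Ioc x₀ x, uVec y (deriv h))) ((h.isTest.memLp_noise hx).toLp _),
    Lp.coeFn_neg (∫ y in Ioc x₀ x, uVec y (deriv h))] with p e1 e2 e3 e4 e5 e6 e7 e8 e9 e10
  rw [e7, e9, Pi.sub_apply, Pi.sub_apply, e10, Pi.neg_apply, e5, e6, e8, ← e1.2,
    kernelDU_sub h hx e2 e3 e4]

/-- Continuity in space of the smeared derivative, read off from the second evolution equation: the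
drift contributes a Lipschitz term and the noise a square root. -/
theorem norm_duVec_sub_le (h : TestSpace) : ∃ C D : ℝ, ∀ x y, ‖duVec x h - duVec y h‖ ≤
    C * |x - y| + D * |x - y| ^ (1 / 2 : ℝ) := by
  refine ⟨‖uVec 0 (deriv h)‖, √(∫ t in Ioi 0, h t ^ 2), ?_⟩
  have key : ∀ x y, y ≤ x → ‖duVec x h - duVec y h‖ ≤ ‖uVec 0 (deriv h)‖ * |x - y| +
      √(∫ t in Ioi 0, h t ^ 2) * |x - y| ^ (1 / 2 : ℝ) := by
    intro x y hyx
    rw [duVec_sub h hyx, abs_of_nonneg (sub_nonneg.mpr hyx), ← h.isTest.norm_noise hyx]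
    refine (norm_sub_le _ _).trans (add_le_add_left ?_ _)
    rw [norm_neg]
    refine (norm_setIntegral_le_of_norm_le_const (C := ‖uVec 0 (deriv h)‖) (by simp)
      fun z _ ↦ (h.isTest_deriv.norm_uVec z 0).le).trans_eq ?_
    rw [Real.volume_real_Ioc_of_le hyx]
  intro x y
  rcases le_total y x with hyx | hyx
  · exact key x y hyx
  · rw [norm_sub_rev, abs_sub_comm]
    exact key y x hyx

theorem uniformContinuous_duVec (h : TestSpace) : UniformContinuous fun x ↦ duVec x h := by
  obtain ⟨C, D, hCD⟩ := norm_duVec_sub_le h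
  exact uniformContinuous_of_norm_sub_le (ω := fun r ↦ C * r + D * r ^ (1 / 2 : ℝ))
    ((continuous_const.mul continuous_id).add
      (continuous_const.mul (Real.continuous_rpow_const (by norm_num))))
    (by norm_num) hCD

/-- The first evolution equation, in `L²` of the half plane. -/
theorem uVec_sub (h : TestSpace) {x₀ x : ℝ} (hx : x₀ ≤ x) :
    uVec x h - uVec x₀ h = ∫ y in Ioc x₀ x, duVec y h := by
  have hint : Integrable (fun y ↦ duVec y h) (volume.restrict (Ioc x₀ x)) :=
    (uniformContinuous_duVec h).continuous.integrableOn_Ioc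
  have hv := ae_integral_eq_of_version hint (A := fun y ↦ kernelDU y h)
    h.isTest.measurable_kernelDU.aestronglyMeasurable
    (ae_of_all _ fun y ↦ (h.isTest.duVec_ae y).symm)
  refine Lp.ext ?_
  filter_upwards [hv, h.isTest.kernelU_ae x, h.isTest.kernelU_ae x₀,
    Lp.coeFn_sub (uVec x h) (uVec x₀ h)] with p e1 e2 e3 e4
  rw [e4, Pi.sub_apply, ← e2, ← e3, ← e1.2, kernelU_sub h hx]

/-! ### The covariances as convolutions -/

/-- Convolving an even kernel with the antisymmetric extension reflects the half line at `0`. For `a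
< 0` the kernel is singular at `0`, where its value does not matter. -/
theorem convolution_antisymm {a : ℝ} (ha : -1 < a) {k : ℝ → ℝ} {c : ℝ} (hk : ∀ r, k r = c * |r| ^ a)
    (h : TestSpace) (t : ℝ) : (k ⋆[ContinuousLinearMap.mul ℝ ℝ] antisymm h) t =
      ∫ r in Ioi 0, (k (t - r) - k (t + r)) * h r := by
  have hi : ∀ t, Integrable fun r ↦ k (t - r) * h r := fun t ↦ by
    refine ((integrable_abs_sub_rpow_mul ha h.continuous h.hasCompactSupport t).const_mul c).congr
      (ae_of_all _ fun r ↦ ?_)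
    beta_reduce
    rw [hk, abs_sub_comm]
    ring
  have e : ∀ r, k (-t - r) = k (t + r) := fun r ↦ by
    rw [hk, hk, ← abs_neg]
    ring_nf
  have hi1 : Integrable fun r ↦ k (t + r) * h r := by simpa only [e] using hi (-t)
  have hi2 : Integrable fun r ↦ k (t - r) * h (-r) := by
    simpa [sub_eq_add_neg] using hi1.comp_neg
  have h1 : ∫ r, k (t - r) * h (-r) = ∫ r, k (t + r) * h r := by
    rw [← integral_neg_eq_self]
    simp
  rw [convolution_eq_swap]
  simp only [ContinuousLinearMap.mul_apply', h.antisymm_eq, mul_sub]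
  rw [integral_sub (hi t) hi2, h1, ← integral_sub (hi t) hi1,
    setIntegral_eq_integral_of_forall_compl_eq_zero]
  · simp only [sub_mul]
  · intro r hr
    rw [h.eq_zero (not_lt.mp hr), mul_zero]

theorem inner_uVec_eq_convolution (h₁ h₂ : TestSpace) (x : ℝ) :
    inner ℝ (uVec x h₁) (uVec x h₂) = ∫ t in Ici (0 : ℝ), h₁ t *
      ((fun r : ℝ ↦ -√|r| / √(4 * Real.pi)) ⋆[ContinuousLinearMap.mul ℝ ℝ] antisymm h₂) t := by
  rw [h₁.isTest.inner_uVec h₂.isTest, integral_Ici_eq_integral_Ioi]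
  refine setIntegral_congr_fun measurableSet_Ioi fun t ht ↦ ?_
  rw [convolution_antisymm (a := 1 / 2) (c := -1 / √(4 * Real.pi)) (by norm_num)
    (fun r ↦ by rw [Real.sqrt_eq_rpow]; ring)]
  congr 1
  refine setIntegral_congr_fun measurableSet_Ioi fun r hr ↦ ?_
  rw [abs_of_pos (show 0 < t + r from add_pos ht hr)]
  ring

theorem inner_duVec_eq_convolution (h₁ h₂ : TestSpace) (x : ℝ) :
    inner ℝ (duVec x h₁) (duVec x h₂) = ∫ t in Ici (0 : ℝ), h₁ t *
      ((fun r : ℝ ↦ 1 / (2 * √(4 * Real.pi * |r|))) ⋆[ContinuousLinearMap.mul ℝ ℝ]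
        antisymm h₂) t := by
  obtain ⟨hi, e⟩ := h₁.isTest.inner_duVec h₂.isTest x
  rw [e, integral_prod _ hi, integral_Ici_eq_integral_Ioi]
  refine setIntegral_congr_fun measurableSet_Ioi fun t ht ↦ ?_
  have hk : ∀ r : ℝ, 1 / (2 * √(4 * Real.pi * |r|)) =
      1 / (2 * √(4 * Real.pi)) * |r| ^ (-(1 / 2) : ℝ) := fun r ↦ by
    rw [Real.sqrt_mul (by positivity), Real.rpow_neg (abs_nonneg r), ← Real.sqrt_eq_rpow]
    simp only [one_div, mul_inv, mul_assoc]
  rw [convolution_antisymm (by norm_num) hk, ← integral_const_mul]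
  refine setIntegral_congr_fun measurableSet_Ioi fun r hr ↦ ?_
  rw [hk, hk, abs_of_pos (show 0 < t + r from add_pos ht hr)]
  ring

/-! ### The Gaussian field -/

section Field

variable {Ω : Type*} [MeasurableSpace Ω] {B : ℝ → ℝ≥0 → Ω → ℝ} {P : Measure Ω}

theorem IsTest.U_eq {h : ℝ → ℝ} (hh : IsTest h) (x : ℝ) :
    U B P x h = wienerIntegralMap B P (uVec x h) := by
  rw [U, wienerIntegral, dif_pos (hh.memLp_kernelU x), hh.uVec_eq]

theorem IsTest.DU_eq {h : ℝ → ℝ} (hh : IsTest h) (x : ℝ) :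
    DU B P x h = wienerIntegralMap B P (duVec x h) := by
  rw [DU, wienerIntegral, dif_pos (hh.memLp_kernelDU x), hh.duVec_eq]

theorem pointU_eq (x : ℝ) (t : ℝ≥0) : pointU B P x t = wienerIntegralMap B P (heatVec x t) := by
  have e : (fun p : ℝ × ℝ ↦ heatKernel p.1 p.2 x t) = pointKernel x t := by
    ext p
    rw [heatKernel_eq, pointKernel]
  rw [pointU, e, wienerIntegral, dif_pos (memLp_pointKernel x t), heatVec]

theorem IsTest.noise_eq {h : ℝ → ℝ} (hh : IsTest h) {a b : ℝ} (hab : a ≤ b) :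
    noise B P a b h = wienerIntegralMap B P ((hh.memLp_noise hab).toLp _) := by
  rw [noise, wienerIntegral, dif_pos (hh.memLp_noise hab)]

/-- The elements of `L²` of the half plane that the field `∂₁ⁱU(x, h)` is the integral of. -/
def fieldVec (q : Fin 2 × ℝ × TestSpace) : Lp ℝ 2 halfPlane :=
  if q.1 = 0 then uVec q.2.1 q.2.2 else duVec q.2.1 q.2.2

theorem field_eq (q : Fin 2 × ℝ × TestSpace) :
    field B P q = wienerIntegralMap B P (fieldVec q) := by
  rw [field, fieldVec]
  split_ifs
  · exact q.2.2.isTest.U_eq _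
  · exact q.2.2.isTest.DU_eq _

theorem isGaussianProcess_field [IsProbabilityMeasure P] (hB : IsBrownianSheet B P) :
    IsGaussianProcess (field B P) P := by
  have e : field B P = fun q ω ↦ wienerIntegralMap B P (fieldVec q) ω := funext field_eq
  rw [e]
  exact hB.isIsonormal.isGaussianProcess fieldVec

theorem integral_field [IsProbabilityMeasure P] (hB : IsBrownianSheet B P)
    (q : Fin 2 × ℝ × TestSpace) : ∫ ω, field B P q ω ∂P = 0 := by
  rw [field_eq]
  exact hB.isIsonormal.integral_eq_zero _

/-- A process given by Wiener integrals of a uniformly continuous family has a measurable version.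
-/
theorem exists_isMeasurableVersion [IsProbabilityMeasure P] (x₀ : ℝ) {X : ℝ → Ω → ℝ}
    {F : ℝ → Lp ℝ 2 halfPlane} (hF : UniformContinuous F)
    (hX : ∀ y, X y = wienerIntegralMap B P (F y)) : ∃ A, IsMeasurableVersion P x₀ X A := by
  obtain ⟨A, hA, hA'⟩ := exists_measurable_version
    ((wienerIntegralMap B P).uniformContinuous.comp hF)
  refine ⟨A, ?_, fun y _ ↦ ?_⟩
  · exact hA.comp ((measurable_subtype_coe.comp measurable_snd).prodMk measurable_fst)
  · rw [hX]
    exact hA' y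

theorem IsMeasurableVersion.measurable_max {x₀ : ℝ} {X A : ℝ → Ω → ℝ}
    (hA : IsMeasurableVersion P x₀ X A) : Measurable fun p : ℝ × Ω ↦ A (max p.1 x₀) p.2 :=
  hA.1.comp (measurable_snd.prodMk
    ((measurable_fst.max measurable_const).subtype_mk (h := fun p : ℝ × Ω ↦ le_max_right p.1 x₀)))

/-- The integral in space of any measurable version is the Wiener integral of the Bochner integral.
-/
theorem IsMeasurableVersion.ae_integral_eq [IsProbabilityMeasure P] {x₀ : ℝ} {X A : ℝ → Ω → ℝ}
    (hA : IsMeasurableVersion P x₀ X A) {F : ℝ → Lp ℝ 2 halfPlane} (hF : Continuous F)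
    (hX : ∀ y, X y = wienerIntegralMap B P (F y)) {x : ℝ} (hx : x₀ ≤ x) :
    ∀ᵐ ω ∂P, IntervalIntegrable (fun y ↦ A y ω) volume x₀ x ∧
      ∫ y in x₀..x, A y ω = wienerIntegralMap B P (∫ y in Ioc x₀ x, F y) ω := by
  have hint : IntegrableOn F (Ioc x₀ x) := hF.integrableOn_Ioc
  have hint' : IntegrableOn (fun y ↦ wienerIntegralMap B P (F y)) (Ioc x₀ x) :=
    (wienerIntegralMap B P).integrable_comp hint
  have h1 := ae_integral_eq_of_version hint' (A := fun y ω ↦ A (max y x₀) ω)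
    hA.measurable_max.aestronglyMeasurable
    ((ae_restrict_iff' measurableSet_Ioc).mpr (ae_of_all _ fun y hy ↦ by
      rw [max_eq_left hy.1.le, ← hX]
      exact hA.2 y hy.1.le))
  rw [(wienerIntegralMap B P).integral_comp_comm hint] at h1
  have hcongr : ∀ ω, EqOn (fun y ↦ A (max y x₀) ω) (fun y ↦ A y ω) (Ioc x₀ x) := fun ω y hy ↦ by
    beta_reduce
    rw [max_eq_left hy.1.le]
  filter_upwards [h1] with ω hω
  refine ⟨?_, ?_⟩
  · rw [intervalIntegrable_iff_integrableOn_Ioc_of_le hx]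
    exact IntegrableOn.congr_fun hω.1 (hcongr ω) measurableSet_Ioc
  · rw [intervalIntegral.integral_of_le hx, ← hω.2]
    exact (setIntegral_congr_fun measurableSet_Ioc (hcongr ω)).symm

theorem U_eq_add_integral [IsProbabilityMeasure P] (h : TestSpace) {x₀ : ℝ} {A : ℝ → Ω → ℝ}
    (hA : IsMeasurableVersion P x₀ (fun y ↦ DU B P y h) A) {x : ℝ} (hx : x₀ ≤ x) :
    ∀ᵐ ω ∂P, IntervalIntegrable (fun y ↦ A y ω) volume x₀ x ∧
      U B P x h ω = U B P x₀ h ω + ∫ y in x₀..x, A y ω := by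
  have h1 := hA.ae_integral_eq (uniformContinuous_duVec h).continuous
    (fun y ↦ h.isTest.DU_eq y) hx
  rw [← uVec_sub h hx, map_sub] at h1
  filter_upwards [h1, Lp.coeFn_sub (wienerIntegralMap B P (uVec x h))
    (wienerIntegralMap B P (uVec x₀ h))] with ω hω e
  refine ⟨hω.1, ?_⟩
  rw [hω.2, e, Pi.sub_apply, h.isTest.U_eq, h.isTest.U_eq]
  ring

theorem DU_eq_sub_integral [IsProbabilityMeasure P] (h : TestSpace) {x₀ : ℝ} {A : ℝ → Ω → ℝ}
    (hA : IsMeasurableVersion P x₀ (fun y ↦ U B P y (deriv h)) A) {x : ℝ} (hx : x₀ ≤ x) :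
    ∀ᵐ ω ∂P, IntervalIntegrable (fun y ↦ A y ω) volume x₀ x ∧
      DU B P x h ω = DU B P x₀ h ω - (∫ y in x₀..x, A y ω) - noise B P x₀ x h ω := by
  have h1 := hA.ae_integral_eq h.isTest_deriv.uniformContinuous_uVec.continuous
    (fun y ↦ h.isTest_deriv.U_eq y) hx
  have h2 : duVec x h = duVec x₀ h - (∫ y in Ioc x₀ x, uVec y (deriv h)) -
      (h.isTest.memLp_noise hx).toLp _ := by
    have := duVec_sub h hx
    rw [sub_eq_iff_eq_add] at this
    rw [this]
    abel
  have h3 := congrArg (wienerIntegralMap B P) h2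
  rw [map_sub, map_sub] at h3
  filter_upwards [h1, Lp.coeFn_sub (wienerIntegralMap B P (duVec x₀ h) -
      wienerIntegralMap B P (∫ y in Ioc x₀ x, uVec y (deriv h)))
      (wienerIntegralMap B P ((h.isTest.memLp_noise hx).toLp _)),
    Lp.coeFn_sub (wienerIntegralMap B P (duVec x₀ h))
      (wienerIntegralMap B P (∫ y in Ioc x₀ x, uVec y (deriv h)))] with ω hω e1 e2
  refine ⟨hω.1, ?_⟩
  rw [hω.2, h.isTest.DU_eq, h.isTest.DU_eq, h.isTest.noise_eq hx, h3, e1, Pi.sub_apply, e2,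
    Pi.sub_apply]

end Field

/-! ### A continuous version of the mild solution -/

theorem norm_heatVec_compactified_sq_le {σ : ℝ} (h0 : 0 < σ) (h1 : σ ≤ 1) (x : ℝ) :
    ‖heatVec x ((1 - σ) / σ)‖ ^ 2 ≤ 1 / √σ := by
  refine (norm_heatVec_sq_le (div_nonneg (by linarith) h0.le) x).trans ?_
  rw [← Real.sqrt_one, ← Real.sqrt_div' _ h0.le, Real.sqrt_one]
  exact Real.sqrt_le_sqrt (div_le_div_of_nonneg_right (by linarith) h0.le)

/-- The heat kernel at the time `t = τ / (1 - τ)`, divided by `(1 + t)^{1/2}`. -/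
def timeVec (x τ : ℝ) : Lp ℝ 2 halfPlane := √(1 - τ) • heatVec x (τ / (1 - τ))

theorem norm_timeVec_sq_le {τ : ℝ} (h0 : 0 ≤ τ) (h1 : τ ≤ 1) (x : ℝ) :
    ‖timeVec x τ‖ ^ 2 ≤ √(1 - τ) := by
  rcases h1.eq_or_lt with rfl | h1
  · simp [timeVec]
  have h2 := norm_heatVec_compactified_sq_le (sub_pos.mpr h1) (by linarith) x
  rw [sub_sub_cancel] at h2
  rw [timeVec, norm_smul, mul_pow, Real.norm_of_nonneg (Real.sqrt_nonneg _)]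
  have h3 : 0 < √(1 - τ) := Real.sqrt_pos.mpr (sub_pos.mpr h1)
  rw [le_div_iff₀ h3] at h2
  nlinarith

/-- Hölder continuity on the compactified time axis, up to the point at infinity: the scaling factor
compensates the growth of the heat kernel in time. -/
theorem norm_timeVec_sub_time_le {τ τ' : ℝ} (h0 : 0 ≤ τ) (h : τ ≤ τ') (h1 : τ' ≤ 1) (x : ℝ) :
    ‖timeVec x τ - timeVec x τ'‖ ≤ 2 * √√(τ' - τ) := by
  rcases h1.eq_or_lt with rfl | h1
  · have h2 := Real.le_sqrt_of_sq_le (norm_timeVec_sq_le h0 h x)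
    have h3 : timeVec x 1 = 0 := by simp [timeVec]
    rw [h3, sub_zero]
    linarith [Real.sqrt_nonneg √(1 - τ)]
  have hσ' : 0 < 1 - τ' := sub_pos.mpr h1
  have hσ : 0 < 1 - τ := by linarith
  have hd : 0 ≤ τ' - τ := sub_nonneg.mpr h
  have e : timeVec x τ - timeVec x τ' = √(1 - τ') • (heatVec x (τ / (1 - τ)) -
      heatVec x (τ' / (1 - τ'))) + (√(1 - τ) - √(1 - τ')) • heatVec x (τ / (1 - τ)) := by
    rw [timeVec, timeVec]
    module
  -- The difference is split into a change of time and a change of the scaling factor.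
  have b1 : ‖√(1 - τ') • (heatVec x (τ / (1 - τ)) - heatVec x (τ' / (1 - τ')))‖ ≤
      √√(τ' - τ) := by
    refine Real.le_sqrt_of_sq_le ?_
    rw [norm_smul, mul_pow, Real.norm_of_nonneg (Real.sqrt_nonneg _), Real.sq_sqrt hσ'.le]
    have h2 := norm_heatVec_sub_time_sq_le (div_nonneg h0 hσ.le)
      (div_nonneg (h0.trans h) hσ'.le) x
    have h3 : |τ / (1 - τ) - τ' / (1 - τ')| ≤ (τ' - τ) / (1 - τ') ^ 2 := by
      rw [abs_sub_comm, div_sub_div _ _ hσ'.ne' hσ.ne',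
        show τ' * (1 - τ) - (1 - τ') * τ = τ' - τ by ring, abs_of_nonneg (by positivity)]
      exact div_le_div_of_nonneg_left hd (by positivity) (by nlinarith)
    have h4 := Real.sqrt_le_sqrt h3
    rw [Real.sqrt_div hd, Real.sqrt_sq hσ'.le] at h4
    calc (1 - τ') * ‖heatVec x (τ / (1 - τ)) - heatVec x (τ' / (1 - τ'))‖ ^ 2
        ≤ (1 - τ') * (√(τ' - τ) / (1 - τ')) := by gcongr; exact h2.trans h4
      _ = √(τ' - τ) := by field_simp
  have b2 : ‖(√(1 - τ) - √(1 - τ')) • heatVec x (τ / (1 - τ))‖ ≤ √√(τ' - τ) := by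
    refine Real.le_sqrt_of_sq_le ?_
    have h2 := norm_heatVec_compactified_sq_le hσ (by linarith) x
    rw [sub_sub_cancel] at h2
    rw [norm_smul, mul_pow, Real.norm_eq_abs, sq_abs]
    have q1 := Real.sq_sqrt hσ.le
    have q2 := Real.sq_sqrt hσ'.le
    have q3 := Real.sq_sqrt hd
    have q4 : √(1 - τ') ≤ √(1 - τ) := Real.sqrt_le_sqrt (by linarith)
    have q5 : √(τ' - τ) ≤ √(1 - τ) := Real.sqrt_le_sqrt (by linarith)
    have q6 := Real.sqrt_nonneg (1 - τ')
    have q7 := Real.sqrt_nonneg (τ' - τ)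
    have q8 : 0 < √(1 - τ) := Real.sqrt_pos.mpr hσ
    have h3 : (√(1 - τ) - √(1 - τ')) ^ 2 ≤ √(τ' - τ) * √(1 - τ) := by nlinarith
    calc (√(1 - τ) - √(1 - τ')) ^ 2 * ‖heatVec x (τ / (1 - τ))‖ ^ 2
        ≤ (√(τ' - τ) * √(1 - τ)) * (1 / √(1 - τ)) := by gcongr
      _ = √(τ' - τ) := by field_simp
  rw [e]
  linarith [norm_add_le (√(1 - τ') • (heatVec x (τ / (1 - τ)) - heatVec x (τ' / (1 - τ'))))
    ((√(1 - τ) - √(1 - τ')) • heatVec x (τ / (1 - τ)))]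

theorem norm_timeVec_sub_space_sq_le {τ : ℝ} (h0 : 0 ≤ τ) (h1 : τ ≤ 1) (x y : ℝ) :
    ‖timeVec x τ - timeVec y τ‖ ^ 2 ≤ 8 * √|x - y| := by
  rcases h1.eq_or_lt with rfl | h1
  · simp [timeVec]
  have hσ : 0 < 1 - τ := sub_pos.mpr h1
  rw [timeVec, timeVec, ← smul_sub, norm_smul, mul_pow, Real.norm_of_nonneg (Real.sqrt_nonneg _),
    Real.sq_sqrt hσ.le]
  have h2 := norm_heatVec_sub_space_sq_le (div_nonneg h0 hσ.le) x y
  rw [← Real.sqrt_eq_rpow] at h2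
  have h3 : (1 - τ) * (τ / (1 - τ)) ^ (1 / 4 : ℝ) ≤ 1 := by
    rw [Real.div_rpow h0 hσ.le, ← mul_div_assoc, div_le_one (by positivity)]
    calc (1 - τ) * τ ^ (1 / 4 : ℝ) ≤ (1 - τ) * 1 := by
          gcongr
          exact Real.rpow_le_one h0 h1.le (by norm_num)
      _ = (1 - τ) ^ (1 : ℝ) := by rw [mul_one, Real.rpow_one]
      _ ≤ (1 - τ) ^ (1 / 4 : ℝ) :=
          Real.rpow_le_rpow_of_exponent_ge hσ (by linarith) (by norm_num)
  calc (1 - τ) * ‖heatVec x (τ / (1 - τ)) - heatVec y (τ / (1 - τ))‖ ^ 2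
      ≤ (1 - τ) * (8 * (τ / (1 - τ)) ^ (1 / 4 : ℝ) * √|x - y|) := by gcongr
    _ = ((1 - τ) * (τ / (1 - τ)) ^ (1 / 4 : ℝ)) * (8 * √|x - y|) := by ring
    _ ≤ 1 * (8 * √|x - y|) := by gcongr
    _ = 8 * √|x - y| := one_mul _

open unitInterval in
/-- The heat kernel at the point `x = x₀ + ξ / (1 - ξ)` and the time `t = τ / (1 - τ)`, divided by
`(1 + (x - x₀)) (1 + t)^{1/2}`.  It is a Hölder continuous function on the closed square. -/
def compactVec (x₀ : ℝ) (p : I × I) : Lp ℝ 2 halfPlane :=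
  (1 - (p.1 : ℝ)) • timeVec (x₀ + p.1 / (1 - p.1)) p.2

/-- Hölder continuity in the compactified space variable, uniformly in time. -/
theorem norm_compact_space_le (x₀ : ℝ) {τ : ℝ} (t0 : 0 ≤ τ) (t1 : τ ≤ 1) {ξ ξ' : ℝ}
    (h0 : 0 ≤ ξ) (h : ξ ≤ ξ') (h1 : ξ' ≤ 1) :
    ‖(1 - ξ) • timeVec (x₀ + ξ / (1 - ξ)) τ - (1 - ξ') • timeVec (x₀ + ξ' / (1 - ξ')) τ‖ ≤
      4 * √√(ξ' - ξ) := by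
  have hg : ∀ x, ‖timeVec x τ‖ ≤ 1 := fun x ↦ by
    have h2 := norm_timeVec_sq_le t0 t1 x
    have h3 : √(1 - τ) ≤ 1 := Real.sqrt_le_one.mpr (by linarith)
    exact (sq_le_one_iff₀ (norm_nonneg _)).mp (h2.trans h3)
  have hd : 0 ≤ ξ' - ξ := sub_nonneg.mpr h
  have hd1 : ξ' - ξ ≤ √√(ξ' - ξ) := by
    refine Real.le_sqrt_of_sq_le (Real.le_sqrt_of_sq_le ?_)
    rw [← pow_mul]
    exact pow_le_of_le_one hd (by linarith) (by norm_num)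
  rcases h1.eq_or_lt with rfl | h1
  · rw [sub_self, zero_smul, sub_zero, norm_smul, Real.norm_of_nonneg hd]
    nlinarith [hg (x₀ + ξ / (1 - ξ)), norm_nonneg (timeVec (x₀ + ξ / (1 - ξ)) τ)]
  have hσ' : 0 < 1 - ξ' := sub_pos.mpr h1
  have hσ : 0 < 1 - ξ := by linarith
  have e : (1 - ξ) • timeVec (x₀ + ξ / (1 - ξ)) τ - (1 - ξ') • timeVec (x₀ + ξ' / (1 - ξ')) τ =
      (1 - ξ') • (timeVec (x₀ + ξ / (1 - ξ)) τ - timeVec (x₀ + ξ' / (1 - ξ')) τ) +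
        (ξ' - ξ) • timeVec (x₀ + ξ / (1 - ξ)) τ := by module
  have b1 : ‖(1 - ξ') • (timeVec (x₀ + ξ / (1 - ξ)) τ - timeVec (x₀ + ξ' / (1 - ξ')) τ)‖ ≤
      3 * √√(ξ' - ξ) := by
    rw [show (3 : ℝ) = √(3 ^ 2) from (Real.sqrt_sq (by norm_num)).symm,
      ← Real.sqrt_mul (by norm_num)]
    refine Real.le_sqrt_of_sq_le ?_
    rw [norm_smul, mul_pow, Real.norm_of_nonneg hσ'.le]
    have h2 := norm_timeVec_sub_space_sq_le t0 t1 (x₀ + ξ / (1 - ξ)) (x₀ + ξ' / (1 - ξ'))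
    have h3 : |x₀ + ξ / (1 - ξ) - (x₀ + ξ' / (1 - ξ'))| ≤ (ξ' - ξ) / (1 - ξ') ^ 2 := by
      rw [add_sub_add_left_eq_sub, abs_sub_comm, div_sub_div _ _ hσ'.ne' hσ.ne',
        show ξ' * (1 - ξ) - (1 - ξ') * ξ = ξ' - ξ by ring, abs_of_nonneg (by positivity)]
      exact div_le_div_of_nonneg_left hd (by positivity) (by nlinarith)
    have h4 := Real.sqrt_le_sqrt h3
    rw [Real.sqrt_div hd, Real.sqrt_sq hσ'.le] at h4
    calc (1 - ξ') ^ 2 * ‖timeVec (x₀ + ξ / (1 - ξ)) τ - timeVec (x₀ + ξ' / (1 - ξ')) τ‖ ^ 2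
        ≤ (1 - ξ') ^ 2 * (8 * (√(ξ' - ξ) / (1 - ξ'))) := by
          gcongr
          exact h2.trans (mul_le_mul_of_nonneg_left h4 (by norm_num))
      _ = (1 - ξ') * (8 * √(ξ' - ξ)) := by field_simp
      _ ≤ 1 * (9 * √(ξ' - ξ)) := by
          gcongr
          · linarith
          · norm_num
      _ = 3 ^ 2 * √(ξ' - ξ) := by ring
  have b2 : ‖(ξ' - ξ) • timeVec (x₀ + ξ / (1 - ξ)) τ‖ ≤ √√(ξ' - ξ) := by
    rw [norm_smul, Real.norm_of_nonneg hd]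
    nlinarith [hg (x₀ + ξ / (1 - ξ)), norm_nonneg (timeVec (x₀ + ξ / (1 - ξ)) τ)]
  rw [e]
  linarith [norm_add_le
    ((1 - ξ') • (timeVec (x₀ + ξ / (1 - ξ)) τ - timeVec (x₀ + ξ' / (1 - ξ')) τ))
    ((ξ' - ξ) • timeVec (x₀ + ξ / (1 - ξ)) τ)]

open unitInterval in
theorem norm_compactVec_sub_le (x₀ : ℝ) (p q : I × I) :
    ‖compactVec x₀ p - compactVec x₀ q‖ ≤ 6 * dist p q ^ (1 / 4 : ℝ) := by
  have hroot : ∀ {r d : ℝ}, 0 ≤ d → r ≤ d → √√r ≤ d ^ (1 / 4 : ℝ) := fun {r d} hd hrd ↦ by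
    rw [show (1 / 4 : ℝ) = 1 / 2 * (1 / 2) by norm_num, Real.rpow_mul hd, ← Real.sqrt_eq_rpow,
      ← Real.sqrt_eq_rpow]
    exact Real.sqrt_le_sqrt (Real.sqrt_le_sqrt hrd)
  have d1 : |(p.1 : ℝ) - q.1| ≤ dist p q := le_max_left (dist p.1 q.1) (dist p.2 q.2)
  have d2 : |(p.2 : ℝ) - q.2| ≤ dist p q := le_max_right (dist p.1 q.1) (dist p.2 q.2)
  have e : compactVec x₀ p - compactVec x₀ q = (compactVec x₀ p - compactVec x₀ (p.1, q.2)) +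
      (compactVec x₀ (p.1, q.2) - compactVec x₀ q) := by abel
  have b1 : ‖compactVec x₀ p - compactVec x₀ (p.1, q.2)‖ ≤ 2 * dist p q ^ (1 / 4 : ℝ) := by
    simp only [compactVec]
    have hle : ‖1 - (p.1 : ℝ)‖ ≤ 1 := by
      rw [Real.norm_of_nonneg (sub_nonneg.mpr p.1.2.2)]
      linarith [p.1.2.1]
    rw [← smul_sub, norm_smul]
    refine (mul_le_of_le_one_left (norm_nonneg _) hle).trans ?_
    rcases le_total (p.2 : ℝ) q.2 with h | h
    · refine (norm_timeVec_sub_time_le p.2.2.1 h q.2.2.2 _).trans ?_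
      rw [abs_sub_comm] at d2
      exact mul_le_mul_of_nonneg_left (hroot dist_nonneg ((le_abs_self _).trans d2)) (by norm_num)
    · rw [norm_sub_rev]
      refine (norm_timeVec_sub_time_le q.2.2.1 h p.2.2.2 _).trans ?_
      exact mul_le_mul_of_nonneg_left (hroot dist_nonneg ((le_abs_self _).trans d2)) (by norm_num)
  have b2 : ‖compactVec x₀ (p.1, q.2) - compactVec x₀ q‖ ≤ 4 * dist p q ^ (1 / 4 : ℝ) := by
    simp only [compactVec]
    rcases le_total (p.1 : ℝ) q.1 with h | h
    · refine (norm_compact_space_le x₀ q.2.2.1 q.2.2.2 p.1.2.1 h q.1.2.2).trans ?_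
      rw [abs_sub_comm] at d1
      exact mul_le_mul_of_nonneg_left (hroot dist_nonneg ((le_abs_self _).trans d1)) (by norm_num)
    · rw [norm_sub_rev]
      refine (norm_compact_space_le x₀ q.2.2.1 q.2.2.2 q.1.2.1 h p.1.2.2).trans ?_
      exact mul_le_mul_of_nonneg_left (hroot dist_nonneg ((le_abs_self _).trans d1)) (by norm_num)
  rw [e]
  linarith [norm_add_le (compactVec x₀ p - compactVec x₀ (p.1, q.2))
    (compactVec x₀ (p.1, q.2) - compactVec x₀ q)]

open unitInterval in
/-- The dyadic grid is a net of the unit square. -/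
theorem exists_finset_unitSquare (n : ℕ) : ∃ S : Finset (I × I), (S.card : ℝ) ≤ 4 ^ (n + 1) ∧
    ∀ s, ∃ t ∈ S, dist s t < (1 / 2) ^ n := by
  classical
  have hpow : (0 : ℝ) < 2 ^ n := by positivity
  let g : Fin (2 ^ n + 1) → I := fun i ↦ ⟨(i : ℝ) / 2 ^ n, by positivity, by
    rw [div_le_one hpow]
    exact_mod_cast Nat.lt_succ_iff.mp i.2⟩
  let T : Finset I := Finset.univ.image g
  have hT : T.card ≤ 2 ^ n + 1 := Finset.card_image_le.trans (by simp)
  have hnet : ∀ s : I, ∃ t ∈ T, dist s t < (1 / 2) ^ n := by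
    intro s
    have h1 : ⌊(s : ℝ) * 2 ^ n⌋₊ < 2 ^ n + 1 := by
      rw [Nat.lt_succ_iff]
      refine Nat.floor_le_of_le ?_
      push_cast
      exact mul_le_of_le_one_left hpow.le s.2.2
    refine ⟨g ⟨_, h1⟩, Finset.mem_image_of_mem _ (Finset.mem_univ _), ?_⟩
    have h2 := Nat.floor_le (mul_nonneg s.2.1 hpow.le)
    have h3 := Nat.lt_floor_add_one ((s : ℝ) * 2 ^ n)
    rw [Subtype.dist_eq, Real.dist_eq]
    change |(s : ℝ) - (⌊(s : ℝ) * 2 ^ n⌋₊ : ℝ) / 2 ^ n| < _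
    have e : (s : ℝ) - (⌊(s : ℝ) * 2 ^ n⌋₊ : ℝ) / 2 ^ n =
        ((s : ℝ) * 2 ^ n - ⌊(s : ℝ) * 2 ^ n⌋₊) / 2 ^ n := by field_simp
    rw [e, abs_of_nonneg (div_nonneg (sub_nonneg.mpr h2) hpow.le), one_div, inv_pow,
      ← one_div, div_lt_div_iff_of_pos_right hpow]
    linarith
  refine ⟨T ×ˢ T, ?_, fun s ↦ ?_⟩
  · rw [Finset.card_product]
    have h1 : (T.card : ℝ) ≤ 2 ^ (n + 1) := by
      refine (Nat.cast_le.mpr hT).trans ?_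
      push_cast
      rw [pow_succ]
      linarith [one_le_pow₀ (M₀ := ℝ) one_le_two (n := n)]
    push_cast
    calc (T.card : ℝ) * T.card ≤ 2 ^ (n + 1) * 2 ^ (n + 1) := by gcongr
      _ = 4 ^ (n + 1) := by rw [← mul_pow]; norm_num
  · obtain ⟨t1, m1, h1⟩ := hnet s.1
    obtain ⟨t2, m2, h2⟩ := hnet s.2
    exact ⟨(t1, t2), Finset.mem_product.mpr ⟨m1, m2⟩, max_lt h1 h2⟩

open unitInterval in
/-- The mild solution, rescaled and compactified, has a continuous version on the closed square with
a square integrable supremum. -/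
theorem exists_continuous_compactified {Ω : Type*} [MeasurableSpace Ω] {B : ℝ → ℝ≥0 → Ω → ℝ}
    {P : Measure Ω} [IsProbabilityMeasure P] (hB : IsBrownianSheet B P) (x₀ : ℝ) :
    ∃ X : Ω → C(I × I, ℝ), StronglyMeasurable X ∧ MemLp X 2 P ∧
      ∀ p, (fun ω ↦ X ω p) =ᵐ[P] wienerIntegralMap B P (compactVec x₀ p) :=
  exists_continuous_version hB.isIsonormal (compactVec x₀) (γ := 1 / 4) (C := 6) (D := 4)
    (by norm_num) (by norm_num) (by norm_num) (norm_compactVec_sub_le x₀) exists_finset_unitSquare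

open unitInterval

/-! ### Continuous functions as elements of `E₁` -/

/-- The homeomorphism `t ↦ t / (1 + t)` of `[0, ∞)` onto `[0, 1)`. -/
def toUnit (t : ℝ≥0) : I := ⟨t / (1 + t), by positivity, by
  rw [div_le_one (by positivity)]
  linarith⟩

theorem continuous_toUnit : Continuous toUnit := by
  refine Continuous.subtype_mk ?_ _
  exact (NNReal.continuous_coe).div (by fun_prop) fun t ↦ by positivity

theorem one_sub_toUnit (t : ℝ≥0) : 1 - (toUnit t : ℝ) = 1 / (1 + t) := by
  have : (1 + t : ℝ) ≠ 0 := by positivity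
  simp only [toUnit]
  field_simp
  ring

theorem toUnit_div (t : ℝ≥0) : (toUnit t : ℝ) / (1 - toUnit t) = t := by
  have : (1 + t : ℝ) ≠ 0 := by positivity
  rw [one_sub_toUnit]
  simp only [toUnit]
  field_simp

theorem toUnit_zero : toUnit 0 = 0 := by
  ext
  simp [toUnit]

/-- The function on `[0, ∞)` that a continuous function on the compactified time axis stands for.
Subtracting `z 0` makes it vanish at `0` for every `z`; for the mild solution `z 0` vanishes almost
surely only. -/
def density (z : C(I, ℝ)) (t : ℝ≥0) : ℝ := (z (toUnit t) - z 0) * √(1 + t)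

theorem continuous_density (z : C(I, ℝ)) : Continuous (density z) :=
  ((z.continuous.comp continuous_toUnit).sub continuous_const).mul
    (Real.continuous_sqrt.comp (by fun_prop))

theorem density_zero (z : C(I, ℝ)) : density z 0 = 0 := by
  simp [density, toUnit_zero]

theorem abs_density_le (z : C(I, ℝ)) (t : ℝ≥0) : |density z t| ≤ 2 * ‖z‖ * √(1 + t) := by
  rw [density, abs_mul, abs_of_nonneg (Real.sqrt_nonneg _)]
  gcongr
  have h1 := z.norm_coe_le_norm (toUnit t)
  have h2 := z.norm_coe_le_norm 0
  rw [Real.norm_eq_abs] at h1 h2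
  linarith [abs_sub (z (toUnit t)) (z 0)]

theorem WeightedC0.abs_le {α : ℝ} (h : WeightedC0 α) (t : ℝ≥0) :
    |h.toCont t| ≤ ‖h‖ * (1 + (t : ℝ)) ^ (-α) := by
  have h1 : ‖h.toCont t * (1 + (t : ℝ)) ^ α‖ ≤ ‖(weightMap α h).toBCF‖ :=
    (weightMap α h).toBCF.norm_coe_le_norm t
  have h2 : (0 : ℝ) < 1 + t := by positivity
  rw [norm_mul, Real.norm_eq_abs, Real.norm_of_nonneg (by positivity)] at h1
  rw [Real.rpow_neg h2.le, ← div_eq_mul_inv, le_div_iff₀ (by positivity)]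
  exact h1

theorem integrableOn_one_add_rpow {a : ℝ} (ha : a < -1) :
    IntegrableOn (fun t : ℝ ↦ (1 + t) ^ a) (Ici 0) := by
  have := integrableOn_add_rpow_Ioi_of_lt (c := 0) (m := 1) ha (by norm_num)
  simp only [add_comm _ (1 : ℝ)] at this
  exact Iff.mpr integrableOn_Ici_iff_integrableOn_Ioi this

/-- The constant `∫ (1 + t)^{1/2 - α} dt`. -/
def timeMass (α : ℝ) : ℝ := ∫ t in Ici (0 : ℝ), (1 + t) ^ (1 / 2 - α)

theorem norm_density_mul_le {α : ℝ} (z : C(I, ℝ)) (h : WeightedC0 α) {t : ℝ} (ht : 0 ≤ t) :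
    ‖density z t.toNNReal * h.toCont t.toNNReal‖ ≤
      2 * ‖z‖ * ‖h‖ * (1 + t) ^ (1 / 2 - α) := by
  have h1 := abs_density_le z t.toNNReal
  have h2 := h.abs_le t.toNNReal
  rw [Real.coe_toNNReal _ ht] at h1 h2
  rw [norm_mul, Real.norm_eq_abs, Real.norm_eq_abs, sub_eq_add_neg,
    Real.rpow_add (by linarith), ← Real.sqrt_eq_rpow]
  calc |density z t.toNNReal| * |h.toCont t.toNNReal|
      ≤ (2 * ‖z‖ * √(1 + t)) * (‖h‖ * (1 + t) ^ (-α)) := by gcongr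
    _ = _ := by ring

/-- The growth `(1 + t)^{1/2}` of the density is integrable against `C_{0,α}` for `α > 3/2`. -/
theorem integrableOn_density_mul {α : ℝ} (hα : 3 / 2 < α) (z : C(I, ℝ)) (h : WeightedC0 α) :
    IntegrableOn (fun t : ℝ ↦ density z t.toNNReal * h.toCont t.toNNReal) (Ici 0) := by
  refine ((integrableOn_one_add_rpow (a := 1 / 2 - α) (by linarith)).const_mul
    (2 * ‖z‖ * ‖h‖)).mono' ?_ ?_
  · exact (((continuous_density z).comp continuous_real_toNNReal).mul
      (h.toCont.continuous.comp continuous_real_toNNReal)).aestronglyMeasurable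
  · exact (ae_restrict_iff' measurableSet_Ici).mpr
      (ae_of_all _ fun t ht ↦ norm_density_mul_le z h ht)

theorem density_add (z z' : C(I, ℝ)) (t : ℝ≥0) :
    density (z + z') t = density z t + density z' t := by
  simp only [density, ContinuousMap.add_apply]
  ring

theorem density_smul (c : ℝ) (z : C(I, ℝ)) (t : ℝ≥0) : density (c • z) t = c * density z t := by
  simp only [density, ContinuousMap.smul_apply, smul_eq_mul]
  ring

/-- The pairing of `density z` with an element of `C_{0,α}`. -/
def pairing {α : ℝ} (hα : 3 / 2 < α) : C(I, ℝ) →L[ℝ] StrongDual ℝ (WeightedC0 α) :=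
  LinearMap.mkContinuous₂
    (LinearMap.mk₂ ℝ
      (fun z h ↦ ∫ t in Ici (0 : ℝ), density z t.toNNReal * h.toCont t.toNNReal)
      (fun z z' h ↦ by
        simp only [density_add, add_mul]
        exact integral_add (integrableOn_density_mul hα z h) (integrableOn_density_mul hα z' h))
      (fun c z h ↦ by
        simp only [density_smul, mul_assoc, smul_eq_mul]
        exact integral_const_mul _ _)
      (fun z h h' ↦ by
        rw [← integral_add (integrableOn_density_mul hα z h) (integrableOn_density_mul hα z h')]
        congr 1
        ext t
        exact mul_add _ _ _)
      (fun c z h ↦ by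
        rw [smul_eq_mul, ← integral_const_mul]
        congr 1
        ext t
        exact mul_left_comm _ _ _))
    (2 * timeMass α) fun z h ↦ by
      refine (norm_integral_le_of_norm_le (((integrableOn_one_add_rpow (a := 1 / 2 - α)
        (by linarith)).const_mul (2 * ‖z‖ * ‖h‖))) ((ae_restrict_iff' measurableSet_Ici).mpr
        (ae_of_all _ fun t ht ↦ norm_density_mul_le z h ht))).trans_eq ?_
      rw [integral_const_mul, timeMass]
      ring

theorem represents_pairing {α : ℝ} (hα : 3 / 2 < α) (z : C(I, ℝ)) :
    Represents (pairing hα z) (density z) := fun h ↦ ⟨integrableOn_density_mul hα z h, rfl⟩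

/-- The element of `E₁` given by `density z`. -/
def toE₁ {α : ℝ} (hα : 3 / 2 < α) : C(I, ℝ) →L[ℝ] E₁ α :=
  (pairing hα).codRestrict _ fun z ↦
    ⟨density z, continuous_density z, density_zero z, represents_pairing hα z⟩

theorem norm_toE₁_le {α : ℝ} (hα : 3 / 2 < α) (z : C(I, ℝ)) :
    ‖toE₁ hα z‖ ≤ ‖pairing hα‖ * ‖z‖ := (pairing hα).le_opNorm z

/-! ### The mild solution as an `E₁`-valued process -/

/-- The Borel σ-algebra of the supremum norm. -/
instance {K : Type*} [TopologicalSpace K] [CompactSpace K] : MeasurableSpace C(K, ℝ) := borel _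

instance {K : Type*} [TopologicalSpace K] [CompactSpace K] : BorelSpace C(K, ℝ) := ⟨rfl⟩

/-- From a function on the compactified quarter plane to its restriction to the line at `x`. -/
def slice (x₀ x : ℝ) (z : C(I × I, ℝ)) : C(I, ℝ) :=
  (1 + ((x - x₀).toNNReal : ℝ)) • z.curry (toUnit (x - x₀).toNNReal)

theorem slice_apply (x₀ x : ℝ) (z : C(I × I, ℝ)) (τ : I) :
    slice x₀ x z τ = (1 + ((x - x₀).toNNReal : ℝ)) * z (toUnit (x - x₀).toNNReal, τ) := rfl

theorem continuous_slice (x₀ : ℝ) : Continuous fun q : ℝ × C(I × I, ℝ) ↦ slice x₀ q.1 q.2 := by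
  have h1 : Continuous fun q : ℝ × C(I × I, ℝ) ↦ (q.1 - x₀).toNNReal := by fun_prop
  have h2 : Continuous fun q : ℝ × C(I × I, ℝ) ↦ q.2.curry (toUnit (q.1 - x₀).toNNReal) :=
    (ContinuousMap.continuous_curry.comp continuous_snd).eval (continuous_toUnit.comp h1)
  exact (continuous_const.add (NNReal.continuous_coe.comp h1)).smul h2

theorem norm_slice_le (x₀ x : ℝ) (z : C(I × I, ℝ)) :
    ‖slice x₀ x z‖ ≤ (1 + ((x - x₀).toNNReal : ℝ)) * ‖z‖ := by
  rw [slice, norm_smul, Real.norm_of_nonneg (by positivity)]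
  gcongr
  exact (ContinuousMap.norm_le _ (norm_nonneg _)).mpr fun τ ↦ z.norm_coe_le_norm _

theorem continuous_density_uncurry :
    Continuous fun q : C(I, ℝ) × ℝ≥0 ↦ density q.1 q.2 := by
  unfold density
  refine ((continuous_fst.eval (continuous_toUnit.comp continuous_snd)).sub
    (continuous_fst.eval continuous_const)).mul (Real.continuous_sqrt.comp ?_)
  fun_prop

theorem timeVec_toUnit (x : ℝ) (t : ℝ≥0) :
    √(1 + t) • timeVec x (toUnit t) = heatVec x t := by
  rw [timeVec, toUnit_div, one_sub_toUnit, smul_smul, ← Real.sqrt_mul (by positivity),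
    mul_one_div_cancel (by positivity), Real.sqrt_one, one_smul]

theorem timeVec_zero (x : ℝ) : timeVec x 0 = 0 := by
  rw [timeVec, zero_div, heatVec_of_nonpos le_rfl, smul_zero]

theorem compactVec_toUnit {x₀ x : ℝ} (hx : x₀ ≤ x) (τ : I) :
    (1 + ((x - x₀).toNNReal : ℝ)) • compactVec x₀ (toUnit (x - x₀).toNNReal, τ) = timeVec x τ := by
  rw [compactVec, toUnit_div, one_sub_toUnit, smul_smul, mul_one_div_cancel (by positivity),
    one_smul, Real.coe_toNNReal _ (sub_nonneg.mpr hx), add_sub_cancel]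

theorem shift_timeVec (z x τ : ℝ) : shift z (timeVec x τ) = timeVec (x + z) τ := by
  rw [timeVec, timeVec, map_smul, shift_heatVec]

section Solution

variable {Ω : Type*} [MeasurableSpace Ω] {B : ℝ → ℝ≥0 → Ω → ℝ} {P : Measure Ω} {x₀ : ℝ}
  {X : Ω → C(I × I, ℝ)}

theorem measurable_slice (hX : Measurable X) :
    Measurable fun p : Ω × ℝ ↦ slice x₀ p.2 (X p.1) :=
  (continuous_slice x₀).measurable.comp (measurable_snd.prodMk (hX.comp measurable_fst))

/-- The slice at `x` of the compactified solution is a version of the rescaled solution at `x`. -/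
theorem slice_ae (h : ∀ p, (fun ω ↦ X ω p) =ᵐ[P] wienerIntegralMap B P (compactVec x₀ p)) {x : ℝ}
    (hx : x₀ ≤ x) (τ : I) :
    (fun ω ↦ slice x₀ x (X ω) τ) =ᵐ[P] wienerIntegralMap B P (timeVec x τ) := by
  rw [← compactVec_toUnit hx, map_smul]
  filter_upwards [h (toUnit (x - x₀).toNNReal, τ), Lp.coeFn_smul (1 + ((x - x₀).toNNReal : ℝ))
    (wienerIntegralMap B P (compactVec x₀ (toUnit (x - x₀).toNNReal, τ)))] with ω h1 h2
  rw [slice_apply, h1, h2, Pi.smul_apply, smul_eq_mul]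

theorem density_slice_ae (h : ∀ p, (fun ω ↦ X ω p) =ᵐ[P] wienerIntegralMap B P (compactVec x₀ p))
    {x : ℝ} (hx : x₀ ≤ x) (t : ℝ≥0) : (fun ω ↦ density (slice x₀ x (X ω)) t) =ᵐ[P]
      wienerIntegralMap B P (heatVec x t) := by
  have h0 := slice_ae h hx 0
  rw [show ((0 : I) : ℝ) = 0 from rfl, timeVec_zero, map_zero] at h0
  rw [← timeVec_toUnit, map_smul]
  filter_upwards [slice_ae h hx (toUnit t), h0, Lp.coeFn_zero ℝ 2 P, Lp.coeFn_smul √(1 + t)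
    (wienerIntegralMap B P (timeVec x (toUnit t)))] with ω h1 h2 h3 h4
  rw [density, h1, h2, h3, h4, Pi.zero_apply, sub_zero, Pi.smul_apply, smul_eq_mul, mul_comm]

/-- The `E₁`-valued slice tested against `k` is the smeared solution: the pathwise time integral is
the Wiener integral of the Bochner integral of the heat kernel. -/
theorem toE₁_ofTest_ae [IsProbabilityMeasure P] {α : ℝ} (hα : 3 / 2 < α) (hX : Measurable X)
    (h : ∀ p, (fun ω ↦ X ω p) =ᵐ[P] wienerIntegralMap B P (compactVec x₀ p)) {x : ℝ}
    (hx : x₀ ≤ x) (k : TestSpace) :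
    ∀ᵐ ω ∂P, (toE₁ hα (slice x₀ x (X ω))).1 (WeightedC0.ofTest α k) = U B P x k ω := by
  have hint := (k.isTest.integrable_smul_heatVec x).integrableOn (s := Ici 0)
  have hm : Measurable fun p : ℝ × Ω ↦ density (slice x₀ x (X p.2)) p.1.toNNReal * k p.1 := by
    refine Measurable.mul ?_ (k.continuous.measurable.comp measurable_fst)
    refine continuous_density_uncurry.measurable.comp (Measurable.prodMk ?_ ?_)
    · exact (measurable_slice hX).comp (measurable_snd.prodMk measurable_const)
    · exact measurable_real_toNNReal.comp measurable_fst
  have h1 := ae_integral_eq_of_version ((wienerIntegralMap B P).integrable_comp hint)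
    (A := fun t ω ↦ density (slice x₀ x (X ω)) t.toNNReal * k t) hm.aestronglyMeasurable
    ((ae_restrict_iff' measurableSet_Ici).mpr (ae_of_all _ fun t ht ↦ by
      have h2 := density_slice_ae h hx t.toNNReal
      rw [Real.coe_toNNReal t ht] at h2
      rw [map_smul]
      filter_upwards [h2, Lp.coeFn_smul (k t) (wienerIntegralMap B P (heatVec x t))] with ω h3 h4
      rw [h3, h4, Pi.smul_apply, smul_eq_mul, mul_comm]))
  rw [(wienerIntegralMap B P).integral_comp_comm hint, integral_Ici_eq_integral_Ioi (f := fun t ↦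
    k t • heatVec x t)] at h1
  filter_upwards [h1] with ω hω
  rw [k.isTest.U_eq, uVec, ← hω.2]
  refine setIntegral_congr_fun measurableSet_Ici fun t ht ↦ ?_
  change density _ _ * k (t.toNNReal : ℝ) = _
  rw [Real.coe_toNNReal t ht]

end Solution

end HeatSPDE

namespace HeatSPDE

/-! ### Sobolev norms of negative order -/

theorem integral_inner_fourier {f g : ℝ → ℂ} (hf : Integrable f) (hg : Integrable g) :
    ∫ σ, inner ℂ (𝓕 f σ) (g σ) = ∫ t, inner ℂ (f t) (𝓕⁻ g t) := by
  simpa using! VectorFourier.integral_sesq_fourierIntegral_eq_neg_flip (innerSL ℂ)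
    (L := innerₗ ℝ) Real.continuous_fourierChar continuous_inner hf hg

theorem integral_fourier_mul {f g : ℝ → ℂ} (hf : Integrable f) (hg : Integrable g) :
    ∫ σ, 𝓕 f σ * g σ = ∫ t, f t * 𝓕 g t := by
  simpa using! VectorFourier.integral_fourierIntegral_smul_eq_flip
    (L := innerₗ ℝ) Real.continuous_fourierChar continuous_inner hf hg

theorem norm_fourier_le (f : ℝ → ℂ) (σ : ℝ) : ‖𝓕 f σ‖ ≤ ∫ t, ‖f t‖ :=
  VectorFourier.norm_fourierIntegral_le_integral_norm _ _ _ _ _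

theorem continuous_fourier_of_integrable {f : ℝ → ℂ} (hf : Integrable f) : Continuous (𝓕 f) :=
  VectorFourier.fourierIntegral_continuous Real.continuous_fourierChar
    (by exact continuous_inner) hf

/-- The Fourier transform of the heat kernel. -/
def gaussFourier (v σ : ℝ) : ℝ := Real.exp (-v * (2 * Real.pi * σ) ^ 2)

theorem continuous_gaussFourier (v : ℝ) : Continuous (gaussFourier v) := by
  unfold gaussFourier
  fun_prop

theorem integrable_gaussFourier {v : ℝ} (hv : 0 < v) : Integrable (gaussFourier v) := by
  have h := integrable_exp_neg_mul_sq (b := v * (2 * Real.pi) ^ 2) (by positivity)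
  refine h.congr (ae_of_all _ fun σ ↦ ?_)
  simp only [gaussFourier]
  congr 1
  ring

/-- The inverse Fourier transform of a Gaussian, written as the Fourier transform of a modulated
Gaussian. -/
theorem fourier_gaussFourier_mul {v : ℝ} (hv : 0 < v) (t' t : ℝ) :
    𝓕 (fun σ : ℝ ↦ Complex.exp (2 * Real.pi * σ * t' * Complex.I) * gaussFourier v σ) t =
      (gauss v (t' - t) : ℂ) := by
  have hb : 0 < v * (2 * Real.pi) ^ 2 := by positivity
  have h1 := fourierIntegral_gaussian (b := ((v * (2 * Real.pi) ^ 2 : ℝ) : ℂ))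
    (by rwa [Complex.ofReal_re]) ((2 * Real.pi * (t' - t) : ℝ) : ℂ)
  have e1 : ∀ σ : ℝ, Complex.exp (((-2 * Real.pi * σ * t : ℝ) : ℂ) * Complex.I) •
      (Complex.exp (2 * Real.pi * σ * t' * Complex.I) * (gaussFourier v σ : ℂ)) =
      Complex.exp (Complex.I * ((2 * Real.pi * (t' - t) : ℝ) : ℂ) * σ) *
        Complex.exp (-((v * (2 * Real.pi) ^ 2 : ℝ) : ℂ) * σ ^ 2) := fun σ ↦ by
    rw [smul_eq_mul, ← mul_assoc, ← Complex.exp_add, gaussFourier, Complex.ofReal_exp]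
    push_cast
    congr 2 <;> ring
  rw [Real.fourier_real_eq_integral_exp_smul]
  simp only [e1]
  rw [h1, gauss_of_pos hv]
  have e2 : ((Real.pi : ℂ) / ((v * (2 * Real.pi) ^ 2 : ℝ) : ℂ)) ^ (1 / 2 : ℂ) =
      ((1 / √(4 * Real.pi * v) : ℝ) : ℂ) := by
    rw [← Complex.ofReal_div, show (1 / 2 : ℂ) = ((1 / 2 : ℝ) : ℂ) by norm_num,
      ← Complex.ofReal_cpow (by positivity), ← Real.sqrt_eq_rpow, ← Real.sqrt_one,
      ← Real.sqrt_div (by norm_num)]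
    congr 2
    have := Real.pi_pos
    field_simp
    ring
  have e3 : -((2 * Real.pi * (t' - t) : ℝ) : ℂ) ^ 2 / (4 * ((v * (2 * Real.pi) ^ 2 : ℝ) : ℂ)) =
      ((-(t' - t) ^ 2 / (4 * v) : ℝ) : ℂ) := by
    have h3 : -(2 * Real.pi * (t' - t)) ^ 2 / (4 * (v * (2 * Real.pi) ^ 2)) =
        -(t' - t) ^ 2 / (4 * v) := by
      have := Real.pi_pos
      field_simp
    rw [← h3]
    push_cast
    ring
  rw [e2, e3, ← Complex.ofReal_exp, ← Complex.ofReal_mul]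

theorem integrable_fourier_mul_gaussFourier {f : ℝ → ℂ} (hf : Integrable f) {v : ℝ} (hv : 0 < v) :
    Integrable fun σ ↦ 𝓕 f σ * (gaussFourier v σ : ℂ) :=
  (integrable_gaussFourier hv).ofReal.bdd_mul
    (continuous_fourier_of_integrable hf).aestronglyMeasurable
    (ae_of_all _ fun σ ↦ norm_fourier_le f σ)

theorem fourierInv_fourier_mul_gaussFourier {f : ℝ → ℂ} (hf : Integrable f) {v : ℝ} (hv : 0 < v)
    (t' : ℝ) : 𝓕⁻ (fun σ ↦ 𝓕 f σ * (gaussFourier v σ : ℂ)) t' = ∫ t, f t * gauss v (t' - t) := by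
  have hg : Integrable fun σ : ℝ ↦
      Complex.exp (2 * Real.pi * σ * t' * Complex.I) * gaussFourier v σ := by
    refine (integrable_gaussFourier hv).ofReal.bdd_mul (c := 1)
      (by fun_prop : Continuous _).aestronglyMeasurable (ae_of_all _ fun σ ↦ ?_)
    have := Complex.norm_exp_ofReal_mul_I (2 * Real.pi * σ * t')
    push_cast at this
    exact this.le
  simp only [← fourier_gaussFourier_mul hv]
  rw [← integral_fourier_mul hf hg, Real.fourierInv_eq']
  congr 1
  ext σ
  simp only [smul_eq_mul, RCLike.inner_apply, conj_trivial]
  push_cast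
  ring_nf

/-- Plancherel's identity against a Gaussian: the energy of `f` for the heat kernel. -/
theorem integral_gaussFourier_mul_norm_sq {f : ℝ → ℝ} (hf : Integrable f) {v : ℝ} (hv : 0 < v) :
    ∫ σ, gaussFourier v σ * ‖𝓕 (fun t ↦ (f t : ℂ)) σ‖ ^ 2 =
      ∫ t', f t' * ∫ t, f t * gauss v (t' - t) := by
  have h1 := integral_inner_fourier hf.ofReal
    (integrable_fourier_mul_gaussFourier hf.ofReal hv)
  simp only [fourierInv_fourier_mul_gaussFourier hf.ofReal hv] at h1
  have e1 : ∀ σ, inner ℂ (𝓕 (fun t ↦ (f t : ℂ)) σ)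
      (𝓕 (fun t ↦ (f t : ℂ)) σ * (gaussFourier v σ : ℂ)) =
      ((gaussFourier v σ * ‖𝓕 (fun t ↦ (f t : ℂ)) σ‖ ^ 2 : ℝ) : ℂ) := fun σ ↦ by
    rw [mul_comm, ← smul_eq_mul, inner_smul_right, inner_self_eq_norm_sq_to_K]
    push_cast
    rfl
  have e2 : ∀ t', inner ℂ (f t' : ℂ) (∫ t, (f t : ℂ) * (gauss v (t' - t) : ℂ)) =
      ((f t' * ∫ t, f t * gauss v (t' - t) : ℝ) : ℂ) := fun t' ↦ by
    have : ∫ t, (f t : ℂ) * (gauss v (t' - t) : ℂ) = ((∫ t, f t * gauss v (t' - t) : ℝ) : ℂ) := by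
      rw [← integral_complex_ofReal]
      simp only [Complex.ofReal_mul]
    rw [this, RCLike.inner_apply]
    simp [mul_comm]
  simp only [RCLike.ofReal_eq_complex_ofReal] at h1
  simp only [e1, e2] at h1
  rw [integral_complex_ofReal, integral_complex_ofReal] at h1
  exact_mod_cast h1

theorem integrable_mul_gauss {f : ℝ → ℝ} (hf : Integrable f) (v t' : ℝ) :
    Integrable fun t ↦ f t * gauss v (t' - t) := by
  refine hf.mul_bdd (c := gauss v 0) ?_ (ae_of_all _ fun t ↦ ?_)
  · exact ((continuous_gauss v).comp (continuous_const.sub continuous_id)).aestronglyMeasurable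
  · rw [Real.norm_of_nonneg (gauss_nonneg _ _)]
    exact gauss_le_gauss_zero _ _

/-- The energy identity for functions of constant sign, with values in `[0, ∞]`. -/
theorem lintegral_gaussFourier_mul {f : ℝ → ℝ} (hf : Integrable f)
    (hpos : ∀ t t', 0 ≤ f t * f t') {v : ℝ} (hv : 0 < v) :
    ∫⁻ σ, ENNReal.ofReal (gaussFourier v σ * ‖𝓕 (fun t ↦ (f t : ℂ)) σ‖ ^ 2) =
      ∫⁻ t', ∫⁻ t, ENNReal.ofReal (f t' * f t * gauss v (t' - t)) := by
  have hc := continuous_fourier_of_integrable (f := fun t ↦ (f t : ℂ)) hf.ofReal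
  have hm : AEStronglyMeasurable (fun t' ↦ ∫ t, f t * gauss v (t' - t)) volume := by
    have h1 : AEStronglyMeasurable (fun q : ℝ × ℝ ↦ f q.2 * gauss v (q.1 - q.2))
        (volume.prod volume) := by
      refine hf.aestronglyMeasurable.comp_snd.mul ?_
      exact ((continuous_gauss v).comp (continuous_fst.sub continuous_snd)).aestronglyMeasurable
    exact h1.integral_prod_right'
  have hb : ∀ t', ‖∫ t, f t * gauss v (t' - t)‖ ≤ ∫ t, ‖f t‖ * gauss v 0 := fun t' ↦ by
    refine norm_integral_le_of_norm_le (hf.norm.mul_const _) (ae_of_all _ fun t ↦ ?_)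
    rw [norm_mul, Real.norm_of_nonneg (gauss_nonneg _ _)]
    exact mul_le_mul_of_nonneg_left (gauss_le_gauss_zero _ _) (norm_nonneg _)
  have hi : Integrable fun t' ↦ f t' * ∫ t, f t * gauss v (t' - t) :=
    hf.mul_bdd hm (ae_of_all _ hb)
  have hnn : ∀ t', 0 ≤ f t' * ∫ t, f t * gauss v (t' - t) := fun t' ↦ by
    rw [← integral_const_mul]
    refine integral_nonneg fun t ↦ ?_
    rw [← mul_assoc]
    exact mul_nonneg (hpos _ _) (gauss_nonneg _ _)
  have hi' : Integrable fun σ ↦ gaussFourier v σ * ‖𝓕 (fun t ↦ (f t : ℂ)) σ‖ ^ 2 := by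
    refine (integrable_gaussFourier hv).mul_bdd (c := (∫ t, ‖(f t : ℂ)‖) ^ 2)
      (hc.norm.pow 2).aestronglyMeasurable (ae_of_all _ fun σ ↦ ?_)
    rw [norm_pow, norm_norm]
    exact pow_le_pow_left₀ (norm_nonneg _) (norm_fourier_le _ σ) 2
  rw [← ofReal_integral_eq_lintegral_ofReal hi' (ae_of_all _ fun σ ↦ by
    unfold gaussFourier; positivity), integral_gaussFourier_mul_norm_sq hf hv,
    ofReal_integral_eq_lintegral_ofReal hi (ae_of_all _ hnn)]
  congr 1
  ext t'
  rw [← integral_const_mul, ofReal_integral_eq_lintegral_ofReal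
    ((integrable_mul_gauss hf v t').const_mul _) (ae_of_all _ fun t ↦ by
      rw [Pi.zero_apply]
      beta_reduce
      rw [← mul_assoc]
      exact mul_nonneg (hpos _ _) (gauss_nonneg _ _))]
  simp only [mul_assoc]

/-- The weight of the Gaussians in the representation of `(1 + τ²)^{-β}` as a mixture. -/
def gammaWeight (β v : ℝ) : ℝ≥0∞ :=
  ENNReal.ofReal (v ^ (β - 1) * Real.exp (-v)) / ENNReal.ofReal (Real.Gamma β)

/-- `(1 + a)^{-β} = Γ(β)⁻¹ ∫ v^{β-1} e^{-v} e^{-va} dv`. -/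
theorem lintegral_gammaWeight_mul {β : ℝ} (hβ : 0 < β) {a : ℝ} (ha : 0 ≤ a) :
    ∫⁻ v in Ioi 0, gammaWeight β v * ENNReal.ofReal (Real.exp (-v * a)) =
      ENNReal.ofReal ((1 + a) ^ (-β)) := by
  have hΓ := Real.Gamma_pos_of_pos hβ
  have h1 := Real.integral_rpow_mul_exp_neg_mul_Ioi hβ (by linarith : 0 < 1 + a)
  have hi : IntegrableOn (fun v : ℝ ↦ v ^ (β - 1) * Real.exp (-((1 + a) * v))) (Ioi 0) :=
    .of_integral_ne_zero (by rw [h1]; positivity)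
  have e : ∀ v ∈ Ioi (0 : ℝ), gammaWeight β v * ENNReal.ofReal (Real.exp (-v * a)) =
      ENNReal.ofReal (v ^ (β - 1) * Real.exp (-((1 + a) * v)) / Real.Gamma β) := fun v hv ↦ by
    have hv : 0 < v := hv
    rw [gammaWeight, ← ENNReal.ofReal_div_of_pos hΓ, ← ENNReal.ofReal_mul (by positivity)]
    congr 1
    rw [show -((1 + a) * v) = -v + -v * a by ring, Real.exp_add]
    ring
  rw [setLIntegral_congr_fun measurableSet_Ioi e, ← ofReal_integral_eq_lintegral_ofReal
    (hi.div_const _) ((ae_restrict_iff' measurableSet_Ioi).mpr (ae_of_all _ fun v hv ↦ by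
      have hv : 0 < v := hv
      simp only [Pi.zero_apply]
      positivity)), integral_div, h1, mul_div_assoc, div_self hΓ.ne', mul_one, one_div,
    Real.inv_rpow (by positivity), Real.rpow_neg (by positivity)]

theorem measurable_gammaWeight (β : ℝ) : Measurable (gammaWeight β) := by
  unfold gammaWeight
  fun_prop

/-- The Sobolev norm of order `-β` as the energy for a mixture of heat kernels. -/
theorem lintegral_sobolev_neg {f : ℝ → ℝ} (hf : Integrable f) (hpos : ∀ t t', 0 ≤ f t * f t')
    {β : ℝ} (hβ : 0 < β) :
    ∫⁻ σ, ENNReal.ofReal ((1 + (2 * Real.pi * σ) ^ 2) ^ (-β)) *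
        ‖𝓕 (fun t ↦ (f t : ℂ)) σ‖ₑ ^ 2 =
      ∫⁻ v in Ioi 0, gammaWeight β v *
        ∫⁻ t', ∫⁻ t, ENNReal.ofReal (f t' * f t * gauss v (t' - t)) := by
  have hc := continuous_fourier_of_integrable (f := fun t ↦ (f t : ℂ)) hf.ofReal
  have hg : Measurable fun q : ℝ × ℝ ↦ ENNReal.ofReal (Real.exp (-q.2 * (2 * Real.pi * q.1) ^ 2)) :=
    by fun_prop
  have hF : Measurable fun σ ↦ ‖𝓕 (fun t ↦ (f t : ℂ)) σ‖ₑ ^ 2 :=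
    hc.measurable.enorm.pow_const 2
  have e1 : ∀ σ, ENNReal.ofReal ((1 + (2 * Real.pi * σ) ^ 2) ^ (-β)) *
      ‖𝓕 (fun t ↦ (f t : ℂ)) σ‖ₑ ^ 2 = ∫⁻ v in Ioi 0, gammaWeight β v *
        ENNReal.ofReal (gaussFourier v σ * ‖𝓕 (fun t ↦ (f t : ℂ)) σ‖ ^ 2) := fun σ ↦ by
    rw [← lintegral_gammaWeight_mul hβ (sq_nonneg _), ← lintegral_mul_const]
    · refine lintegral_congr fun v ↦ ?_
      rw [ENNReal.ofReal_mul (by unfold gaussFourier; positivity),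
        ENNReal.ofReal_pow (norm_nonneg _), ofReal_norm, gaussFourier, mul_assoc]
    · exact (measurable_gammaWeight β).mul
        (hg.comp (by fun_prop : Measurable fun v : ℝ ↦ (σ, v)))
  simp only [e1]
  rw [lintegral_lintegral_swap]
  · refine setLIntegral_congr_fun measurableSet_Ioi fun v hv ↦ ?_
    rw [← lintegral_gaussFourier_mul hf hpos hv, lintegral_const_mul]
    have := continuous_gaussFourier v
    exact (ENNReal.measurable_ofReal.comp (this.mul (hc.norm.pow 2)).measurable)
  · refine Measurable.aemeasurable ?_
    refine ((measurable_gammaWeight β).comp measurable_snd).mul (ENNReal.measurable_ofReal.comp ?_)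
    refine Measurable.mul ?_ ((hc.norm.pow 2).measurable.comp measurable_fst)
    unfold gaussFourier
    fun_prop

/-! ### The derivative of the heat kernel in weighted Sobolev spaces of negative order -/

/-- For `z ≠ 0`, the derivative of the heat kernel is integrable in time: it decays like `τ^{-3/2}`.
-/
theorem integrable_dgauss_time {z : ℝ} (hz : z ≠ 0) : Integrable fun τ ↦ dgauss τ z := by
  have hm : Measurable fun τ ↦ dgauss τ z :=
    measurable_dgauss.comp (by fun_prop : Measurable fun τ : ℝ ↦ (τ, z))
  have h0 : IntegrableOn (fun τ ↦ dgauss τ z) (Iic 0) :=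
    integrableOn_zero.congr_fun (fun τ hτ ↦ (dgauss_of_nonpos hτ z).symm) measurableSet_Iic
  have h1 : IntegrableOn (fun τ ↦ dgauss τ z) (Ioc 0 1) := by
    have h2 : IntegrableOn (fun τ : ℝ ↦ τ ^ (-(3 / 4) : ℝ)) (Ioc 0 1) :=
      (intervalIntegral.intervalIntegrable_rpow' (by norm_num)).1
    refine (h2.const_mul (2 * |z| ^ (-(1 / 2) : ℝ))).mono' hm.aestronglyMeasurable
      ((ae_restrict_iff' measurableSet_Ioc).mpr (ae_of_all _ fun τ hτ ↦ ?_))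
    refine (abs_dgauss_le hτ.1 hz).trans_eq ?_
    ring
  have h2 : IntegrableOn (fun τ ↦ dgauss τ z) (Ioi 1) := by
    have h3 : IntegrableOn (fun τ : ℝ ↦ τ ^ (-(3 / 2) : ℝ)) (Ioi 1) :=
      integrableOn_Ioi_rpow_of_lt (by norm_num) one_pos
    refine (h3.const_mul |z|).mono' hm.aestronglyMeasurable
      ((ae_restrict_iff' measurableSet_Ioi).mpr (ae_of_all _ fun τ hτ ↦ ?_))
    have hτ0 : 0 < τ := one_pos.trans hτ
    have h4 := gauss_le_rpow τ z
    rw [abs_of_pos hτ0] at h4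
    rw [dgauss, norm_mul, Real.norm_of_nonneg (gauss_nonneg _ _), norm_neg, Real.norm_eq_abs,
      abs_div, abs_of_pos (by positivity : 0 < 2 * τ)]
    have h5 : τ ^ (-(3 / 2) : ℝ) = τ⁻¹ * τ ^ (-(1 / 2) : ℝ) := by
      rw [← Real.rpow_neg_one, ← Real.rpow_add hτ0]
      norm_num
    calc |z| / (2 * τ) * gauss τ z ≤ |z| / τ * τ ^ (-(1 / 2) : ℝ) := by
          refine mul_le_mul (div_le_div_of_nonneg_left (abs_nonneg z) hτ0 (by linarith)) h4
            (gauss_nonneg _ _) (by positivity)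
      _ = |z| * τ ^ (-(3 / 2) : ℝ) := by rw [h5]; ring
  have h3 := (h0.union h1).union h2
  rw [Iic_union_Ioc_eq_Iic zero_le_one, Iic_union_Ioi] at h3
  exact integrableOn_univ.mp h3

namespace Weight

variable {ε : ℝ} (w : Weight ε)

theorem one_le (t : ℝ) : 1 ≤ w.toFun t :=
  (le_add_of_nonneg_right (by positivity)).trans (w.le_toFun t)

theorem pos (t : ℝ) : 0 < w.toFun t := one_pos.trans_le (w.one_le t)

/-- The inverse of the weight is square integrable, as the weight grows faster than `|t|^{1/2}`. -/
theorem lintegral_inv_sq_lt_top (hε : 0 < ε) :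
    ∫⁻ t, ENNReal.ofReal ((w.toFun t)⁻¹ ^ 2) < ∞ := by
  set a : ℝ := 1 / 2 + ε with ha
  have ha0 : 0 ≤ a := by linarith
  have h1 : Integrable fun t : ℝ ↦ (2 ^ a) ^ 2 * (1 + ‖t‖) ^ (-(1 + 2 * ε)) :=
    (integrable_one_add_norm (by simp; linarith)).const_mul _
  have hle : ∀ t, (w.toFun t)⁻¹ ^ 2 ≤ (2 ^ a) ^ 2 * (1 + ‖t‖) ^ (-(1 + 2 * ε)) := by
    intro t
    have hp : 0 < 1 + |t| := by positivity
    have h2 : (1 + |t|) ^ a ≤ 2 ^ a * w.toFun t := by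
      refine le_trans ?_ (mul_le_mul_of_nonneg_left (w.le_toFun t) (by positivity))
      rcases le_total |t| 1 with ht | ht
      · calc (1 + |t|) ^ a ≤ 2 ^ a := Real.rpow_le_rpow hp.le (by linarith) ha0
          _ ≤ 2 ^ a * (1 + |t| ^ a) := le_mul_of_one_le_right (by positivity)
            (le_add_of_nonneg_right (by positivity))
      · calc (1 + |t|) ^ a ≤ (2 * |t|) ^ a := Real.rpow_le_rpow hp.le (by linarith) ha0
          _ = 2 ^ a * |t| ^ a := Real.mul_rpow (by norm_num) (abs_nonneg t)
          _ ≤ 2 ^ a * (1 + |t| ^ a) :=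
            mul_le_mul_of_nonneg_left (le_add_of_nonneg_left zero_le_one) (by positivity)
    have e : (1 + |t|) ^ (-(1 + 2 * ε)) = (((1 + |t|) ^ a)⁻¹) ^ 2 := by
      rw [← Real.rpow_neg hp.le, ← Real.rpow_natCast, ← Real.rpow_mul hp.le]
      congr 1
      push_cast
      rw [ha]
      ring
    rw [Real.norm_eq_abs, e, ← mul_pow]
    refine pow_le_pow_left₀ (inv_nonneg.mpr (w.pos t).le) ?_ 2
    have hq : 0 < (1 + |t|) ^ a := by positivity
    rw [← div_eq_mul_inv, le_div_iff₀ hq, inv_mul_le_iff₀ (w.pos t), mul_comm]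
    exact h2
  have h2 : Integrable fun t ↦ (w.toFun t)⁻¹ ^ 2 := by
    refine h1.mono' ?_ (ae_of_all _ fun t ↦ ?_)
    · exact ((w.smooth.continuous.inv₀ fun t ↦ (w.pos t).ne').pow 2).aestronglyMeasurable
    · rw [Real.norm_of_nonneg (sq_nonneg _)]
      exact hle t
  exact h2.lintegral_lt_top

end Weight

/-- `∂₃g(y, s; x, ·)` divided by the weight. -/
def weightedKernel {ε : ℝ} (w : Weight ε) (x : ℝ) (p : ℝ × ℝ) (t : ℝ) : ℝ :=
  pointDKernel x t p * (w.toFun t)⁻¹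

section Energy

variable {ε : ℝ} (w : Weight ε)

theorem integrable_weightedKernel {x : ℝ} {p : ℝ × ℝ} (hp : p.1 ≠ x) :
    Integrable (weightedKernel w x p) := by
  have h1 := (integrable_dgauss_time (sub_ne_zero.mpr hp.symm)).comp_sub_right p.2
  refine h1.mul_bdd (c := 1) ?_ (ae_of_all _ fun t ↦ ?_)
  · exact (w.smooth.continuous.inv₀ fun t ↦ (w.pos t).ne').aestronglyMeasurable
  · rw [Real.norm_of_nonneg (inv_nonneg.mpr (w.pos t).le)]
    exact inv_le_one_of_one_le₀ (w.one_le t)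

theorem weightedKernel_mul_nonneg (x : ℝ) (p : ℝ × ℝ) (t t' : ℝ) :
    0 ≤ weightedKernel w x p t * weightedKernel w x p t' := by
  have h1 := pointDKernel_mul_nonneg x t t' p
  have h2 := mul_nonneg (inv_nonneg.mpr (w.pos t).le) (inv_nonneg.mpr (w.pos t').le)
  have h3 := mul_nonneg h1 h2
  unfold weightedKernel
  linarith

theorem measurable_weightedKernel (x : ℝ) :
    Measurable fun q : (ℝ × ℝ) × ℝ ↦ weightedKernel w x q.1 q.2 := by
  refine Measurable.mul ?_ ?_
  · exact measurable_pointDKernel.comp (by fun_prop : Measurable fun q : (ℝ × ℝ) × ℝ ↦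
      ((x, q.2), q.1))
  · exact ((w.smooth.continuous.inv₀ fun t ↦ (w.pos t).ne').measurable).comp measurable_snd

/-- The squared norm of the weighted kernel in the Sobolev space of order `-β`, as an integral
against Gaussians. -/
def energy (β x : ℝ) (p : ℝ × ℝ) : ℝ≥0∞ :=
  ∫⁻ q : ℝ × (ℝ × ℝ), gammaWeight β q.1 * ENNReal.ofReal
    (weightedKernel w x p q.2.1 * weightedKernel w x p q.2.2 * gauss q.1 (q.2.1 - q.2.2))
    ∂(volume.restrict (Ioi 0)).prod (volume.prod volume)

theorem measurable_energy_integrand (β x : ℝ) :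
    Measurable fun r : (ℝ × ℝ) × (ℝ × (ℝ × ℝ)) ↦ gammaWeight β r.2.1 * ENNReal.ofReal
      (weightedKernel w x r.1 r.2.2.1 * weightedKernel w x r.1 r.2.2.2 *
        gauss r.2.1 (r.2.2.1 - r.2.2.2)) := by
  have h1 := measurable_weightedKernel w x
  have h2 : Measurable fun r : (ℝ × ℝ) × (ℝ × (ℝ × ℝ)) ↦ weightedKernel w x r.1 r.2.2.1 :=
    h1.comp (by fun_prop : Measurable fun r : (ℝ × ℝ) × (ℝ × (ℝ × ℝ)) ↦ (r.1, r.2.2.1))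
  have h3 : Measurable fun r : (ℝ × ℝ) × (ℝ × (ℝ × ℝ)) ↦ weightedKernel w x r.1 r.2.2.2 :=
    h1.comp (by fun_prop : Measurable fun r : (ℝ × ℝ) × (ℝ × (ℝ × ℝ)) ↦ (r.1, r.2.2.2))
  have h4 : Measurable fun r : (ℝ × ℝ) × (ℝ × (ℝ × ℝ)) ↦ gauss r.2.1 (r.2.2.1 - r.2.2.2) :=
    measurable_gauss.comp (by fun_prop : Measurable fun r : (ℝ × ℝ) × (ℝ × (ℝ × ℝ)) ↦
      (r.2.1, r.2.2.1 - r.2.2.2))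
  exact ((measurable_gammaWeight β).comp (by fun_prop)).mul
    (ENNReal.measurable_ofReal.comp ((h2.mul h3).mul h4))

/-- The energy is the squared Sobolev norm of order `-β` of the weighted kernel. -/
theorem lintegral_fourier_weightedKernel {β : ℝ} (hβ : 0 < β) {x : ℝ} {p : ℝ × ℝ} (hp : p.1 ≠ x) :
    ∫⁻ σ, ENNReal.ofReal ((1 + (2 * Real.pi * σ) ^ 2) ^ (-β)) *
      ‖𝓕 (fun t ↦ (weightedKernel w x p t : ℂ)) σ‖ₑ ^ 2 = energy w β x p := by
  have hm0 : Measurable fun q : ℝ × (ℝ × ℝ) ↦ gammaWeight β q.1 * ENNReal.ofReal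
      (weightedKernel w x p q.2.1 * weightedKernel w x p q.2.2 * gauss q.1 (q.2.1 - q.2.2)) := by
    have h1 := measurable_weightedKernel w x
    have h2 : Measurable (weightedKernel w x p) := h1.comp measurable_prodMk_left
    have h3 : Measurable fun q : ℝ × (ℝ × ℝ) ↦ gauss q.1 (q.2.1 - q.2.2) :=
      measurable_gauss.comp (by fun_prop : Measurable fun q : ℝ × (ℝ × ℝ) ↦ (q.1, q.2.1 - q.2.2))
    exact ((measurable_gammaWeight β).comp measurable_fst).mul (ENNReal.measurable_ofReal.comp
      (((h2.comp (measurable_fst.comp measurable_snd)).mul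
        (h2.comp (measurable_snd.comp measurable_snd))).mul h3))
  rw [lintegral_sobolev_neg (integrable_weightedKernel w hp) (weightedKernel_mul_nonneg w x p) hβ,
    energy, lintegral_prod _ hm0.aemeasurable]
  refine lintegral_congr fun v ↦ ?_
  have hm : Measurable fun q : ℝ × ℝ ↦ ENNReal.ofReal
      (weightedKernel w x p q.1 * weightedKernel w x p q.2 * gauss v (q.1 - q.2)) := by
    have h1 := measurable_weightedKernel w x
    have h2 : Measurable (weightedKernel w x p) := h1.comp measurable_prodMk_left
    refine ENNReal.measurable_ofReal.comp (((h2.comp measurable_fst).mul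
      (h2.comp measurable_snd)).mul ?_)
    exact (continuous_gauss v).measurable.comp (by fun_prop)
  dsimp only
  rw [lintegral_const_mul _ hm, lintegral_prod _ hm.aemeasurable]

theorem lintegral_pointDKernel_le (x : ℝ) {t t' : ℝ} (hne : t ≠ t') :
    ∫⁻ p, ENNReal.ofReal (pointDKernel x t p * pointDKernel x t' p) ∂halfPlane ≤
      ENNReal.ofReal (|t - t'| ^ (-(1 / 2) : ℝ)) := by
  by_cases ht : 0 < t ∧ 0 < t'
  · obtain ⟨hi, e⟩ := integral_pointDKernel x ht.1 ht.2 hne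
    rw [← ofReal_integral_eq_lintegral_ofReal hi
      (ae_of_all _ fun p ↦ pointDKernel_mul_nonneg _ _ _ _), e]
    refine ENNReal.ofReal_le_ofReal ?_
    have h3 : 0 ≤ (t + t') ^ (-(1 / 2) : ℝ) := Real.rpow_nonneg (by linarith [ht.1, ht.2]) _
    have h4 : 0 ≤ |t - t'| ^ (-(1 / 2) : ℝ) := by positivity
    have h5 : 1 / (2 * √(4 * Real.pi)) ≤ 1 := by
      have : 1 ≤ √(4 * Real.pi) := Real.one_le_sqrt.mpr (by linarith [Real.pi_gt_three])
      rw [div_le_one (by positivity)]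
      linarith
    have h6 : 0 ≤ 1 / (2 * √(4 * Real.pi)) := by positivity
    nlinarith [mul_nonneg h6 h3, mul_nonneg (sub_nonneg.mpr h5) h4]
  · have hpos : ∀ᵐ p ∂halfPlane, 0 < p.2 := by
      rw [halfPlane_eq_prod]
      exact Measure.quasiMeasurePreserving_snd.ae (ae_restrict_mem measurableSet_Ioi)
    have h0 : ∫⁻ p, ENNReal.ofReal (pointDKernel x t p * pointDKernel x t' p) ∂halfPlane = 0 := by
      rw [lintegral_congr_ae (g := fun _ ↦ 0), lintegral_zero]
      filter_upwards [hpos] with p hp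
      rw [not_and_or, not_lt, not_lt] at ht
      simp only [pointDKernel]
      rcases ht with ht | ht
      · rw [dgauss_of_nonpos (by linarith), zero_mul, ENNReal.ofReal_zero]
      · rw [dgauss_of_nonpos (τ := t' - p.2) (by linarith), mul_zero, ENNReal.ofReal_zero]
    rw [h0]
    exact bot_le

/-- Scaling of the Gaussian moment of order `-1/2`. -/
theorem exists_lintegral_gauss_mul_rpow : ∃ C : ℝ≥0∞, C ≠ ∞ ∧ ∀ v : ℝ, 0 < v →
    ∫⁻ r, ENNReal.ofReal (gauss v r * |r| ^ (-(1 / 2) : ℝ)) ≤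
      C * ENNReal.ofReal (v ^ (-(1 / 4) : ℝ)) := by
  set G : ℝ := Real.Gamma ((-(1 / 2) + 1) / 2) with hG
  have hG0 : 0 < G := Real.Gamma_pos_of_pos (by norm_num)
  refine ⟨ENNReal.ofReal (2 * (1 / √(4 * Real.pi) * (4 ^ (1 / 4 : ℝ) * (1 / 2) * G))),
    ENNReal.ofReal_ne_top, fun v hv ↦ ?_⟩
  let f : ℝ → ℝ := fun r ↦ 1 / √(4 * Real.pi * v) *
    (r ^ (-(1 / 2) : ℝ) * Real.exp (-(1 / (4 * v)) * r ^ (2 : ℝ)))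
  have e : ∀ r, gauss v r * |r| ^ (-(1 / 2) : ℝ) = f |r| := fun r ↦ by
    have : -r ^ 2 / (4 * v) = -(1 / (4 * v)) * |r| ^ (2 : ℝ) := by
      rw [Real.rpow_two, sq_abs]
      ring
    simp only [gauss, if_pos hv, f, this]
    ring
  have e2 : ∫ r, f |r| = 2 * (1 / √(4 * Real.pi) * (4 ^ (1 / 4 : ℝ) * (1 / 2) * G)) *
      v ^ (-(1 / 4) : ℝ) := by
    rw [integral_comp_abs, integral_const_mul, integral_rpow_mul_exp_neg_mul_rpow two_pos
      (by norm_num) (by positivity), ← hG]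
    have e3 : (1 / (4 * v)) ^ (-(-(1 / 2) + 1 : ℝ) / 2) = 4 ^ (1 / 4 : ℝ) * v ^ (1 / 4 : ℝ) := by
      rw [one_div, Real.inv_rpow (by positivity), ← Real.rpow_neg (by positivity),
        ← Real.mul_rpow (by norm_num) hv.le]
      norm_num
    have e4 : 1 / √(4 * Real.pi * v) = 1 / √(4 * Real.pi) * v ^ (-(1 / 2) : ℝ) := by
      rw [Real.sqrt_mul (by positivity), Real.rpow_neg hv.le, ← Real.sqrt_eq_rpow]
      field_simp
    have e5 : v ^ (-(1 / 4) : ℝ) = v ^ (-(1 / 2) : ℝ) * v ^ (1 / 4 : ℝ) := by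
      rw [← Real.rpow_add hv]
      norm_num
    rw [e3, e4, e5]
    ring
  have hi : Integrable fun r ↦ f |r| := by
    refine .of_integral_ne_zero ?_
    rw [e2]
    positivity
  simp only [e]
  rw [← ofReal_integral_eq_lintegral_ofReal hi (ae_of_all _ fun r ↦ ?_), e2,
    ENNReal.ofReal_mul (by positivity)]
  simp only [f, Pi.zero_apply]
  positivity

/-- The mixture of the Gaussian moments is finite at `v = 0` because `β > 1/4`. -/
theorem lintegral_gammaWeight_mul_rpow {β : ℝ} (hβ : 1 / 4 < β) :
    ∫⁻ v in Ioi 0, gammaWeight β v * ENNReal.ofReal (v ^ (-(1 / 4) : ℝ)) < ∞ := by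
  have hG : 0 < Real.Gamma β := Real.Gamma_pos_of_pos (by linarith)
  have h1 := Real.integral_rpow_mul_exp_neg_mul_Ioi (a := β - 1 / 4) (r := 1) (by linarith) one_pos
  have h2 : 0 < Real.Gamma (β - 1 / 4) := Real.Gamma_pos_of_pos (by linarith)
  have hi : IntegrableOn (fun t : ℝ ↦ t ^ (β - 1 / 4 - 1) * Real.exp (-(1 * t))) (Ioi 0) := by
    refine Integrable.of_integral_ne_zero ?_
    rw [h1]
    positivity
  have e : ∀ v ∈ Ioi (0 : ℝ), gammaWeight β v * ENNReal.ofReal (v ^ (-(1 / 4) : ℝ)) =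
      (ENNReal.ofReal (Real.Gamma β))⁻¹ *
        ENNReal.ofReal (v ^ (β - 1 / 4 - 1) * Real.exp (-(1 * v))) := by
    intro v hv
    have e1 : v ^ (β - 1 / 4 - 1) * Real.exp (-(1 * v)) =
        v ^ (β - 1) * Real.exp (-v) * v ^ (-(1 / 4) : ℝ) := by
      rw [show β - 1 / 4 - 1 = (β - 1) + -(1 / 4) by ring, Real.rpow_add hv, one_mul]
      ring
    have hv' : 0 < v := hv
    rw [e1, ENNReal.ofReal_mul (by positivity), gammaWeight, div_eq_mul_inv]
    ring
  rw [setLIntegral_congr_fun measurableSet_Ioi e, lintegral_const_mul' _ _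
    (ENNReal.inv_ne_top.mpr (by simpa using hG))]
  exact ENNReal.mul_lt_top (ENNReal.inv_lt_top.mpr (by simpa using hG)) hi.lintegral_lt_top

/-- The weighted derivative of the heat kernel has a finite total energy. Integrated over the half
plane, the product of the kernels at times `t` and `t'` is at most `|t - t'|^{-1/2}`; against the
heat kernel at time `v` this singularity gives `v^{-1/4}`, which the mixture integrates for `β >
1/4`. -/
theorem lintegral_energy_lt_top (hε : 0 < ε) {β : ℝ} (hβ : 1 / 4 < β) (x : ℝ) :
    ∫⁻ p, energy w β x p ∂halfPlane < ∞ := by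
  obtain ⟨C, hC, hC'⟩ := exists_lintegral_gauss_mul_rpow
  set θ : ℝ → ℝ≥0∞ := fun t ↦ ENNReal.ofReal ((w.toFun t)⁻¹ ^ 2) with hθ
  have hθm : Measurable θ := ENNReal.measurable_ofReal.comp
    (((w.smooth.continuous.inv₀ fun t ↦ (w.pos t).ne').pow 2).measurable)
  have hT := w.lintegral_inv_sq_lt_top hε
  let κ : ℝ → ℝ → ℝ≥0∞ := fun v r ↦ ENNReal.ofReal (gauss v r * |r| ^ (-(1 / 2) : ℝ))
  have hκm : Measurable fun q : ℝ × ℝ ↦ κ q.1 q.2 :=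
    ENNReal.measurable_ofReal.comp (measurable_gauss.mul
      ((by measurability : Measurable fun r : ℝ ↦ |r| ^ (-(1 / 2) : ℝ)).comp measurable_snd))
  have hκ' : ∀ v, Measurable (κ v) := fun v ↦ hκm.comp measurable_prodMk_left
  have hbound : ∀ q : ℝ × (ℝ × ℝ), q.2.1 ≠ q.2.2 →
      ∫⁻ p, gammaWeight β q.1 * ENNReal.ofReal (weightedKernel w x p q.2.1 *
        weightedKernel w x p q.2.2 * gauss q.1 (q.2.1 - q.2.2)) ∂halfPlane ≤
      gammaWeight β q.1 * (κ q.1 (q.2.1 - q.2.2) * (θ q.2.1 + θ q.2.2)) := by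
    intro q hq
    have hw1 := inv_nonneg.mpr (w.pos q.2.1).le
    have hw2 := inv_nonneg.mpr (w.pos q.2.2).le
    have e : ∀ p, ENNReal.ofReal (weightedKernel w x p q.2.1 *
        weightedKernel w x p q.2.2 * gauss q.1 (q.2.1 - q.2.2)) =
        ENNReal.ofReal ((w.toFun q.2.1)⁻¹ * (w.toFun q.2.2)⁻¹ * gauss q.1 (q.2.1 - q.2.2)) *
          ENNReal.ofReal (pointDKernel x q.2.1 p * pointDKernel x q.2.2 p) := fun p ↦ by
      rw [← ENNReal.ofReal_mul (mul_nonneg (mul_nonneg hw1 hw2) (gauss_nonneg _ _))]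
      congr 1
      simp only [weightedKernel]
      ring
    have hm : ∀ t, Measurable (pointDKernel x t) := fun t ↦
      measurable_pointDKernel.comp (by fun_prop : Measurable fun p : ℝ × ℝ ↦ ((x, t), p))
    simp only [e]
    rw [lintegral_const_mul, lintegral_const_mul]
    · refine mul_le_mul_right ?_ _
      refine (mul_le_mul_right (lintegral_pointDKernel_le x hq) _).trans ?_
      -- This decouples the weights, so that the integrals over `t - t'` and over one of the times
      -- factorize.
      have h1 : (w.toFun q.2.1)⁻¹ * (w.toFun q.2.2)⁻¹ ≤
          (w.toFun q.2.1)⁻¹ ^ 2 + (w.toFun q.2.2)⁻¹ ^ 2 := by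
        nlinarith [sq_nonneg ((w.toFun q.2.1)⁻¹ - (w.toFun q.2.2)⁻¹), mul_nonneg hw1 hw2]
      simp only [hθ, κ]
      rw [← ENNReal.ofReal_add (sq_nonneg _) (sq_nonneg _),
        ← ENNReal.ofReal_mul (mul_nonneg (mul_nonneg hw1 hw2) (gauss_nonneg _ _)),
        ← ENNReal.ofReal_mul (mul_nonneg (gauss_nonneg _ _) (by positivity))]
      refine ENNReal.ofReal_le_ofReal ?_
      have h2 := mul_le_mul_of_nonneg_left h1 (mul_nonneg (gauss_nonneg q.1 (q.2.1 - q.2.2))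
        (by positivity : 0 ≤ |q.2.1 - q.2.2| ^ (-(1 / 2) : ℝ)))
      linarith
    · exact ENNReal.measurable_ofReal.comp ((hm _).mul (hm _))
    · exact (ENNReal.measurable_ofReal.comp ((hm _).mul (hm _))).const_mul _
  have hne : ∀ᵐ q : ℝ × (ℝ × ℝ) ∂(volume.restrict (Ioi (0 : ℝ))).prod (volume.prod volume),
      q.2.1 ≠ q.2.2 := Measure.quasiMeasurePreserving_snd.ae ae_prod_ne
  have hκθ : ∀ v, 0 < v → ∫⁻ r : ℝ × ℝ, κ v (r.1 - r.2) * (θ r.1 + θ r.2) ≤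
      2 * (∫⁻ t, θ t) * (C * ENNReal.ofReal (v ^ (-(1 / 4) : ℝ))) := by
    intro v hv
    have hm1 : Measurable fun r : ℝ × ℝ ↦ κ v (r.1 - r.2) * θ r.1 :=
      ((hκ' v).comp (by fun_prop)).mul (hθm.comp measurable_fst)
    have hm2 : Measurable fun r : ℝ × ℝ ↦ κ v (r.1 - r.2) * θ r.2 :=
      ((hκ' v).comp (by fun_prop)).mul (hθm.comp measurable_snd)
    simp only [mul_add]
    rw [lintegral_add_left hm1, Measure.volume_eq_prod, lintegral_prod _ hm1.aemeasurable,
      lintegral_prod_symm _ hm2.aemeasurable]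
    have hκ1 : ∀ t, Measurable fun t' ↦ κ v (t - t') := fun t ↦
      (hκ' v).comp (by fun_prop : Measurable fun t' : ℝ ↦ t - t')
    have hκ2 : ∀ t, Measurable fun t' ↦ κ v (t' - t) := fun t ↦
      (hκ' v).comp (by fun_prop : Measurable fun t' : ℝ ↦ t' - t)
    have e1 : ∀ t, ∫⁻ t', κ v (t - t') * θ t = (∫⁻ r, κ v r) * θ t := fun t ↦ by
      rw [lintegral_mul_const _ (hκ1 t), lintegral_sub_left_eq_self (κ v)]
    have e2 : ∀ t, ∫⁻ t', κ v (t' - t) * θ t = (∫⁻ r, κ v r) * θ t := fun t ↦ by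
      rw [lintegral_mul_const _ (hκ2 t), lintegral_sub_right_eq_self (κ v)]
    simp only [e1, e2]
    rw [lintegral_const_mul _ hθm, ← two_mul, mul_comm (∫⁻ r, κ v r), ← mul_assoc]
    exact mul_le_mul_right (hC' v hv) _
  unfold energy
  -- By Tonelli the half plane is integrated out first.
  rw [lintegral_lintegral_swap (measurable_energy_integrand w β x).aemeasurable]
  refine (lintegral_mono_ae (hne.mono hbound)).trans_lt ?_
  have hm3 : Measurable fun q : ℝ × (ℝ × ℝ) ↦
      gammaWeight β q.1 * (κ q.1 (q.2.1 - q.2.2) * (θ q.2.1 + θ q.2.2)) := by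
    have h2 : Measurable fun q : ℝ × (ℝ × ℝ) ↦ κ q.1 (q.2.1 - q.2.2) :=
      hκm.comp (by fun_prop : Measurable fun q : ℝ × (ℝ × ℝ) ↦ (q.1, q.2.1 - q.2.2))
    have h3 : Measurable fun q : ℝ × (ℝ × ℝ) ↦ θ q.2.1 + θ q.2.2 :=
      (hθm.comp (by fun_prop)).add (hθm.comp (by fun_prop))
    exact ((measurable_gammaWeight β).comp measurable_fst).mul (h2.mul h3)
  rw [lintegral_prod _ hm3.aemeasurable]
  have h1 : ∀ v ∈ Ioi (0 : ℝ), ∫⁻ r : ℝ × ℝ, gammaWeight β v *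
      (κ v (r.1 - r.2) * (θ r.1 + θ r.2)) ∂volume.prod volume ≤
      (2 * (∫⁻ t, θ t) * C) * (gammaWeight β v * ENNReal.ofReal (v ^ (-(1 / 4) : ℝ))) := by
    intro v hv
    rw [lintegral_const_mul]
    · refine (mul_le_mul_right (hκθ v hv) _).trans_eq ?_
      ring
    · exact ((hκ' v).comp (by fun_prop)).mul
        ((hθm.comp measurable_fst).add (hθm.comp measurable_snd))
  refine (setLIntegral_mono' measurableSet_Ioi h1).trans_lt ?_
  have hm4 : Measurable fun v ↦ gammaWeight β v * ENNReal.ofReal (v ^ (-(1 / 4) : ℝ)) :=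
    (measurable_gammaWeight β).mul (by fun_prop)
  rw [lintegral_const_mul _ hm4]
  exact ENNReal.mul_lt_top (ENNReal.mul_lt_top (ENNReal.mul_lt_top (by simp) hT)
    (lt_top_iff_ne_top.mpr hC)) (lintegral_gammaWeight_mul_rpow hβ)

end Energy

/-! ### Hilbert-Schmidt operators on a dense range -/

/-- The range of a linear map into a separable inner product space contains a sequence which is
orthonormal, up to vanishing terms, and satisfies Bessel's inequality in the whole space and
Parseval's identity on the range. -/
theorem exists_parseval_range {E V : Type*} [NormedAddCommGroup E] [InnerProductSpace ℝ E]
    [SecondCountableTopology E] [AddCommGroup V] [Module ℝ V] (J : V →ₗ[ℝ] E) :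
    ∃ h : ℕ → V, (∀ x N, ∑ n ∈ Finset.range N, inner ℝ x (J (h n)) ^ 2 ≤ ‖x‖ ^ 2) ∧
      ∀ v, Tendsto (fun N ↦ ∑ n ∈ Finset.range N, inner ℝ (J v) (J (h n)) • J (h n)) atTop
        (𝓝 (J v)) := by
  -- Gram–Schmidt inside the range of `J`, where dependent vectors are turned into `0`.
  let f : ℕ → LinearMap.range J := TopologicalSpace.denseSeq _
  let e : ℕ → E := fun n ↦ (InnerProductSpace.gramSchmidtNormed ℝ f n : LinearMap.range J)
  have horth : ∀ m n, m ≠ n → inner ℝ (e m) (e n) = 0 := by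
    intro m n hmn
    by_cases hm : InnerProductSpace.gramSchmidtNormed ℝ f m = 0
    · simp [e, hm]
    by_cases hn : InnerProductSpace.gramSchmidtNormed ℝ f n = 0
    · simp [e, hn]
    exact (InnerProductSpace.gramSchmidtNormed_orthonormal' (𝕜 := ℝ) f).2 (i := ⟨m, hm⟩)
      (j := ⟨n, hn⟩) (by simpa using hmn)
  have hunit : ∀ n, inner ℝ (e n) (e n) • e n = e n := by
    intro n
    by_cases hn : InnerProductSpace.gramSchmidtNormed ℝ f n = 0
    · simp [e, hn]
    · have h1 : ‖e n‖ = 1 := (InnerProductSpace.gramSchmidtNormed_orthonormal' (𝕜 := ℝ) f).1 ⟨n, hn⟩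
      rw [real_inner_self_eq_norm_sq, h1, one_pow, one_smul]
  choose h hh using fun n ↦ (InnerProductSpace.gramSchmidtNormed ℝ f n : LinearMap.range J).2
  have hJ : ∀ n, J (h n) = e n := hh
  let Pr : ℕ → E →ₗ[ℝ] E := fun N ↦ ∑ n ∈ Finset.range N,
    LinearMap.toSpanSingleton ℝ E (e n) ∘ₗ (innerₗ E).flip (e n)
  have hPr : ∀ N x, Pr N x = ∑ n ∈ Finset.range N, inner ℝ x (e n) • e n := fun N x ↦ by
    simp [Pr, real_inner_comm]
  have hQ : ∀ N x, ‖x - Pr N x‖ ^ 2 = ‖x‖ ^ 2 - ∑ n ∈ Finset.range N, inner ℝ x (e n) ^ 2 := by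
    intro N x
    have h1 : inner ℝ x (Pr N x) = ∑ n ∈ Finset.range N, inner ℝ x (e n) ^ 2 := by
      rw [hPr, inner_sum]
      refine Finset.sum_congr rfl fun n _ ↦ ?_
      rw [inner_smul_right, sq]
    have h2 : inner ℝ (Pr N x) (Pr N x) = ∑ n ∈ Finset.range N, inner ℝ x (e n) ^ 2 := by
      rw [← h1, hPr, sum_inner, inner_sum]
      refine Finset.sum_congr rfl fun n hn ↦ ?_
      rw [inner_sum, Finset.sum_eq_single n, inner_smul_left, inner_smul_right, inner_smul_right]
      · have h3 : inner ℝ x (inner ℝ (e n) (e n) • e n) = inner ℝ x (e n) := by rw [hunit]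
        rw [inner_smul_right] at h3
        rw [mul_comm (inner ℝ x (e n)) (inner ℝ (e n) (e n)), h3]
        rfl
      · intro m _ hmn
        rw [inner_smul_left, inner_smul_right, horth n m hmn.symm]
        simp
      · exact fun hn' ↦ absurd hn hn'
    rw [@norm_sub_sq_real, h1, ← real_inner_self_eq_norm_sq (Pr N x), h2]
    ring
  have hbessel : ∀ x N, ∑ n ∈ Finset.range N, inner ℝ x (e n) ^ 2 ≤ ‖x‖ ^ 2 := fun x N ↦ by
    have := hQ N x
    have := sq_nonneg ‖x - Pr N x‖
    linarith
  have hcontr : ∀ N x, ‖x - Pr N x‖ ≤ ‖x‖ := fun N x ↦ by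
    refine abs_le_of_sq_le_sq' ?_ (norm_nonneg _) |>.2
    rw [hQ]
    have : 0 ≤ ∑ n ∈ Finset.range N, inner ℝ x (e n) ^ 2 := Finset.sum_nonneg fun _ _ ↦ sq_nonneg _
    linarith
  have hspan : ∀ y ∈ Submodule.span ℝ (range e), Tendsto (fun N ↦ y - Pr N y) atTop (𝓝 0) := by
    intro y hy
    induction hy using Submodule.span_induction with
    | mem y hy =>
      obtain ⟨m, rfl⟩ := hy
      refine tendsto_const_nhds.congr' ?_
      filter_upwards [eventually_gt_atTop m] with N hN
      rw [hPr, Finset.sum_eq_single m, hunit, sub_self]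
      · intro n _ hn
        rw [horth m n hn.symm, zero_smul]
      · exact fun hm ↦ absurd (Finset.mem_range.mpr hN) hm
    | zero => simp
    | add y z _ _ hy hz =>
      have := hy.add hz
      rw [add_zero] at this
      refine this.congr fun N ↦ ?_
      rw [map_add]
      abel
    | smul c y _ hy =>
      have := hy.const_smul c
      rw [smul_zero] at this
      refine this.congr fun N ↦ ?_
      rw [map_smul, smul_sub]
  have hdense : ∀ v, ∀ δ > 0, ∃ y ∈ Submodule.span ℝ (range e), ‖J v - y‖ < δ := by
    intro v δ hδ
    obtain ⟨m, hm⟩ := (TopologicalSpace.denseRange_denseSeq (LinearMap.range J)).exists_dist_lt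
      ⟨J v, v, rfl⟩ hδ
    refine ⟨f m, ?_, ?_⟩
    · have h1 : f m ∈ Submodule.span ℝ (range (InnerProductSpace.gramSchmidtNormed ℝ f)) := by
        rw [InnerProductSpace.span_gramSchmidtNormed_range,
          InnerProductSpace.span_gramSchmidt]
        exact Submodule.subset_span ⟨m, rfl⟩
      have h2 := Submodule.mem_map_of_mem (f := (LinearMap.range J).subtype) h1
      rw [Submodule.map_span, ← range_comp] at h2
      exact h2
    · rw [Subtype.dist_eq, dist_eq_norm] at hm
      exact hm
  refine ⟨h, by simpa only [hJ] using hbessel, fun v ↦ ?_⟩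
  simp only [hJ, ← hPr]
  rw [tendsto_iff_norm_sub_tendsto_zero, Metric.tendsto_atTop]
  intro δ hδ
  obtain ⟨y, hy, hyv⟩ := hdense v (δ / 2) (by positivity)
  obtain ⟨N₀, hN₀⟩ := Metric.tendsto_atTop.mp (hspan y hy) (δ / 2) (by positivity)
  refine ⟨N₀, fun N hN ↦ ?_⟩
  have h1 := hN₀ N hN
  rw [dist_zero_right] at h1
  rw [Real.dist_0_eq_abs, abs_norm, norm_sub_rev]
  -- The projections converge on a dense subspace, and the complementary projections are
  -- contractions.
  have h2 : J v - Pr N (J v) = (J v - y - Pr N (J v - y)) + (y - Pr N y) := by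
    rw [map_sub]
    abel
  rw [h2]
  have h3 := norm_add_le (J v - y - Pr N (J v - y)) (y - Pr N y)
  have h4 := hcontr N (J v - y)
  linarith

/-! ### Test functions in the weighted Sobolev space -/

theorem eLpNorm_two_sq {X E : Type*} [MeasurableSpace X] {μ : Measure X} [NormedAddCommGroup E]
    (f : X → E) : eLpNorm f 2 μ ^ 2 = ∫⁻ x, ‖f x‖ₑ ^ 2 ∂μ := by
  rw [eLpNorm_eq_lintegral_rpow_enorm_toReal (by norm_num) (by norm_num),
    ← ENNReal.rpow_natCast, ← ENNReal.rpow_mul]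
  norm_num

theorem enorm_sq_eq_lintegral {X E : Type*} [MeasurableSpace X] {μ : Measure X}
    [NormedAddCommGroup E] (f : Lp E 2 μ) : ‖f‖ₑ ^ 2 = ∫⁻ x, ‖f x‖ₑ ^ 2 ∂μ := by
  rw [Lp.enorm_def, eLpNorm_two_sq]

variable {ε : ℝ} (w : Weight ε) (β : ℝ)

theorem WeightedSobolev.ofTest_add (h k : TestSpace) :
    WeightedSobolev.ofTest w β (h + k) =
      WeightedSobolev.ofTest w β h + WeightedSobolev.ofTest w β k :=
  Subtype.ext (Subtype.ext (MemLp.toLp_add (TestSpace.memLp h) (TestSpace.memLp k)))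

theorem WeightedSobolev.ofTest_smul (c : ℝ) (h : TestSpace) :
    WeightedSobolev.ofTest w β (c • h) = c • WeightedSobolev.ofTest w β h :=
  Subtype.ext (Subtype.ext (MemLp.toLp_const_smul c (TestSpace.memLp h)))

/-- `h ↦ (1 + τ²)^{β/2} (w h^a)^F` on test functions. -/
def testMap : TestSpace →ₗ[ℝ] L2C where
  toFun h := WeightedSobolev.toL2 w β (WeightedSobolev.ofTest w β h)
  map_add' h k := by rw [WeightedSobolev.ofTest_add, map_add]
  map_smul' c h := by rw [WeightedSobolev.ofTest_smul, map_smul, RingHom.id_apply]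

/-- `w h^a` as a Schwartz function. -/
def weightedSchwartz (h : TestSpace) : SchwartzMap ℝ ℂ :=
  (TestSpace.weighted_smooth w h).2.toSchwartzMap (TestSpace.weighted_smooth w h).1

theorem weightedSchwartz_apply (h : TestSpace) (t : ℝ) :
    weightedSchwartz w h t = weighted w.toFun h t := rfl

/-- For test functions the Fourier transform in the definition of the Sobolev norm is the classical
one. -/
theorem testMap_ae (h : TestSpace) : testMap w β h =ᵐ[volume]
    fun σ ↦ sobolevSymbol β σ * 𝓕 (weightedSchwartz w h) σ := by
  have h1 : testMap w β h =ᵐ[volume]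
      bessel β (weightedMap w.toFun (WeightedSobolev.ofTest w β h).1) :=
    MemLp.coeFn_toLp (WeightedSobolev.ofTest w β h).2
  have h2 : weightedMap w.toFun (WeightedSobolev.ofTest w β h).1 =
      (weightedSchwartz w h).toLp 2 := by
    refine Lp.ext ?_
    refine (MemLp.coeFn_toLp (WeightedSobolev.ofTest w β h).1.2).trans ?_
    refine (weighted_ae (MemLp.coeFn_toLp (TestSpace.memLp h))).trans ?_
    exact (SchwartzMap.coeFn_toLp (weightedSchwartz w h) 2 volume).symm
  have h3 : (𝓕 ((weightedSchwartz w h).toLp 2) : L2C) = (𝓕 (weightedSchwartz w h)).toLp 2 :=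
    SchwartzMap.toLp_fourier_eq _
  filter_upwards [h1, SchwartzMap.coeFn_toLp (𝓕 (weightedSchwartz w h)) 2 volume] with σ e1 e2
  rw [e1, h2, bessel, h3, e2]

variable {β}

/-- A point of the half plane at which the weighted kernel has finite energy represents the
evaluation `h ↦ ∫ ∂₃g(y, s; x, t) h(t) dt` as an inner product. -/
theorem exists_inner_testMap_eq (hβ : 0 < β) {x : ℝ} {p : ℝ × ℝ} (hp : p.1 ≠ x) (hp2 : 0 < p.2)
    (hE : energy w β x p < ∞) :
    ∃ k : L2C, ‖k‖ₑ ^ 2 = energy w β x p ∧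
      ∀ h, inner ℝ k (testMap w β h) = kernelDU x h p := by
  have hfi : Integrable fun t ↦ (weightedKernel w x p t : ℂ) :=
    (integrable_weightedKernel w hp).ofReal
  set F : ℝ → ℂ := 𝓕 (fun t ↦ (weightedKernel w x p t : ℂ)) with hF
  have hFc : Continuous F := continuous_fourier_of_integrable hfi
  let a : ℝ → ℝ := fun σ ↦ (1 + (2 * Real.pi * σ) ^ 2) ^ (-β / 2)
  have ha : Continuous a := by
    refine Continuous.rpow_const (by fun_prop) fun σ ↦ Or.inl (by positivity)
  let k : ℝ → ℂ := fun σ ↦ (a σ : ℂ) * F σ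
  have hk : Continuous k := by fun_prop
  have hknorm : ∫⁻ σ, ‖k σ‖ₑ ^ 2 = energy w β x p := by
    rw [← lintegral_fourier_weightedKernel w hβ hp]
    refine lintegral_congr fun σ ↦ ?_
    have ha0 : 0 ≤ a σ := by positivity
    have h1 : ‖(a σ : ℂ)‖ₑ = ENNReal.ofReal (a σ) := by
      rw [← ofReal_norm, Complex.norm_of_nonneg ha0]
    rw [enorm_mul, mul_pow, h1, ← ENNReal.ofReal_pow ha0, ← Real.rpow_natCast,
      ← Real.rpow_mul (by positivity)]
    congr 4
    push_cast
    ring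
  have hkm : MemLp k 2 volume := by
    refine ⟨hk.aestronglyMeasurable, ?_⟩
    by_contra htop
    rw [not_lt, top_le_iff] at htop
    have h1 := eLpNorm_two_sq (μ := volume) k
    rw [hknorm, htop] at h1
    rw [← h1] at hE
    simp at hE
  refine ⟨hkm.toLp k, ?_, fun h ↦ ?_⟩
  · rw [Lp.enorm_toLp, eLpNorm_two_sq, hknorm]
  · set φ := weightedSchwartz w h with hφ
    have hint := L2.integrable_inner (𝕜 := ℂ) (hkm.toLp k) (testMap w β h)
    have hae : (fun σ ↦ inner ℂ ((hkm.toLp k : L2C) σ) (testMap w β h σ)) =ᵐ[volume]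
        fun σ ↦ inner ℂ (F σ) (𝓕 φ σ) := by
      filter_upwards [hkm.coeFn_toLp, testMap_ae w β h] with σ e1 e2
      rw [e1, e2]
      have h1 : ((1 + (2 * Real.pi * σ) ^ 2 : ℝ) ^ (β / 2)) * a σ = 1 := by
        rw [← Real.rpow_add (by positivity)]
        ring_nf
        exact Real.rpow_zero _
      -- The symbol and its inverse cancel, which leaves the pairing of the Fourier transforms.
      have h2 : sobolevSymbol β σ * (a σ : ℂ) = 1 := by
        rw [sobolevSymbol, ← Complex.ofReal_mul, h1, Complex.ofReal_one]
      simp only [RCLike.inner_apply, k, map_mul, Complex.conj_ofReal]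
      linear_combination (𝓕 φ σ * (starRingEnd ℂ) (F σ)) * h2
    have h1 : inner ℝ (hkm.toLp k) (testMap w β h) = (∫ σ, inner ℂ (F σ) (𝓕 φ σ)).re := by
      rw [L2.inner_def, ← integral_congr_ae hae]
      refine Eq.trans ?_ (integral_re hint)
      refine integral_congr_ae (ae_of_all _ fun σ ↦ ?_)
      simp only [Complex.inner, RCLike.inner_apply]
      rfl
    have h2 : 𝓕⁻ (⇑(𝓕 φ : SchwartzMap ℝ ℂ)) = φ := by
      rw [← SchwartzMap.fourierInv_coe, FourierTransform.fourierInv_fourier_eq]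
    have h3 := integral_inner_fourier hfi (𝓕 φ).integrable
    rw [h1, h3]
    have h4 : ∀ t, inner ℂ (weightedKernel w x p t : ℂ) (𝓕⁻ (⇑(𝓕 φ : SchwartzMap ℝ ℂ)) t) =
        ((pointDKernel x t p * antisymm h t : ℝ) : ℂ) := by
      intro t
      rw [congrFun h2 t, hφ, weightedSchwartz_apply, weighted, weightedKernel, RCLike.inner_apply,
        Complex.conj_ofReal, ← Complex.ofReal_mul]
      congr 1
      have := (w.pos t).ne'
      field_simp
    simp only [h4]
    rw [integral_complex_ofReal, kernelDU_eq]
    refine (Complex.ofReal_re _).trans ?_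
    -- The antisymmetric extension of `h` may replace `h`: the kernel vanishes at times `t ≤ p.2`,
    -- in particular at all `t ≤ 0`.
    rw [← integral_indicator measurableSet_Ioi]
    refine integral_congr_ae (ae_of_all _ fun t ↦ ?_)
    by_cases ht : 0 < t
    · simp only [indicator_of_mem (mem_Ioi.mpr ht), antisymm, if_pos ht]
    · rw [indicator_of_notMem (by simpa using ht)]
      simp only [pointDKernel]
      rw [dgauss_of_nonpos (by linarith), zero_mul]

end HeatSPDE

namespace HeatSPDE

/-! ### Random series in a dual space -/

/-- The limit in `L²` and the almost sure limit of a sequence agree. -/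
theorem ae_eq_of_tendsto_Lp {Ω : Type*} [MeasurableSpace Ω] {μ : Measure Ω} {F : ℕ → Lp ℝ 2 μ}
    {G : Lp ℝ 2 μ} (h : Tendsto F atTop (𝓝 G)) {f : Ω → ℝ}
    (hf : ∀ᵐ ω ∂μ, Tendsto (fun N ↦ F N ω) atTop (𝓝 (f ω))) : f =ᵐ[μ] G := by
  obtain ⟨ns, hns, hlim⟩ := (tendstoInMeasure_of_tendsto_Lp h).exists_seq_tendsto_ae
  filter_upwards [hf, hlim] with ω h1 h2
  exact tendsto_nhds_unique (h1.comp hns.tendsto_atTop) h2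

section DualSeries

variable {X : Type*} [NormedAddCommGroup X] [NormedSpace ℝ X]

open Classical in
/-- The functional `∑ aₙ ℓₙ` for a square summable sequence `a`, and `0` otherwise. -/
def dualSeries (ℓ : ℕ → StrongDual ℝ X) (a : ℕ → ℝ) : StrongDual ℝ X :=
  if ∑' n, ‖a n‖ₑ ^ 2 < ∞ then ∑' n, a n • ℓ n else 0

variable {ℓ : ℕ → StrongDual ℝ X} (hℓ : ∀ l N, ∑ n ∈ Finset.range N, ℓ n l ^ 2 ≤ ‖l‖ ^ 2)

include hℓ

/-- If the functionals satisfy the inequality of Bessel, their combinations are bounded by the `ℓ²`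
norm of the coefficients. -/
theorem norm_sum_smul_le (a : ℕ → ℝ) (s : Finset ℕ) :
    ‖∑ n ∈ s, a n • ℓ n‖ ^ 2 ≤ ∑ n ∈ s, a n ^ 2 := by
  have h0 : 0 ≤ ∑ n ∈ s, a n ^ 2 := Finset.sum_nonneg fun _ _ ↦ sq_nonneg _
  have h1 : ‖∑ n ∈ s, a n • ℓ n‖ ≤ √(∑ n ∈ s, a n ^ 2) := by
    refine ContinuousLinearMap.opNorm_le_bound _ (Real.sqrt_nonneg _) fun l ↦ ?_
    have h2 : ∑ n ∈ s, ℓ n l ^ 2 ≤ ‖l‖ ^ 2 := by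
      obtain ⟨N, hN⟩ := s.exists_nat_subset_range
      exact (Finset.sum_le_sum_of_subset_of_nonneg hN fun _ _ _ ↦ sq_nonneg _).trans (hℓ l N)
    have h3 : (∑ n ∈ s, a n • ℓ n) l = ∑ n ∈ s, a n * ℓ n l := by
      simp
    rw [h3]
    refine abs_le_of_sq_le_sq ?_ (by positivity)
    rw [mul_pow, Real.sq_sqrt h0]
    exact (Finset.sum_mul_sq_le_sq_mul_sq s a fun n ↦ ℓ n l).trans
      (mul_le_mul_of_nonneg_left h2 h0)
  calc ‖∑ n ∈ s, a n • ℓ n‖ ^ 2 ≤ √(∑ n ∈ s, a n ^ 2) ^ 2 := by gcongr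
    _ = _ := Real.sq_sqrt h0

theorem summable_smul {a : ℕ → ℝ} (ha : ∑' n, ‖a n‖ₑ ^ 2 < ∞) : Summable fun n ↦ a n • ℓ n := by
  have h1 : Summable fun n ↦ a n ^ 2 := by
    have h2 : Summable fun n ↦ (‖a n‖₊ ^ 2 : ℝ≥0) := by
      rw [← ENNReal.tsum_coe_ne_top_iff_summable]
      simpa [enorm] using ha.ne
    have h3 := NNReal.summable_coe.mpr h2
    simpa using h3
  rw [summable_iff_vanishing_norm] at h1 ⊢
  intro δ hδ
  obtain ⟨s, hs⟩ := h1 (δ ^ 2) (by positivity)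
  refine ⟨s, fun t ht ↦ ?_⟩
  have h2 := hs t ht
  have h3 := norm_sum_smul_le hℓ a t
  rw [Real.norm_of_nonneg (Finset.sum_nonneg fun _ _ ↦ sq_nonneg _)] at h2
  exact lt_of_pow_lt_pow_left₀ 2 hδ.le (h3.trans_lt h2)

theorem tendsto_dualSeries {a : ℕ → ℝ} (ha : ∑' n, ‖a n‖ₑ ^ 2 < ∞) :
    Tendsto (fun N ↦ ∑ n ∈ Finset.range N, a n • ℓ n) atTop (𝓝 (dualSeries ℓ a)) := by
  rw [dualSeries, if_pos ha]
  exact (summable_smul hℓ ha).hasSum.tendsto_sum_nat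

theorem enorm_dualSeries_le (a : ℕ → ℝ) : ‖dualSeries ℓ a‖ₑ ^ 2 ≤ ∑' n, ‖a n‖ₑ ^ 2 := by
  by_cases ha : ∑' n, ‖a n‖ₑ ^ 2 < ∞
  · have h1 := ((ENNReal.continuous_pow 2).tendsto _).comp (tendsto_dualSeries hℓ ha).enorm
    refine le_of_tendsto' h1 fun N ↦ ?_
    refine le_trans ?_ (ENNReal.sum_le_tsum (Finset.range N))
    have h2 := ENNReal.ofReal_le_ofReal (norm_sum_smul_le hℓ a (Finset.range N))
    rw [ENNReal.ofReal_pow (norm_nonneg _), ofReal_norm,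
      ENNReal.ofReal_sum_of_nonneg fun _ _ ↦ sq_nonneg _] at h2
    refine h2.trans_eq (Finset.sum_congr rfl fun n _ ↦ ?_)
    rw [← sq_abs, ENNReal.ofReal_pow (abs_nonneg _), ← Real.norm_eq_abs, ofReal_norm]
  · rw [not_lt, top_le_iff] at ha
    rw [ha]
    exact le_top

theorem measurable_dualSeries : Measurable (dualSeries ℓ) := by
  have hS : MeasurableSet {a : ℕ → ℝ | ∑' n, ‖a n‖ₑ ^ 2 < ∞} := by
    refine measurableSet_lt (Measurable.tsum fun n ↦ ?_) measurable_const
    exact (measurable_pi_apply n).enorm.pow_const 2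
  refine measurable_of_tendsto_metrizable (f := fun N ↦
    {a : ℕ → ℝ | ∑' n, ‖a n‖ₑ ^ 2 < ∞}.indicator fun a ↦ ∑ n ∈ Finset.range N, a n • ℓ n)
    (fun N ↦ ?_) (tendsto_pi_nhds.mpr fun a ↦ ?_)
  · refine Measurable.indicator (Continuous.measurable ?_) hS
    fun_prop
  · by_cases ha : ∑' n, ‖a n‖ₑ ^ 2 < ∞
    · refine (tendsto_dualSeries hℓ ha).congr fun N ↦ ?_
      rw [indicator_of_mem (by exact ha)]
    · rw [dualSeries, if_neg ha]
      refine tendsto_const_nhds.congr fun N ↦ ?_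
      rw [indicator_of_notMem (by exact ha)]

end DualSeries

/-! ### The `E₂`-valued version of `∂₁U` -/

variable {ε : ℝ} (w : Weight ε) {β : ℝ}

theorem ae_exists_inner_testMap_eq (hε : 0 < ε) (hβ : 1 / 4 < β) (x : ℝ) :
    ∀ᵐ p ∂halfPlane, ∃ k : L2C, ‖k‖ₑ ^ 2 = energy w β x p ∧
      ∀ h, inner ℝ k (testMap w β h) = kernelDU x h p := by
  have hpos : ∀ᵐ p ∂halfPlane, 0 < p.2 := by
    rw [halfPlane_eq_prod]
    exact Measure.quasiMeasurePreserving_snd.ae (ae_restrict_mem measurableSet_Ioi)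
  have hne : ∀ᵐ p ∂halfPlane, p.1 ≠ x := by
    rw [halfPlane_eq_prod]
    exact Measure.quasiMeasurePreserving_fst.ae (p := fun y : ℝ ↦ y ≠ x) (by simp [ae_iff])
  have hm : Measurable (energy w β x) := (measurable_energy_integrand w β x).lintegral_prod_right'
  filter_upwards [hpos, hne, ae_lt_top hm (lintegral_energy_lt_top w hε hβ x).ne] with p h1 h2 h3
  exact exists_inner_testMap_eq w (by linarith) h2 h1 h3

/-- The Hilbert–Schmidt bound: at each point of the half plane the inequality of Bessel applies to
the representative of the kernel, and the energies integrate to a finite bound. -/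
theorem sum_enorm_duVec_le (hε : 0 < ε) (hβ : 1 / 4 < β) (x : ℝ) {e : ℕ → TestSpace}
    (he : ∀ y N, ∑ n ∈ Finset.range N, inner ℝ y (testMap w β (e n)) ^ 2 ≤ ‖y‖ ^ 2) (N : ℕ) :
    ∑ n ∈ Finset.range N, ‖duVec x (e n)‖ₑ ^ 2 ≤ ∫⁻ p, energy w β x p ∂halfPlane := by
  simp only [enorm_sq_eq_lintegral]
  rw [← lintegral_finsetSum' _ fun n _ ↦ (Lp.aestronglyMeasurable _).enorm.pow_const 2]
  have h1 : ∀ᵐ p ∂halfPlane, ∀ n, duVec x (e n) p = kernelDU x (e n) p :=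
    ae_all_iff.mpr fun n ↦ (TestSpace.isTest (e n)).duVec_ae x
  refine lintegral_mono_ae ?_
  filter_upwards [h1, ae_exists_inner_testMap_eq w hε hβ x] with p h2 ⟨k, hk, hk'⟩
  have h3 := ENNReal.ofReal_le_ofReal (he k N)
  rw [ENNReal.ofReal_pow (norm_nonneg _), ofReal_norm, hk,
    ENNReal.ofReal_sum_of_nonneg fun _ _ ↦ sq_nonneg _] at h3
  refine le_trans (le_of_eq (Finset.sum_congr rfl fun n _ ↦ ?_)) h3
  rw [h2, hk', ← sq_abs, ENNReal.ofReal_pow (abs_nonneg _), ← Real.norm_eq_abs, ofReal_norm]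

/-- Up to the total energy, the map `h ↦ duVec x h` is bounded for the norm of `testMap w β h`. -/
theorem enorm_duVec_sub_sum_le (hε : 0 < ε) (hβ : 1 / 4 < β) (x : ℝ) (v : TestSpace)
    (e : ℕ → TestSpace) (c : ℕ → ℝ) (N : ℕ) :
    ‖duVec x v - ∑ n ∈ Finset.range N, c n • duVec x (e n)‖ₑ ^ 2 ≤
      (∫⁻ p, energy w β x p ∂halfPlane) *
        ‖testMap w β v - ∑ n ∈ Finset.range N, c n • testMap w β (e n)‖ₑ ^ 2 := by
  rw [enorm_sq_eq_lintegral, ← lintegral_mul_const']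
  · have h1 : ∀ᵐ p ∂halfPlane, ∀ n, duVec x (e n) p = kernelDU x (e n) p :=
      ae_all_iff.mpr fun n ↦ (TestSpace.isTest (e n)).duVec_ae x
    have h4 : ∀ᵐ p ∂halfPlane, ∀ n, (c n • duVec x (e n) : Lp ℝ 2 halfPlane) p =
        c n * duVec x (e n) p := ae_all_iff.mpr fun n ↦ Lp.coeFn_smul _ _
    refine lintegral_mono_ae ?_
    filter_upwards [h1, h4, (TestSpace.isTest v).duVec_ae x, ae_exists_inner_testMap_eq w hε hβ x,
      Lp.coeFn_sub (duVec x v) (∑ n ∈ Finset.range N, c n • duVec x (e n)),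
      Lp.coeFn_finsetSum (Finset.range N) fun n ↦ (c n • duVec x (e n) : Lp ℝ 2 halfPlane)]
      with p h2 h3 h5 ⟨k, hk, hk'⟩ h6 h7
    have h8 : (duVec x v - ∑ n ∈ Finset.range N, c n • duVec x (e n) : Lp ℝ 2 halfPlane) p =
        inner ℝ k (testMap w β v - ∑ n ∈ Finset.range N, c n • testMap w β (e n)) := by
      rw [h6, Pi.sub_apply, h7, inner_sub_right, inner_sum, hk', h5]
      simp only [Finset.sum_apply, h3, h2, inner_smul_right, hk']
    rw [h8, ← hk, ← mul_pow]
    gcongr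
    rw [← ofReal_norm, ← ofReal_norm, ← ofReal_norm, ← ENNReal.ofReal_mul (norm_nonneg _)]
    exact ENNReal.ofReal_le_ofReal (norm_inner_le_norm _ _)
  · simp

end HeatSPDE

namespace HeatSPDE

section DerivativeVersion

variable {ε : ℝ} (w : Weight ε) {β : ℝ}

/-- The functional `l ↦ ⟨(1 + τ²)^{β/2} (w l^a)^F, (1 + τ²)^{β/2} (w h^a)^F⟩`. -/
def testFunctional (β : ℝ) (h : TestSpace) : E₂ w β :=
  LinearMap.mkContinuous (((innerₗ L2C).flip (testMap w β h)) ∘ₗ WeightedSobolev.toL2 w β)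
    ‖testMap w β h‖ fun l ↦ by
      have h1 : ‖WeightedSobolev.toL2 w β l‖ = ‖l‖ := rfl
      rw [← h1, mul_comm]
      exact abs_real_inner_le_norm (WeightedSobolev.toL2 w β l) (testMap w β h)

theorem testFunctional_apply (h : TestSpace) (l : WeightedSobolev w β) :
    testFunctional w β h l = inner ℝ (WeightedSobolev.toL2 w β l) (testMap w β h) := rfl

variable {Ω : Type*} [MeasurableSpace Ω] {B : ℝ → ℝ≥0 → Ω → ℝ} {P : Measure Ω}
  [IsProbabilityMeasure P]

/-- For a Parseval sequence `e` in the range of `testMap`, the series of the functionals of `eₙ`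
with coefficients `∂₁U(y, eₙ)` is a version of `∂₁U(y, ·)` with bounded second moments. -/
theorem exists_dualSeries_version (hB : IsBrownianSheet B P) (hε : 0 < ε) (hβ : 1 / 4 < β) :
    ∃ (e : ℕ → TestSpace) (Z : ℕ → ℝ → Ω → ℝ) (C : ℝ≥0∞),
      C < ∞ ∧
      (∀ l N, ∑ n ∈ Finset.range N, testFunctional w β (e n) l ^ 2 ≤ ‖l‖ ^ 2) ∧
      (∀ n, Measurable fun p : ℝ × Ω ↦ Z n p.1 p.2) ∧
      (∀ n y, Z n y =ᵐ[P] wienerIntegralMap B P (duVec y (e n))) ∧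
      (∀ y, ∫⁻ ω, ‖dualSeries (fun n ↦ testFunctional w β (e n)) fun n ↦ Z n y ω‖ₑ ^ 2 ∂P ≤ C) ∧
      ∀ y v, ∀ᵐ ω ∂P, dualSeries (fun n ↦ testFunctional w β (e n)) (fun n ↦ Z n y ω)
        (WeightedSobolev.ofTest w β v) = DU B P y v ω := by
  have hI := hB.isIsonormal
  have : Fact ((2 : ℝ≥0∞) ≠ ∞) := ⟨by norm_num⟩
  obtain ⟨e, hbessel, hparseval⟩ := exists_parseval_range (testMap w β)
  have hℓ : ∀ l N, ∑ n ∈ Finset.range N, testFunctional w β (e n) l ^ 2 ≤ ‖l‖ ^ 2 :=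
    fun l N ↦ hbessel (WeightedSobolev.toL2 w β l) N
  choose Z hZm hZ using fun n ↦ exists_measurable_version
    ((wienerIntegralMap B P).uniformContinuous.comp (uniformContinuous_duVec (e n)))
  set C := ∫⁻ p, energy w β 0 p ∂halfPlane with hC
  have hZy : ∀ n y, Measurable (Z n y) := fun n y ↦ (hZm n).comp measurable_prodMk_left
  have hsq : ∀ y, ∫⁻ ω, ∑' n, ‖Z n y ω‖ₑ ^ 2 ∂P ≤ C := by
    intro y
    rw [lintegral_tsum fun n ↦ ((hZy n y).enorm.pow_const 2).aemeasurable]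
    refine ENNReal.tsum_le_of_sum_range_le fun N ↦ ?_
    refine le_trans (le_of_eq (Finset.sum_congr rfl fun n _ ↦ ?_))
      (sum_enorm_duVec_le w hε hβ 0 hbessel N)
    have h1 : ∫⁻ ω, ‖Z n y ω‖ₑ ^ 2 ∂P = ‖wienerIntegralMap B P (duVec y (e n))‖ₑ ^ 2 := by
      rw [enorm_sq_eq_lintegral]
      refine lintegral_congr_ae ?_
      filter_upwards [hZ n y] with ω hω
      rw [hω]
      rfl
    rw [h1, ← ofReal_norm, hI.norm_map, (e n).isTest.norm_duVec y 0, ofReal_norm]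
  refine ⟨e, Z, C, lintegral_energy_lt_top w hε hβ 0, hℓ, hZm, hZ, fun y ↦
    (lintegral_mono fun ω ↦ enorm_dualSeries_le hℓ _).trans (hsq y), fun y v ↦ ?_⟩
  have hfin : ∀ᵐ ω ∂P, ∑' n, ‖Z n y ω‖ₑ ^ 2 < ∞ := by
    refine ae_lt_top (Measurable.tsum fun n ↦ (hZy n y).enorm.pow_const 2) ?_
    exact ((hsq y).trans_lt (lintegral_energy_lt_top w hε hβ 0)).ne
  let c : ℕ → ℝ := fun n ↦ inner ℝ (testMap w β v) (testMap w β (e n))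
  -- Parseval in the range of `testMap` carries over to the kernels of `∂₁U`.
  have hlim : Tendsto (fun N ↦ ∑ n ∈ Finset.range N, c n • duVec y (e n)) atTop
      (𝓝 (duVec y v)) := by
    have h1 := (tendsto_const_nhds (x := testMap w β v)).sub (hparseval v)
    rw [sub_self] at h1
    have h2 := ((ENNReal.continuous_pow 2).tendsto _).comp h1.enorm
    have h3 := ENNReal.Tendsto.const_mul (a := ∫⁻ p, energy w β y p ∂halfPlane) h2
      (Or.inr (lintegral_energy_lt_top w hε hβ y).ne)
    have h4 : Tendsto (fun N ↦
        ‖duVec y v - ∑ n ∈ Finset.range N, c n • duVec y (e n)‖ₑ ^ 2) atTop (𝓝 0) := by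
      refine tendsto_of_tendsto_of_tendsto_of_le_of_le tendsto_const_nhds (h3.trans ?_)
        (fun _ ↦ bot_le) fun N ↦ enorm_duVec_sub_sum_le w hε hβ y v e c N
      simp
    have h5 := (ENNReal.tendsto_toReal ENNReal.zero_ne_top).comp h4
    rw [tendsto_iff_norm_sub_tendsto_zero]
    have h6 := h5.sqrt
    simp only [ENNReal.toReal_zero, Real.sqrt_zero] at h6
    refine h6.congr fun N ↦ ?_
    rw [Function.comp_apply, ENNReal.toReal_pow, toReal_enorm, Real.sqrt_sq (norm_nonneg _),
      norm_sub_rev]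
  have hlim2 := ((wienerIntegralMap B P).continuous.tendsto _).comp hlim
  have h7 : ∀ᵐ ω ∂P, ∀ n, (c n • wienerIntegralMap B P (duVec y (e n)) : Lp ℝ 2 P) ω =
      c n * wienerIntegralMap B P (duVec y (e n)) ω := ae_all_iff.mpr fun n ↦ Lp.coeFn_smul _ _
  have h8 : ∀ᵐ ω ∂P, ∀ N, (∑ n ∈ Finset.range N,
      c n • wienerIntegralMap B P (duVec y (e n)) : Lp ℝ 2 P) ω =
      (∑ n ∈ Finset.range N, ⇑(c n • wienerIntegralMap B P (duVec y (e n)) : Lp ℝ 2 P)) ω :=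
    ae_all_iff.mpr fun N ↦ Lp.coeFn_finsetSum _ _
  have h9 : ∀ᵐ ω ∂P, ∀ n, Z n y ω = wienerIntegralMap B P (duVec y (e n)) ω :=
    ae_all_iff.mpr fun n ↦ hZ n y
  rw [v.isTest.DU_eq]
  -- The partial sums converge to `∂₁U(y, v)` in `L²`, and almost surely to the pairing of the
  -- series with `v`.
  refine ae_eq_of_tendsto_Lp hlim2 ?_
  filter_upwards [hfin, h7, h8, h9] with ω hω h7 h8 h9
  have h10 := ((ContinuousLinearMap.apply ℝ ℝ (WeightedSobolev.ofTest w β v)).continuous.tendsto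
    _).comp (tendsto_dualSeries hℓ hω)
  refine h10.congr fun N ↦ ?_
  simp only [Function.comp_apply, map_sum, map_smul, h8, Finset.sum_apply, h7, ← h9,
    ContinuousLinearMap.apply_apply, smul_eq_mul, testFunctional_apply]
  exact Finset.sum_congr rfl fun n _ ↦ mul_comm _ _

end DerivativeVersion

/-! ### Stationarity -/

/-- The same measurable functional of two families of coordinates with equal Gram matrices has the
same law. -/
theorem IsIsonormal.identDistrib_comp {Ω : Type*} [MeasurableSpace Ω] {P : Measure Ω}
    [IsProbabilityMeasure P] {H : Type*} [NormedAddCommGroup H] [InnerProductSpace ℝ H]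
    {I : H →L[ℝ] Lp ℝ 2 P} (hI : IsIsonormal P I) {ι E : Type*} [Countable ι] [MeasurableSpace E]
    (J K : ι → H) (h : ∀ i j, inner ℝ (J i) (J j) = inner ℝ (K i) (K j)) {Ψ : (ι → ℝ) → E}
    (hΨ : Measurable Ψ) {X Y : Ω → E} (hX : X =ᵐ[P] fun ω ↦ Ψ fun i ↦ I (J i) ω)
    (hY : Y =ᵐ[P] fun ω ↦ Ψ fun i ↦ I (K i) ω) : IdentDistrib X Y P P := by
  have h1 := (hI.identDistrib J K h).comp hΨ
  exact ((IdentDistrib.of_ae_eq h1.aemeasurable_fst hX.symm).symm.trans h1).trans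
    (IdentDistrib.of_ae_eq h1.aemeasurable_snd hY.symm)

open unitInterval in
/-- A continuous function is a measurable function of its values on a dense sequence. -/
theorem exists_measurable_reconstruction : ∃ r : (ℕ → ℝ) → C(I, ℝ), Measurable r ∧
    ∀ z : C(I, ℝ), r (fun j ↦ z (TopologicalSpace.denseSeq I j)) = z := by
  have hc : Continuous fun (z : C(I, ℝ)) (j : ℕ) ↦ z (TopologicalSpace.denseSeq I j) := by fun_prop
  have hi : Function.Injective fun (z : C(I, ℝ)) (j : ℕ) ↦ z (TopologicalSpace.denseSeq I j) := by
    intro z z' h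
    refine DFunLike.coe_injective ?_
    exact (TopologicalSpace.denseRange_denseSeq I).equalizer z.continuous z'.continuous h
  -- An injective continuous map between Polish spaces is a measurable embedding.
  obtain ⟨r, hr, hr'⟩ := (hc.measurableEmbedding hi).exists_measurable_extend measurable_id
    fun _ ↦ ⟨0⟩
  exact ⟨r, hr, fun z ↦ congrFun hr' z⟩

end HeatSPDE

namespace HeatSPDE

open unitInterval

/-! ### The stationary process in `E₁ × E₂` -/

section Stationary

variable {Ω : Type*} [MeasurableSpace Ω] {B : ℝ → ℝ≥0 → Ω → ℝ} {P : Measure Ω}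
  [IsProbabilityMeasure P]

/-- The coordinates of the pair `(U(x, ·), ∂₁U(x, ·))`: scaled time points for the first component,
test functions for the second. -/
def coordVec (e : ℕ → TestSpace) (x : ℝ) : ℕ ⊕ ℕ → Lp ℝ 2 halfPlane :=
  Sum.elim (fun j ↦ timeVec x (TopologicalSpace.denseSeq I j)) fun n ↦ duVec x (e n)

theorem shift_coordVec (e : ℕ → TestSpace) (z x : ℝ) (s : ℕ ⊕ ℕ) :
    shift z (coordVec e x s) = coordVec e (x + z) s := by
  rcases s with j | n
  · exact shift_timeVec z x _
  · exact (e n).isTest.shift_duVec z x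

/-- The joint law of finitely many slices is invariant under translation in space: they are a fixed
measurable function of Gaussian coordinates whose Gram matrix is translation invariant. -/
theorem identDistrib_shift (hB : IsBrownianSheet B P) {x₀ : ℝ} {X : Ω → C(I × I, ℝ)}
    (hX : ∀ p, (fun ω ↦ X ω p) =ᵐ[P] wienerIntegralMap B P (compactVec x₀ p))
    {e : ℕ → TestSpace} {Z : ℕ → ℝ → Ω → ℝ}
    (hZ : ∀ n y, Z n y =ᵐ[P] wienerIntegralMap B P (duVec y (e n)))
    {E F : Type*} [MeasurableSpace E] [MeasurableSpace F] {f : C(I, ℝ) → E} (hf : Measurable f)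
    {g : (ℕ → ℝ) → F} (hg : Measurable g) (n : ℕ) (x : Fin n → ℝ) (z : ℝ)
    (hx : ∀ k, x₀ ≤ x k) (hz : 0 ≤ z) :
    IdentDistrib
      (fun ω k ↦ (f (slice x₀ (x k + z) (X ω)), g fun n ↦ Z n (x k + z) ω))
      (fun ω k ↦ (f (slice x₀ (x k) (X ω)), g fun n ↦ Z n (x k) ω)) P P := by
  obtain ⟨r, hr, hr'⟩ := exists_measurable_reconstruction
  -- The functional recovers the slice at each `x k` from its values at a dense sequence of times.
  let Ψ : (Fin n × (ℕ ⊕ ℕ) → ℝ) → Fin n → E × F := fun a k ↦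
    (f (r fun j ↦ a (k, Sum.inl j)), g fun m ↦ a (k, Sum.inr m))
  have hΨ : Measurable Ψ := by
    refine measurable_pi_lambda _ fun k ↦ Measurable.prodMk (hf.comp (hr.comp ?_)) (hg.comp ?_)
    · exact measurable_pi_lambda _ fun j ↦ measurable_pi_apply _
    · exact measurable_pi_lambda _ fun j ↦ measurable_pi_apply _
  have key : ∀ y : Fin n → ℝ, (∀ k, x₀ ≤ y k) →
      (fun ω k ↦ (f (slice x₀ (y k) (X ω)), g fun n ↦ Z n (y k) ω)) =ᵐ[P] fun ω ↦
        Ψ fun i ↦ wienerIntegralMap B P (coordVec e (y i.1) i.2) ω := by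
    intro y hy
    have h1 : ∀ᵐ ω ∂P, ∀ k j, slice x₀ (y k) (X ω) (TopologicalSpace.denseSeq I j) =
        wienerIntegralMap B P (timeVec (y k) (TopologicalSpace.denseSeq I j)) ω :=
      ae_all_iff.mpr fun k ↦ ae_all_iff.mpr fun j ↦ slice_ae hX (hy k) _
    have h2 : ∀ᵐ ω ∂P, ∀ k n, Z n (y k) ω = wienerIntegralMap B P (duVec (y k) (e n)) ω :=
      ae_all_iff.mpr fun k ↦ ae_all_iff.mpr fun n ↦ hZ n (y k)
    filter_upwards [h1, h2] with ω h1 h2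
    funext k
    simp only [Ψ, coordVec, Sum.elim_inl, Sum.elim_inr, ← h1, ← h2, hr']
  refine hB.isIsonormal.identDistrib_comp (fun i ↦ coordVec e (x i.1 + z) i.2)
    (fun i ↦ coordVec e (x i.1) i.2) (fun i j ↦ ?_) hΨ
    (key (fun k ↦ x k + z) fun k ↦ by linarith [hx k]) (key x hx)
  rw [← shift_coordVec, ← shift_coordVec, LinearIsometry.inner_map_map]

end Stationary

section Version

variable {Ω : Type*} [MeasurableSpace Ω] {B : ℝ → ℝ≥0 → Ω → ℝ} {P : Measure Ω}
  [IsProbabilityMeasure P]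

/-- The second moments of the first component are bounded locally uniformly in space. -/
theorem lintegral_enorm_toE₁_le {α : ℝ} (hα : 3 / 2 < α) (x₀ : ℝ) {X : Ω → C(I × I, ℝ)} {x y : ℝ}
    (hyx : y ≤ x) :
    ∫⁻ ω, ‖toE₁ hα (slice x₀ y (X ω))‖ₑ ^ 2 ∂P ≤
      (‖pairing hα‖ₑ * ENNReal.ofReal (1 + ((x - x₀).toNNReal : ℝ))) ^ 2 *
        eLpNorm X 2 P ^ 2 := by
  rw [eLpNorm_two_sq, ← lintegral_const_mul']
  · refine lintegral_mono fun ω ↦ ?_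
    beta_reduce
    rw [← mul_pow]
    gcongr
    rw [← ofReal_norm, ← ofReal_norm (pairing hα), ← ofReal_norm (X ω),
      ← ENNReal.ofReal_mul (norm_nonneg _), ← ENNReal.ofReal_mul (by positivity)]
    refine ENNReal.ofReal_le_ofReal ((norm_toE₁_le hα _).trans ?_)
    rw [mul_assoc]
    gcongr
    refine (norm_slice_le x₀ y (X ω)).trans ?_
    have : (y - x₀).toNNReal ≤ (x - x₀).toNNReal := Real.toNNReal_le_toNNReal (by linarith)
    gcongr
  · exact ENNReal.pow_ne_top (ENNReal.mul_ne_top (by simp) (by simp))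

/-- The pair of the slices of the continuous version and of the random series in `E₂` is a
stationary version of the field. -/
theorem exists_stationary_version (hB : IsBrownianSheet B P) (x₀ : ℝ) {α : ℝ} (hα : 3 / 2 < α)
    {ε : ℝ} (hε : 0 < ε) (w : Weight ε) {β : ℝ} (hβ : 1 / 4 < β) :
    ∃ (V₁ : ℝ → Ω → E₁ α) (V₂ : ℝ → Ω → E₂ w β),
      Measurable (fun p : Ω × ℝ ↦ (V₁ p.2 p.1, V₂ p.2 p.1)) ∧
      (∀ x, x₀ ≤ x → ∀ h : TestSpace, ∀ᵐ ω ∂P,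
        (V₁ x ω).1 (WeightedC0.ofTest α h) = U B P x h ω ∧
        V₂ x ω (WeightedSobolev.ofTest w β h) = DU B P x h ω) ∧
      (∀ (n : ℕ) (x : Fin n → ℝ) (z : ℝ), (∀ k, x₀ ≤ x k) → 0 ≤ z →
        IdentDistrib (fun ω k ↦ (V₁ (x k + z) ω, V₂ (x k + z) ω))
          (fun ω k ↦ (V₁ (x k) ω, V₂ (x k) ω)) P P) ∧
      (∀ x, x₀ < x →
        (∫⁻ ω, (∫⁻ y in Ioc x₀ x, (‖V₁ y ω‖ₑ ^ 2 + ‖V₂ y ω‖ₑ ^ 2)) ∂P) < ∞) ∧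
      ∃ u : ℝ → ℝ≥0 → Ω → ℝ,
        (∀ ω, ContinuousOn (fun p : ℝ × ℝ≥0 ↦ u p.1 p.2 ω) (Ici x₀ ×ˢ univ)) ∧
        (∀ ω x, x₀ ≤ x → u x 0 ω = 0 ∧ Represents (V₁ x ω).1 (fun t ↦ u x t ω)) ∧
        ∀ x, x₀ ≤ x → ∀ t, u x t =ᵐ[P] pointU B P x t := by
  obtain ⟨X, hXm, hX2, hX⟩ := exists_continuous_compactified hB x₀
  obtain ⟨e, Z, C, hC, hℓ, hZm, hZ, hV₂, hDU⟩ := exists_dualSeries_version w hB hε hβ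
  have hgm := measurable_dualSeries hℓ
  have hm1 : Measurable fun p : Ω × ℝ ↦ toE₁ hα (slice x₀ p.2 (X p.1)) :=
    (toE₁ hα).continuous.measurable.comp (measurable_slice hXm.measurable)
  have hm2 : Measurable fun p : Ω × ℝ ↦
      dualSeries (fun n ↦ testFunctional w β (e n)) fun n ↦ Z n p.2 p.1 :=
    hgm.comp (measurable_pi_lambda _ fun n ↦ (hZm n).comp measurable_swap)
  refine ⟨fun x ω ↦ toE₁ hα (slice x₀ x (X ω)),
    fun x ω ↦ dualSeries (fun n ↦ testFunctional w β (e n)) fun n ↦ Z n x ω,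
    hm1.prodMk hm2, fun x hx h ↦ ?_, fun n x z hx hz ↦ ?_, fun x hx ↦ ?_,
    fun x t ω ↦ density (slice x₀ x (X ω)) t, fun ω ↦ ?_, fun ω x hx ↦ ⟨density_zero _, ?_⟩,
    fun x hx t ↦ ?_⟩
  · filter_upwards [toE₁_ofTest_ae hα hXm.measurable hX hx h, hDU x h] with ω h1 h2
    exact ⟨h1, h2⟩
  · exact identDistrib_shift hB hX hZ (toE₁ hα).continuous.measurable hgm n x z hx hz
  · have hm : Measurable fun p : Ω × ℝ ↦ ‖toE₁ hα (slice x₀ p.2 (X p.1))‖ₑ ^ 2 +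
        ‖dualSeries (fun n ↦ testFunctional w β (e n)) fun n ↦ Z n p.2 p.1‖ₑ ^ 2 :=
      ((measurable_subtype_coe.comp hm1).enorm.pow_const 2).add (hm2.enorm.pow_const 2)
    rw [lintegral_lintegral_swap hm.aemeasurable]
    set D := (‖pairing hα‖ₑ * ENNReal.ofReal (1 + ((x - x₀).toNNReal : ℝ))) ^ 2 *
      eLpNorm X 2 P ^ 2 with hD
    have hD' : D < ∞ := ENNReal.mul_lt_top (ENNReal.pow_lt_top (ENNReal.mul_lt_top (by simp)
      (by simp))) (ENNReal.pow_lt_top hX2.2)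
    have h1 : ∀ y ∈ Ioc x₀ x, ∫⁻ ω, (‖toE₁ hα (slice x₀ y (X ω))‖ₑ ^ 2 +
        ‖dualSeries (fun n ↦ testFunctional w β (e n)) fun n ↦ Z n y ω‖ₑ ^ 2) ∂P ≤ D + C := by
      intro y hy
      have hm3 : Measurable fun ω ↦ ‖toE₁ hα (slice x₀ y (X ω))‖ₑ ^ 2 :=
        (measurable_subtype_coe.comp
          (hm1.comp (measurable_prodMk_right (y := y)))).enorm.pow_const 2
      rw [lintegral_add_left hm3]
      exact add_le_add (lintegral_enorm_toE₁_le hα x₀ hy.2) (hV₂ y)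
    refine (setLIntegral_mono' measurableSet_Ioc h1).trans_lt ?_
    rw [setLIntegral_const, Real.volume_Ioc]
    exact ENNReal.mul_lt_top (ENNReal.add_lt_top.mpr ⟨hD', hC⟩) ENNReal.ofReal_lt_top
  · have h1 : Continuous fun p : ℝ × ℝ≥0 ↦ slice x₀ p.1 (X ω) :=
      (continuous_slice x₀).comp (continuous_fst.prodMk continuous_const)
    exact (continuous_density_uncurry.comp (h1.prodMk continuous_snd)).continuousOn
  · exact represents_pairing hα _
  · rw [pointU_eq]
    exact density_slice_ae hX hx t

end Version

end HeatSPDE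

theorem proposition3p1 {Ω : Type*} [MeasurableSpace Ω] (P : Measure Ω) [IsProbabilityMeasure P]
    [P.IsComplete] (B : ℝ → ℝ≥0 → Ω → ℝ) (hB : HeatSPDE.IsBrownianSheet B P) (x₀ : ℝ) :
    -- the integrals defining the field exist and the field is centred Gaussian
    (HeatSPDE.IsWienerIntegral B P (HeatSPDE.wienerIntegralMap B P) ∧
      (∀ (x : ℝ) (h : HeatSPDE.TestSpace), MemLp (HeatSPDE.kernelU x h) 2 HeatSPDE.halfPlane ∧
        MemLp (HeatSPDE.kernelDU x h) 2 HeatSPDE.halfPlane) ∧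
      IsGaussianProcess (HeatSPDE.field B P) P ∧
      ∀ q, ∫ ω, HeatSPDE.field B P q ω ∂P = 0) ∧
    -- (i)
    (∀ h : HeatSPDE.TestSpace,
      (∃ A, HeatSPDE.IsMeasurableVersion P x₀ (fun y ↦ HeatSPDE.DU B P y h) A) ∧
      (∃ A, HeatSPDE.IsMeasurableVersion P x₀ (fun y ↦ HeatSPDE.U B P y (deriv h)) A) ∧
      (∀ A, HeatSPDE.IsMeasurableVersion P x₀ (fun y ↦ HeatSPDE.DU B P y h) A →
        ∀ x, x₀ ≤ x → ∀ᵐ ω ∂P, IntervalIntegrable (fun y ↦ A y ω) volume x₀ x ∧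
          HeatSPDE.U B P x h ω = HeatSPDE.U B P x₀ h ω + ∫ y in x₀..x, A y ω) ∧
      (∀ A, HeatSPDE.IsMeasurableVersion P x₀ (fun y ↦ HeatSPDE.U B P y (deriv h)) A →
        ∀ x, x₀ ≤ x → ∀ᵐ ω ∂P, IntervalIntegrable (fun y ↦ A y ω) volume x₀ x ∧
          HeatSPDE.DU B P x h ω =
            HeatSPDE.DU B P x₀ h ω - (∫ y in x₀..x, A y ω) - HeatSPDE.noise B P x₀ x h ω)) ∧
    -- (ii)
    (∀ x, x₀ ≤ x →
      IndepFun (fun ω (h : HeatSPDE.TestSpace) ↦ HeatSPDE.U B P x h ω)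
        (fun ω (h : HeatSPDE.TestSpace) ↦ HeatSPDE.DU B P x h ω) P ∧
      IsGaussianProcess (fun h : HeatSPDE.TestSpace ↦ HeatSPDE.U B P x h) P ∧
      IsGaussianProcess (fun h : HeatSPDE.TestSpace ↦ HeatSPDE.DU B P x h) P ∧
      (∀ h : HeatSPDE.TestSpace,
        ∫ ω, HeatSPDE.U B P x h ω ∂P = 0 ∧ ∫ ω, HeatSPDE.DU B P x h ω ∂P = 0) ∧
      ∀ h₁ h₂ : HeatSPDE.TestSpace,
        ∫ ω, HeatSPDE.U B P x h₁ ω * HeatSPDE.U B P x h₂ ω ∂P =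
          ∫ t in Ici (0 : ℝ), h₁ t *
            ((fun r : ℝ ↦ -√|r| / √(4 * Real.pi))
              ⋆[ContinuousLinearMap.mul ℝ ℝ] HeatSPDE.antisymm h₂) t ∧
        ∫ ω, HeatSPDE.DU B P x h₁ ω * HeatSPDE.DU B P x h₂ ω ∂P =
          ∫ t in Ici (0 : ℝ), h₁ t *
            ((fun r : ℝ ↦ 1 / (2 * √(4 * Real.pi * |r|)))
              ⋆[ContinuousLinearMap.mul ℝ ℝ] HeatSPDE.antisymm h₂) t) ∧
    -- (iii)
    (∀ α : ℝ, 3 / 2 < α → ∀ x, x₀ ≤ x → ∃ V : Ω → HeatSPDE.E₁ α, Measurable V ∧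
      ∀ h : HeatSPDE.TestSpace, ∀ᵐ ω ∂P,
        (V ω).1 (HeatSPDE.WeightedC0.ofTest α h) = HeatSPDE.U B P x h ω) ∧
    -- (iv)
    (∀ ε : ℝ, 0 < ε → ∀ (w : HeatSPDE.Weight ε) (β : ℝ), 1 / 4 < β → ∀ x, x₀ ≤ x →
      ∃ V : Ω → HeatSPDE.E₂ w β, Measurable V ∧
      ∀ h : HeatSPDE.TestSpace, ∀ᵐ ω ∂P,
        V ω (HeatSPDE.WeightedSobolev.ofTest w β h) = HeatSPDE.DU B P x h ω) ∧
    -- (v)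
    (∀ α : ℝ, 3 / 2 < α → ∀ ε : ℝ, 0 < ε → ∀ (w : HeatSPDE.Weight ε) (β : ℝ), 1 / 4 < β →
      ∃ (V₁ : ℝ → Ω → HeatSPDE.E₁ α) (V₂ : ℝ → Ω → HeatSPDE.E₂ w β),
        -- joint measurability
        Measurable (fun p : Ω × Ici x₀ ↦ (V₁ p.2 p.1, V₂ p.2 p.1)) ∧
        -- version of the field
        (∀ x, x₀ ≤ x → ∀ h : HeatSPDE.TestSpace, ∀ᵐ ω ∂P,
          (V₁ x ω).1 (HeatSPDE.WeightedC0.ofTest α h) = HeatSPDE.U B P x h ω ∧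
          V₂ x ω (HeatSPDE.WeightedSobolev.ofTest w β h) = HeatSPDE.DU B P x h ω) ∧
        -- stationarity
        (∀ (n : ℕ) (x : Fin n → ℝ) (z : ℝ), (∀ k, x₀ ≤ x k) → 0 ≤ z →
          IdentDistrib (fun ω k ↦ (V₁ (x k + z) ω, V₂ (x k + z) ω))
            (fun ω k ↦ (V₁ (x k) ω, V₂ (x k) ω)) P P) ∧
        -- integrated second moments
        (∀ x, x₀ < x →
          (∫⁻ ω, (∫⁻ y in Ioc x₀ x, (‖V₁ y ω‖ₑ ^ 2 + ‖V₂ y ω‖ₑ ^ 2)) ∂P) < ∞) ∧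
        -- joint continuity
        ∃ u : ℝ → ℝ≥0 → Ω → ℝ,
          (∀ ω, ContinuousOn (fun p : ℝ × ℝ≥0 ↦ u p.1 p.2 ω) (Ici x₀ ×ˢ univ)) ∧
          (∀ ω x, x₀ ≤ x → u x 0 ω = 0 ∧ HeatSPDE.Represents (V₁ x ω).1 (fun t ↦ u x t ω)) ∧
          ∀ x, x₀ ≤ x → ∀ t, u x t =ᵐ[P] HeatSPDE.pointU B P x t) := by
  have hI := hB.isIsonormal
  refine ⟨⟨HeatSPDE.isWienerIntegral_wienerIntegralMap hB, fun x h ↦ ⟨h.isTest.memLp_kernelU x,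
      h.isTest.memLp_kernelDU x⟩, HeatSPDE.isGaussianProcess_field hB, HeatSPDE.integral_field hB⟩,
    fun h ↦ ⟨?_, ?_, fun A hA x hx ↦ HeatSPDE.U_eq_add_integral h hA hx,
      fun A hA x hx ↦ HeatSPDE.DU_eq_sub_integral h hA hx⟩, fun x hx ↦ ?_, fun α hα x hx ↦ ?_,
    fun ε hε w β hβ x hx ↦ ?_, fun α hα ε hε w β hβ ↦ ?_⟩
  · exact HeatSPDE.exists_isMeasurableVersion x₀ (HeatSPDE.uniformContinuous_duVec h)
      fun y ↦ h.isTest.DU_eq y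
  · exact HeatSPDE.exists_isMeasurableVersion x₀ h.isTest_deriv.uniformContinuous_uVec
      fun y ↦ h.isTest_deriv.U_eq y
  · have eU : ∀ h : HeatSPDE.TestSpace, HeatSPDE.U B P x h =
        HeatSPDE.wienerIntegralMap B P (HeatSPDE.uVec x h) := fun h ↦ h.isTest.U_eq x
    have eD : ∀ h : HeatSPDE.TestSpace, HeatSPDE.DU B P x h =
        HeatSPDE.wienerIntegralMap B P (HeatSPDE.duVec x h) := fun h ↦ h.isTest.DU_eq x
    simp only [eU, eD]
    exact ⟨hI.indepFun _ _ fun h k ↦ k.isTest.inner_uVec_duVec h.isTest x,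
      hI.isGaussianProcess fun h : HeatSPDE.TestSpace ↦ HeatSPDE.uVec x h,
      hI.isGaussianProcess fun h : HeatSPDE.TestSpace ↦ HeatSPDE.duVec x h,
      fun h ↦ ⟨hI.integral_eq_zero _, hI.integral_eq_zero _⟩, fun h₁ h₂ ↦
        ⟨(hI.integral_mul _ _).trans (HeatSPDE.inner_uVec_eq_convolution h₁ h₂ x),
          (hI.integral_mul _ _).trans (HeatSPDE.inner_duVec_eq_convolution h₁ h₂ x)⟩⟩
  · obtain ⟨X, hXm, -, hX⟩ := HeatSPDE.exists_continuous_compactified hB x₀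
    exact ⟨fun ω ↦ HeatSPDE.toE₁ hα (HeatSPDE.slice x₀ x (X ω)),
      (HeatSPDE.toE₁ hα).continuous.measurable.comp ((HeatSPDE.measurable_slice hXm.measurable).comp measurable_prodMk_right),
      HeatSPDE.toE₁_ofTest_ae hα hXm.measurable hX hx⟩
  · obtain ⟨e, Z, C, -, hℓ, hZm, -, -, hDU⟩ := HeatSPDE.exists_dualSeries_version w hB hε hβ
    exact ⟨fun ω ↦ HeatSPDE.dualSeries (fun n ↦ HeatSPDE.testFunctional w β (e n)) fun n ↦ Z n x ω,
      (HeatSPDE.measurable_dualSeries hℓ).comp (measurable_pi_lambda _ fun n ↦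
        (hZm n).comp measurable_prodMk_left), hDU x⟩
  · obtain ⟨V₁, V₂, hm, h⟩ := HeatSPDE.exists_stationary_version hB x₀ hα hε w hβ
    exact ⟨V₁, V₂, hm.comp (by fun_prop : Measurable fun p : Ω × Ici x₀ ↦ (p.1, (p.2 : ℝ))), h⟩

end
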